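/- A projective line segment with distinct endpoints $x,y\in\mathbb{RP}^2$ is either of the two closed arcs with endpoints $x,y$ of the projective line through $x$ and $y$. A set $X\subset\mathbb{RP}^2$ is \emph{convex} if any two points of $X$ are joined by a projective line segment contained in $X$ and $X$ is disjoint from some projective line. A \emph{projective convex hull} of $Y\subset\mathbb{RP}^2$ is an inclusion-wise minimal convex set containing $Y$ (it need not be unique). Let $P\subset\mathbb{RP}^2$ be finite and in general position, that is, no three points of $P$ lie on a common projective line, and let $k\ge 3$. A \emph{projective $k$-gon} determined by $P$ is a projective convex hull of a set $I$ of $k$ points of $P$ that has all points of $I$ on its boundary. A \emph{projective $k$-hole} in $P$ is a projective $k$-gon determined by $P$ with no point of $P$ in its interior. A \emph{projective $k$-island} in $P$ is a projective convex hull of a set $I$ of $k$ points of $P$ that contains no point of $P\setminus I$. The model of computation is a RAM with unit cost per instruction, which performs the arithmetic operations $+,-,\times$ and integer division on integers (of any size) in constant time, and which can add, subtract, multiply and compare (but not divide, round, or use as addresses) numbers obtained from the input coordinates; for integer coordinates this is a RAM with integer arithmetic. Space is measured in memory cells. \textbf{Theorem.} Let $n\ge 1$ and $m\ge 3$ be integers,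 and let $P$ be a set of $n$ points in $\mathbb{R}^2\subset\mathbb{RP}^2$ in general position, given by the list of their coordinates. (a) There is an algorithm which, given $m$ and $P$, computes the number of projective $k$-gons determined by $P$ and the number of projective $k$-holes in $P$ for all $k=3,\ldots,m$ in $O(m n^4)$ time and $O(m n^2)$ space. (b) There is an algorithm which, given $m$ and $P$, computes the number of projective $k$-islands in $P$ for all $k=3,\ldots,m$ in $O(m^2 n^5)$ time and $O(m^2 n^3)$ space. Each algorithm is a single fixed program, and the implied constants are absolute (independent of $m$, $n$ and $P$). -/

import Mathlib

open scoped LinearAlgebra.Projectivization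

/-! ### Convexity in the real projective plane -/

/-- The real projective plane. -/
abbrev RP2 : Type := ℙ ℝ (Fin 3 → ℝ)

/-- The usual topology: the quotient topology from `ℝ³ \ {0}`. -/
noncomputable instance RP2.instTopologicalSpace : TopologicalSpace RP2 :=
  TopologicalSpace.coinduced
    (fun v : {v : Fin 3 → ℝ // v ≠ 0} => Projectivization.mk ℝ v.1 v.2) inferInstance

/-- The standard embedding `ℝ² ⊂ RP²`, `(x, y) ↦ [x : y : 1]`. -/
noncomputable def affinePoint (q : ℝ × ℝ) : RP2 :=
  Projectivization.mk ℝ ![q.1, q.2, 1] (fun h => one_ne_zero (congrFun h 2))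

/-- Projective lines: the zero sets of nonzero linear forms on `ℝ³`. -/
def IsProjLine (L : Set RP2) : Prop :=
  ∃ a : RP2, L = {x | Projectivization.orthogonal a x}

/-- General position: no three distinct points of `P` lie on a common projective line. -/
def GeneralPosition (P : Set RP2) : Prop :=
  ∀ x ∈ P, ∀ y ∈ P, ∀ z ∈ P, x ≠ y → x ≠ z → y ≠ z →
    ¬ ∃ L : Set RP2, IsProjLine L ∧ x ∈ L ∧ y ∈ L ∧ z ∈ L

/-- `S` is a (closed) projective line segment with endpoints `x` and `y`. For `x ≠ y` there are
exactly two of them, obtained from representatives `(u, v)` and `(u, -v)`; for `x = y` the only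
one is `{x}`. -/
def IsProjSegment (x y : RP2) (S : Set RP2) : Prop :=
  ∃ (u v : Fin 3 → ℝ) (hu : u ≠ 0) (hv : v ≠ 0),
    Projectivization.mk ℝ u hu = x ∧ Projectivization.mk ℝ v hv = y ∧
    S = {z | ∃ (s t : ℝ) (h : s • u + t • v ≠ 0), 0 ≤ s ∧ 0 ≤ t ∧
      z = Projectivization.mk ℝ (s • u + t • v) h}

/-- Any two points of `X` can be joined by a line segment contained in `X`. -/
def ProjSemiconvex (X : Set RP2) : Prop :=
  ∀ x ∈ X, ∀ y ∈ X, ∃ S : Set RP2, IsProjSegment x y S ∧ S ⊆ X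

/-- A set is convex if it is semiconvex and contained in a plane, that is, in the complement of
some projective line. -/
def ProjConvex (X : Set RP2) : Prop :=
  ProjSemiconvex X ∧ ∃ L : Set RP2, IsProjLine L ∧ Disjoint X L

/-- `H` is a projective convex hull of `Y`: an inclusion-wise minimal convex set containing `Y`.
Such a set is in general not unique. -/
def IsProjHull (Y H : Set RP2) : Prop :=
  Minimal (fun X : Set RP2 => ProjConvex X ∧ Y ⊆ X) H

/-- `G` is a projective `k`-gon determined by `P`. -/
def IsProjGon (P : Set RP2) (k : ℕ) (G : Set RP2) : Prop :=
  ∃ I : Set RP2, I ⊆ P ∧ I.ncard = k ∧ IsProjHull I G ∧ I ⊆ frontier G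

/-- `G` is a projective `k`-hole in `P`. -/
def IsProjHole (P : Set RP2) (k : ℕ) (G : Set RP2) : Prop :=
  IsProjGon P k G ∧ Disjoint (interior G) P

/-- `G` is a projective `k`-island in `P`. -/
def IsProjIsland (P : Set RP2) (k : ℕ) (G : Set RP2) : Prop :=
  ∃ I : Set RP2, I ⊆ P ∧ I.ncard = k ∧ IsProjHull I G ∧ Disjoint G (P \ I)

/-- The integer `c` is the number of sets in the family `F`, which is finite. -/
def IsCount (c : ℤ) (F : Set (Set RP2)) : Prop :=
  F.Finite ∧ c = (F.ncard : ℤ)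

/-! ### The random access machine

A unit-cost RAM with finitely many registers (those named in the program) and an indirectly
addressed memory. It has cells that hold integers, on which the four arithmetic operations,
comparisons, and addressing are available, and cells that hold coordinates, on which only addition,
subtraction, multiplication, and comparisons are available. Coordinates cannot be converted to
integers or used as addresses. If all input coordinates are integers, all contents of all cells
stay integers, and the machine is a plain RAM with integer arithmetic. -/

namespace RAM

/-- Arithmetic on integer registers; `div` is integer division. -/
inductive IntOp
  | add | sub | mul | div

/-- Arithmetic on coordinate registers. -/
inductive CoordOp
  | add | sub | mul

/-- Result of an integer operation. -/
def IntOp.eval : IntOp → ℤ → ℤ → ℤ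
  | .add, a, b => a + b
  | .sub, a, b => a - b
  | .mul, a, b => a * b
  | .div, a, b => a / b

/-- Result of a coordinate operation. -/
noncomputable def CoordOp.eval : CoordOp → ℝ → ℝ → ℝ
  | .add, a, b => a + b
  | .sub, a, b => a - b
  | .mul, a, b => a * b

/-- The instructions. Arguments `d`, `a`, `b`, `s` are register numbers (`d` is the destination),
`c` is an integer constant, and `l` is a position in the program. The prefix `c` in a name marks
the instructions on coordinate registers and coordinate memory; addresses are always taken from
the integer register `a`. -/
inductive Instr
  | const (d : ℕ) (c : ℤ)
  | arith (op : IntOp) (d a b : ℕ)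
  | load (d a : ℕ)
  | store (a s : ℕ)
  | jumpLt (a b l : ℕ)
  | cconst (d : ℕ) (c : ℤ)
  | carith (op : CoordOp) (d a b : ℕ)
  | cload (d a : ℕ)
  | cstore (a s : ℕ)
  | cjumpLt (a b l : ℕ)
  | jump (l : ℕ)

/-- A program is a finite list of instructions. -/
abbrev Program : Type := List Instr

/-- A configuration: the program counter, the integer and coordinate registers, and the integer
and coordinate memory. -/
structure State where
  pc : ℕ
  reg : ℕ → ℤ
  creg : ℕ → ℝ
  mem : ℕ → ℤ
  cmem : ℕ → ℝ

/-- The effect of one instruction. -/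
noncomputable def Instr.exec (i : Instr) (σ : State) : State :=
  match i with
  | .const d c => { σ with pc := σ.pc + 1, reg := Function.update σ.reg d c }
  | .arith op d a b =>
      { σ with pc := σ.pc + 1, reg := Function.update σ.reg d (op.eval (σ.reg a) (σ.reg b)) }
  | .load d a =>
      { σ with pc := σ.pc + 1, reg := Function.update σ.reg d (σ.mem (σ.reg a).toNat) }
  | .store a s =>
      { σ with pc := σ.pc + 1, mem := Function.update σ.mem (σ.reg a).toNat (σ.reg s) }
  | .jumpLt a b l => { σ with pc := if σ.reg a < σ.reg b then l else σ.pc + 1 }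
  | .cconst d c => { σ with pc := σ.pc + 1, creg := Function.update σ.creg d (c : ℝ) }
  | .carith op d a b =>
      { σ with pc := σ.pc + 1, creg := Function.update σ.creg d (op.eval (σ.creg a) (σ.creg b)) }
  | .cload d a =>
      { σ with pc := σ.pc + 1, creg := Function.update σ.creg d (σ.cmem (σ.reg a).toNat) }
  | .cstore a s =>
      { σ with pc := σ.pc + 1, cmem := Function.update σ.cmem (σ.reg a).toNat (σ.creg s) }
  | .cjumpLt a b l => { σ with pc := if σ.creg a < σ.creg b then l else σ.pc + 1 }
  | .jump l => { σ with pc := l }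

/-- The memory address used by the instruction (if there is one) lies in `[0, S)`. -/
def Instr.InSpace (S : ℕ) (i : Instr) (σ : State) : Prop :=
  match i with
  | .load _ a => 0 ≤ σ.reg a ∧ σ.reg a < S
  | .store a _ => 0 ≤ σ.reg a ∧ σ.reg a < S
  | .cload _ a => 0 ≤ σ.reg a ∧ σ.reg a < S
  | .cstore a _ => 0 ≤ σ.reg a ∧ σ.reg a < S
  | _ => True

/-- `Run prog S σ t τ`: started in `σ`, the program reaches `τ` in exactly `t` steps, and during
these steps both memories are accessed only at addresses in `[0, S)`. -/
inductive Run (prog : Program) (S : ℕ) : State → ℕ → State → Prop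
  | refl (σ : State) : Run prog S σ 0 σ
  | step {σ τ : State} {t : ℕ} {i : Instr} (hi : prog[σ.pc]? = some i) (hS : i.InSpace S σ)
      (h : Run prog S (i.exec σ) t τ) : Run prog S σ (t + 1) τ

/-- The machine halts when the program counter leaves the program. -/
def Halted (prog : Program) (σ : State) : Prop := prog.length ≤ σ.pc

/-- The initial configuration: integer registers `0` and `1` hold `n` and `m`, the cells `2 * i` and
`2 * i + 1` of the coordinate memory hold the two coordinates of the `i`-th point, and everything
else is `0`. -/
noncomputable def start {n : ℕ} (m : ℕ) (p : Fin n → ℝ × ℝ) : State where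
  pc := 0
  reg := fun j => if j = 0 then (n : ℤ) else if j = 1 then (m : ℤ) else 0
  creg := fun _ => 0
  mem := fun _ => 0
  cmem := fun j => if h : j / 2 < n then
    (if j % 2 = 0 then (p ⟨j / 2, h⟩).1 else (p ⟨j / 2, h⟩).2) else 0

/-- On the input `m` and `p`, the program halts after at most `T` steps, using only the first `S`
cells of each memory, in a configuration whose integer memory satisfies `Out`. -/
def Solves {n : ℕ} (prog : Program) (m : ℕ) (p : Fin n → ℝ × ℝ) (T S : ℕ)
    (Out : (ℕ → ℤ) → Prop) : Prop :=
  ∃ (t : ℕ) (τ : State), t ≤ T ∧ Run prog S (start m p) t τ ∧ Halted prog τ ∧ Out τ.mem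

end RAM

/-! Lift the plane to ℝ³ and give every input point both signs: the number `u < n` stands for the
vector `(x, y, 1)` and `u + n` for its negative. A projectively convex set misses a line, so the
hulls of `I` are the images of the cones spanned by sign choices for `I` on which some linear form
is positive (`projCone_subset`, `isProjHull_projCone`, `IsProjHull.eq_projCone`). In general
position, the extreme rays of such a cone over at least three points form a cyclic list of signed
points all of whose triples, in order, have positive determinant. The list is unique up to rotation
and a global change of sign. Starting it at the vertex `r` of least index, with positive sign, gives
a bijection between regions and the lists of `IsPoly` (`exists_isPoly`, `IsPoly.eq_of_region`). From
there on only signs of determinants matter.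

Such lists are built vertex by vertex. With root `r`, second vertex `b` and last two vertices `c`,
`a`, a new vertex `y` is allowed if `(r,b,y)`, `(r,a,y)` and `(c,a,y)` are positive; Plücker
relations then make all triples positive (`Chain.convex`, with converse `Convex.chain`). The
triangles `(r,a,y)` form a fan triangulation, so the number of points inside is additive along the
chain and can be encoded in step weights: 1 for gons; 1 for holes, or `m + 1` if the triangle is not
empty; 1 plus the number of points in the triangle for islands. A step to an index not above the
root weighs `m + 1`. Only weights up to `m` are recorded, so the chains of weight `k` are exactly
the wanted polygons of size `k` (`Chain.wt_eq_iff`, `total_eq_card`).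

Let `g a y k` be the number of chains of weight `k` with last step from `a` to `y`. It is a sum over
those `c` for which `(c,a,y)` is positive. Since `det (c,a,y) = det (a,-c,y)`, this says that the
antipode of `c` precedes `y` in the angular order around `a` that starts at the antipode of `r`. One
rotational sweep around `a`, adding to an accumulator at antipodes of predecessors and reading it at
candidates `y`, therefore serves all pairs `(c, y)` in `O(mn)` steps. Processing the ends `a` in
angular order around `r`, starting at `b`, makes the required table entries available (`runOK`).
There are `O(n²)` pairs `(r,b)` and `O(n)` ends `a` for each, hence `O(mn⁴)` steps in total, and one
table of `O(mn²)` cells is reused.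

The program is written in a small structured language with a denotational semantics, a verified
compiler (`Cmd.correct`) and a compositional cost function. Islands use the same program with other
weights, so they meet the bounds of part (b) with room to spare. -/

open scoped Matrix

/-! ### A structured language on top of the random access machine -/

namespace RAM

/-- Primitive commands. Variables are numbered by `ℕ`; there are five three-dimensional arrays. -/
inductive Prim
  | set (x c : ℕ)
  | plus (x y z : ℕ)
  | modn (x y : ℕ)
  | ld (x : ℕ) (A : Fin 5) (i j k : ℕ)
  | st (A : Fin 5) (i j k x : ℕ)
  | out (x y : ℕ)

/-- Tests: comparison of variables, and orientation of three points. -/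
inductive Test
  | lt (x y : ℕ)
  | pos (u v w : ℕ)

/-- Structured commands. -/
inductive Cmd
  | prim (p : Prim)
  | skip
  | seq (c d : Cmd)
  | ite (t : Test) (c d : Cmd)
  | loop (x b : ℕ) (c : Cmd)

/-- Values of the variables, of the arrays, and of the output cells. -/
structure St where
  v : ℕ → ℕ
  a : Fin 5 → ℕ → ℕ → ℕ → ℕ
  raw : ℕ → ℕ

/-- Assignment to a variable. -/
def St.put (σ : St) (x c : ℕ) : St := { σ with v := Function.update σ.v x c }

/-- Assignment to an array cell. -/
def upd (f : ℕ → ℕ → ℕ → ℕ) (i j k c : ℕ) : ℕ → ℕ → ℕ → ℕ :=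
  fun i' j' k' => if i' = i ∧ j' = j ∧ k' = k then c else f i' j' k'

/-- Effect of a primitive command. Indices are reduced modulo the sizes of the arrays. -/
def Prim.den (n m : ℕ) : Prim → St → St
  | .set x c, σ => σ.put x c
  | .plus x y z, σ => σ.put x (σ.v y + σ.v z)
  | .modn x y, σ => σ.put x (σ.v y % n)
  | .ld x A i j k, σ =>
      σ.put x (σ.a A (σ.v i % (2 * n)) (σ.v j % (2 * n)) (σ.v k % (m + 1)))
  | .st A i j k x, σ => ⟨σ.v, Function.update σ.a A
      (upd (σ.a A) (σ.v i % (2 * n)) (σ.v j % (2 * n)) (σ.v k % (m + 1)) (σ.v x)), σ.raw⟩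
  | .out x y, σ => ⟨σ.v, σ.a, Function.update σ.raw (σ.v x % (2 * m + 1))
      (σ.raw (σ.v x % (2 * m + 1)) + σ.v y)⟩

/-- Meaning of a test, relative to an orientation predicate. -/
def Test.Holds (o : ℕ → ℕ → ℕ → Prop) : Test → St → Prop
  | .lt x y, σ => σ.v x < σ.v y
  | .pos u v w, σ => o (σ.v u) (σ.v v) (σ.v w)

/-- Iteration with a counter. -/
def iter {α : Type} (f : ℕ → α → α) : ℕ → α → α
  | 0, s => s
  | k + 1, s => f k (iter f k s)

open Classical in
/-- Effect of a command. -/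
noncomputable def Cmd.den (n m : ℕ) (o : ℕ → ℕ → ℕ → Prop) : Cmd → St → St
  | .prim p, σ => p.den n m σ
  | .skip, σ => σ
  | .seq c d, σ => d.den n m o (c.den n m o σ)
  | .ite t c d, σ => if t.Holds o σ then c.den n m o σ else d.den n m o σ
  | .loop x b c, σ =>
      (iter (fun i τ => c.den n m o (τ.put x i)) (σ.v b) σ).put x (σ.v b)

/-- The variables written by a command. -/
def Cmd.wr : Cmd → List ℕ
  | .prim (.set x _) => [x]
  | .prim (.plus x _ _) => [x]
  | .prim (.modn x _) => [x]
  | .prim (.ld x _ _ _ _) => [x]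
  | .prim (.st _ _ _ _ _) => []
  | .prim (.out _ _) => []
  | .skip => []
  | .seq c d => c.wr ++ d.wr
  | .ite _ c d => c.wr ++ d.wr
  | .loop x _ c => x :: c.wr

/-- The arrays written by a command. -/
def Cmd.wrA : Cmd → List (Fin 5)
  | .prim (.st A _ _ _ _) => [A]
  | .prim _ => []
  | .skip => []
  | .seq c d => c.wrA ++ d.wrA
  | .ite _ c d => c.wrA ++ d.wrA
  | .loop _ _ c => c.wrA

/-- The command writes no output. -/
def Cmd.quiet : Cmd → Bool
  | .prim (.out _ _) => false
  | .prim _ => true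
  | .skip => true
  | .seq c d => c.quiet && d.quiet
  | .ite _ c d => c.quiet && d.quiet
  | .loop _ _ c => c.quiet

/-- Variable numbers that are not used as temporary registers. -/
def vis (x : ℕ) : Bool := x < 10 || 40 ≤ x

/-- Well-formedness of a primitive command. -/
def Prim.wf : Prim → Bool
  | .set x _ => 40 ≤ x
  | .plus x y z => 40 ≤ x && vis y && vis z
  | .modn x y => 40 ≤ x && vis y
  | .ld x _ i j k => 40 ≤ x && vis i && vis j && vis k
  | .st _ i j k x => vis i && vis j && vis k && vis x
  | .out x y => vis x && vis y

/-- Well-formedness of a test. -/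
def Test.wf : Test → Bool
  | .lt x y => vis x && vis y
  | .pos u v w => vis u && vis v && vis w

/-- Well-formedness of a command. -/
def Cmd.wf : Cmd → Bool
  | .prim p => p.wf
  | .skip => true
  | .seq c d => c.wf && d.wf
  | .ite t c d => t.wf && c.wf && d.wf
  -- Loop limits are constant registers, which no well-formed command writes, so re-reading the
  -- limit at every test gives the same value. Since the body cannot write the counter either, the
  -- number of rounds is fixed on entry.
  | .loop x b c => 40 ≤ x && b < 9 && c.wf && !(c.wr.contains x)

/-! ### Invariants and frame properties of commands -/

theorem iter_inv {α : Type} (f : ℕ → α → α) (P : ℕ → α → Prop) (N : ℕ) (s : α) (h0 : P 0 s)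
    (hs : ∀ i, i < N → ∀ τ, P i τ → P (i + 1) (f i τ)) : P N (iter f N s) := by
  induction N with
  | zero => exact h0
  | succ k ih =>
    exact hs k (Nat.lt_succ_self k) _ (ih fun i hi => hs i (Nat.lt_succ_of_lt hi))

theorem Cmd.den_v {n m : ℕ} {o : ℕ → ℕ → ℕ → Prop} (c : Cmd) {x : ℕ} (hx : x ∉ c.wr) (σ : St) :
    (c.den n m o σ).v x = σ.v x := by
  induction c generalizing σ with
  | prim p => cases p <;> simp_all [Cmd.wr, Cmd.den, Prim.den, St.put]
  | skip => rfl
  | seq c d ihc ihd =>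
    simp only [Cmd.wr, List.mem_append, not_or] at hx
    simp only [Cmd.den]
    rw [ihd hx.2, ihc hx.1]
  | ite t c d ihc ihd =>
    simp only [Cmd.wr, List.mem_append, not_or] at hx
    simp only [Cmd.den]
    split_ifs
    · exact ihc hx.1 σ
    · exact ihd hx.2 σ
  | loop y b c ih =>
    simp only [Cmd.wr, List.mem_cons, not_or] at hx
    simp only [Cmd.den, St.put, Function.update_apply, hx.1, if_false]
    refine iter_inv _ (fun _ (τ : St) => τ.v x = σ.v x) _ _ rfl fun i _ τ hτ => ?_
    rw [ih hx.2]
    simpa [Function.update_apply, hx.1] using hτ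

theorem Cmd.den_a {n m : ℕ} {o : ℕ → ℕ → ℕ → Prop} (c : Cmd) {A : Fin 5} (hx : A ∉ c.wrA)
    (σ : St) : (c.den n m o σ).a A = σ.a A := by
  induction c generalizing σ with
  | prim p => cases p <;> simp_all [Cmd.wrA, Cmd.den, Prim.den, St.put]
  | skip => rfl
  | seq c d ihc ihd =>
    simp only [Cmd.wrA, List.mem_append, not_or] at hx
    simp only [Cmd.den]
    rw [ihd hx.2, ihc hx.1]
  | ite t c d ihc ihd =>
    simp only [Cmd.wrA, List.mem_append, not_or] at hx
    simp only [Cmd.den]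
    split_ifs
    · exact ihc hx.1 σ
    · exact ihd hx.2 σ
  | loop y b c ih =>
    simp only [Cmd.wrA] at hx
    simp only [Cmd.den, St.put]
    refine iter_inv _ (fun _ (τ : St) => τ.a A = σ.a A) _ _ rfl fun i _ τ hτ => ?_
    rw [ih hx]
    exact hτ

theorem Cmd.den_raw {n m : ℕ} {o : ℕ → ℕ → ℕ → Prop} (c : Cmd) (hx : c.quiet = true)
    (σ : St) : (c.den n m o σ).raw = σ.raw := by
  induction c generalizing σ with
  | prim p => cases p <;> simp_all [Cmd.quiet, Cmd.den, Prim.den, St.put]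
  | skip => rfl
  | seq c d ihc ihd =>
    simp only [Cmd.quiet, Bool.and_eq_true] at hx
    simp only [Cmd.den]
    rw [ihd hx.2, ihc hx.1]
  | ite t c d ihc ihd =>
    simp only [Cmd.quiet, Bool.and_eq_true] at hx
    simp only [Cmd.den]
    split_ifs
    · exact ihc hx.1 σ
    · exact ihd hx.2 σ
  | loop y b c ih =>
    simp only [Cmd.quiet] at hx
    simp only [Cmd.den, St.put]
    refine iter_inv _ (fun _ (τ : St) => τ.raw = σ.raw) _ _ rfl fun i _ τ hτ => ?_
    rw [ih hx]
    exact hτ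

/-- The rule for loops: in addition to the invariant, everything that the body does not write is
unchanged. -/
theorem Cmd.loop_rule {n m : ℕ} {o : ℕ → ℕ → ℕ → Prop} {x b : ℕ} {c : Cmd} {σ : St} {N : ℕ}
    (hN : σ.v b = N) (P : ℕ → St → Prop) (h0 : P 0 σ)
    (hs : ∀ i, i < N → ∀ τ : St, (∀ y, y ≠ x → y ∉ c.wr → τ.v y = σ.v y) →
      (∀ A, A ∉ c.wrA → τ.a A = σ.a A) → (c.quiet = true → τ.raw = σ.raw) →
      P i τ → P (i + 1) (c.den n m o (τ.put x i)))
    (hput : ∀ τ, P N τ → P N (τ.put x N)) :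
    P N ((Cmd.loop x b c).den n m o σ) := by
  subst hN
  simp only [Cmd.den]
  refine hput _ (iter_inv _ (fun i (τ : St) => ((∀ y, y ≠ x → y ∉ c.wr → τ.v y = σ.v y) ∧
      (∀ A, A ∉ c.wrA → τ.a A = σ.a A) ∧ (c.quiet = true → τ.raw = σ.raw)) ∧ P i τ) _ _
    ⟨⟨fun _ _ _ => rfl, fun _ _ => rfl, fun _ => rfl⟩, h0⟩ ?_).2
  rintro i hi τ ⟨⟨h1, h2, h3⟩, h4⟩
  refine ⟨⟨fun y hy hyc => ?_, fun A hA => ?_, fun hq => ?_⟩, hs i hi τ h1 h2 h3 h4⟩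
  · rw [Cmd.den_v c hyc]
    simpa [St.put, Function.update_apply, hy] using h1 y hy hyc
  · rw [Cmd.den_a c hA]
    exact h2 A hA
  · rw [Cmd.den_raw c hq]
    exact h3 hq

/-! ### Compilation -/

/-- `d := s mod b`. -/
def red (d s b : ℕ) : List Instr :=
  [.arith .div 20 s b, .arith .mul 20 20 b, .arith .sub d s 20]

/-- Computes the address of an array cell in register `10`. -/
def addrCode (A : Fin 5) (i j k : ℕ) : List Instr :=
  red 10 i 2 ++ (red 11 j 2 ++ (red 12 k 3 ++
    [.arith .mul 10 10 2, .arith .add 10 10 11, .arith .mul 10 10 3, .arith .add 10 10 12,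
     .arith .mul 10 10 5, .const 11 (A : ℕ), .arith .add 10 10 11, .arith .add 10 10 8]))

/-- Address of an array cell. -/
def addr (n m : ℕ) (A : Fin 5) (i j k : ℕ) : ℕ :=
  ((i * (2 * n) + j) * (m + 1) + k) * 5 + A + (2 * m + 1)

/-- Code of the primitive commands. -/
def Prim.code : Prim → List Instr
  | .set x c => [.const x c]
  | .plus x y z => [.arith .add x y z]
  | .modn x y => red x y 0
  | .ld x A i j k => addrCode A i j k ++ [.load x 10]
  | .st A i j k x => addrCode A i j k ++ [.store 10 x]
  | .out x y => red 10 x 8 ++ [.load 11 10, .arith .add 11 11 y, .store 10 11]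

/-- Loads the homogeneous coordinates of a signed point. -/
def ptCode (u d : ℕ) : List Instr :=
  red 10 u 2 ++
    [.arith .div 11 10 0, .arith .mul 12 11 0, .arith .sub 10 10 12, .arith .add 10 10 10,
     .cload d 10, .arith .add 10 10 6, .cload (d + 1) 10, .arith .add 11 11 2, .cload (d + 2) 11,
     .carith .mul d d (d + 2), .carith .mul (d + 1) (d + 1) (d + 2)]

/-- Computes a determinant in coordinate register `10`, and `0` in coordinate register `9`. -/
def detCode : List Instr :=
  [.carith .mul 10 4 8, .carith .mul 11 5 7, .carith .sub 10 10 11, .carith .mul 10 0 10,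
   .carith .mul 11 5 6, .carith .mul 12 3 8, .carith .sub 11 11 12, .carith .mul 11 1 11,
   .carith .add 10 10 11,
   .carith .mul 11 3 7, .carith .mul 12 4 6, .carith .sub 11 11 12, .carith .mul 11 2 11,
   .carith .add 10 10 11, .cconst 9 0]

/-- Code of the preparation of a test. -/
def Test.code : Test → List Instr
  | .lt _ _ => []
  | .pos u v w => ptCode u 0 ++ (ptCode v 3 ++ (ptCode w 6 ++ detCode))

/-- The conditional jump of a test. -/
def Test.jump : Test → ℕ → Instr
  | .lt x y, l => .jumpLt x y l
  | .pos _ _ _, l => .cjumpLt 9 10 l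

/-- Length of the code of a command. -/
def Cmd.len : Cmd → ℕ
  | .prim p => p.code.length
  | .skip => 0
  | .seq c d => c.len + d.len
  | .ite t c d => t.code.length + (1 + (d.len + (1 + c.len)))
  | .loop _ _ c => 3 + (c.len + 2)

/-- Code of a command that is to be placed at position `l`. -/
def Cmd.code : Cmd → ℕ → List Instr
  | .prim p, _ => p.code
  | .skip, _ => []
  | .seq c d, l => c.code l ++ d.code (l + c.len)
  | .ite t c d, l => t.code ++ ([t.jump (l + t.code.length + 1 + d.len + 1)] ++
      (d.code (l + t.code.length + 1) ++ ([.jump (l + t.code.length + 1 + d.len + 1 + c.len)] ++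
        c.code (l + t.code.length + 1 + d.len + 1))))
  | .loop x b c, l => [.const x 0, .jumpLt x b (l + 3), .jump (l + 3 + c.len + 2)] ++
      (c.code (l + 3) ++ [.arith .add x x 6, .jump (l + 1)])

theorem Cmd.length_code (c : Cmd) (l : ℕ) : (c.code l).length = c.len := by
  induction c generalizing l with
  | prim p => rfl
  | skip => rfl
  | seq c d ihc ihd => simp [Cmd.code, Cmd.len, ihc, ihd]
  | ite t c d ihc ihd => simp [Cmd.code, Cmd.len, ihc, ihd]; omega
  | loop x b c ih => simp [Cmd.code, Cmd.len, ih]; omega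

/-- Upper bound for the running time, given upper bounds for the loop limits. -/
def Cmd.cost (bd : ℕ → ℕ) : Cmd → ℕ
  | .prim p => p.code.length
  | .skip => 0
  | .seq c d => c.cost bd + d.cost bd
  | .ite t c d => t.code.length + 2 + c.cost bd + d.cost bd
  | .loop _ b c => 3 + bd b * (c.cost bd + 3)

/-! ### Executing compiled code and relating machine states to abstract states -/

/-- The code `is` stands at position `l` of the program. -/
def At (prog : Program) (l : ℕ) (is : List Instr) : Prop :=
  ∃ pre post, prog = pre ++ is ++ post ∧ pre.length = l

theorem At.left {prog : Program} {l : ℕ} {a b : List Instr} (h : At prog l (a ++ b)) :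
    At prog l a := by
  obtain ⟨p, q, h1, h2⟩ := h
  exact ⟨p, b ++ q, by simp [h1], h2⟩

theorem At.right {prog : Program} {l : ℕ} {a b : List Instr} (h : At prog l (a ++ b)) :
    At prog (l + a.length) b := by
  obtain ⟨p, q, h1, h2⟩ := h
  exact ⟨p ++ a, q, by simp [h1], by simp [h2]⟩

theorem At.head {prog : Program} {l : ℕ} {i : Instr} {b : List Instr} (h : At prog l (i :: b)) :
    prog[l]? = some i := by
  obtain ⟨p, q, h1, h2⟩ := h
  subst h1 h2
  simp

theorem At.tail {prog : Program} {l : ℕ} {i : Instr} {b : List Instr} (h : At prog l (i :: b)) :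
    At prog (l + 1) b := by
  simpa using At.right (a := [i]) h

theorem Run.trans {prog : Program} {S : ℕ} {σ τ υ : State} {s t : ℕ} (h : Run prog S σ s τ)
    (h' : Run prog S τ t υ) : Run prog S σ (s + t) υ := by
  induction h with
  | refl => simpa using h'
  | step hi hS _ ih =>
    rw [Nat.add_right_comm]
    exact Run.step hi hS (ih h')

theorem Run.one {prog : Program} {S : ℕ} {σ : State} {i : Instr} (hi : prog[σ.pc]? = some i)
    (hS : i.InSpace S σ) : Run prog S σ 1 (i.exec σ) :=
  Run.step hi hS (Run.refl _)

/-- Instructions that are not jumps. -/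
def Instr.straight : Instr → Bool
  | .jumpLt _ _ _ => false
  | .cjumpLt _ _ _ => false
  | .jump _ => false
  | _ => true

/-- Execution of a list of instructions one after the other. -/
noncomputable def execs : List Instr → State → State
  | [], σ => σ
  | i :: is, σ => execs is (i.exec σ)

/-- All memory accesses of the successive instructions are in the allowed range. -/
def SpaceOK (S : ℕ) : List Instr → State → Prop
  | [], _ => True
  | i :: is, σ => i.InSpace S σ ∧ SpaceOK S is (i.exec σ)

theorem execs_append (a b : List Instr) (σ : State) :
    execs (a ++ b) σ = execs b (execs a σ) := by
  induction a generalizing σ with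
  | nil => rfl
  | cons i a ih => exact ih _

theorem SpaceOK.append {S : ℕ} {a b : List Instr} {σ : State} (ha : SpaceOK S a σ)
    (hb : SpaceOK S b (execs a σ)) : SpaceOK S (a ++ b) σ := by
  induction a generalizing σ with
  | nil => exact hb
  | cons i a ih => exact ⟨ha.1, ih ha.2 hb⟩

theorem pc_exec {i : Instr} (h : i.straight = true) (σ : State) : (i.exec σ).pc = σ.pc + 1 := by
  cases i <;> simp_all [Instr.straight, Instr.exec]

theorem run_straight {prog : Program} {S : ℕ} {is : List Instr}
    (hst : ∀ i ∈ is, i.straight = true) {σ : State} (hat : At prog σ.pc is)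
    (hS : SpaceOK S is σ) :
    Run prog S σ is.length (execs is σ) ∧ (execs is σ).pc = σ.pc + is.length := by
  induction is generalizing σ with
  | nil => exact ⟨Run.refl _, rfl⟩
  | cons i is ih =>
    have hpc := pc_exec (hst i (by simp)) σ
    have := ih (fun j hj => hst j (by simp [hj])) (σ := i.exec σ) (by rw [hpc]; exact hat.tail) hS.2
    refine ⟨Run.step hat.head hS.1 this.1, ?_⟩
    rw [execs, this.2, hpc, List.length_cons]
    omega

/-- Values of the constants kept in the registers `0, …, 8`. -/
structure Consts (n m : ℕ) (v : ℕ → ℕ) : Prop where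
  c0 : v 0 = n
  c1 : v 1 = m
  c2 : v 2 = 2 * n
  c3 : v 3 = m + 1
  c4 : v 4 = n - 1
  c5 : v 5 = 5
  c6 : v 6 = 1
  c7 : v 7 = 0
  c8 : v 8 = 2 * m + 1

/-- The machine state `ρ` represents the abstract state `σ`. -/
structure Rel (n m : ℕ) (cm : ℕ → ℝ) (σ : St) (ρ : State) : Prop where
  consts : Consts n m σ.v
  var : ∀ x, vis x = true → ρ.reg x = σ.v x
  raw : ∀ i, i < 2 * m + 1 → ρ.mem i = σ.raw i
  arr : ∀ A i j k, i < 2 * n → j < 2 * n → k < m + 1 → ρ.mem (addr n m A i j k) = σ.a A i j k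
  cmem : ρ.cmem = cm

/-- Only temporary registers differ. -/
structure Tmp (ρ ρ' : State) : Prop where
  reg : ∀ x, vis x = true → ρ'.reg x = ρ.reg x
  mem : ρ'.mem = ρ.mem
  cmem : ρ'.cmem = ρ.cmem

theorem Rel.tmp {n m : ℕ} {cm : ℕ → ℝ} {σ : St} {ρ ρ' : State} (h : Rel n m cm σ ρ)
    (h' : Tmp ρ ρ') : Rel n m cm σ ρ' where
  consts := h.consts
  var x hx := (h'.reg x hx).trans (h.var x hx)
  raw i hi := by rw [h'.mem]; exact h.raw i hi
  arr A i j k hi hj hk := by rw [h'.mem]; exact h.arr A i j k hi hj hk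
  cmem := h'.cmem.trans h.cmem

theorem vis_ne {x : ℕ} (hx : vis x = true) {y : ℕ} (h1 : 10 ≤ y) (h2 : y < 40) : x ≠ y := by
  rintro rfl
  simp only [vis, Bool.or_eq_true, decide_eq_true_eq] at hx
  omega

/-- The machine has no remainder instruction; `s - (s / b) * b` replaces it, and on nonnegative
values integer division agrees with division in `ℕ`. -/
theorem red_reg {d s b : ℕ} (hs : s ≠ 20) (hb : b ≠ 20) (ρ : State) (p q : ℕ)
    (h1 : ρ.reg s = p) (h2 : ρ.reg b = q) :
    (execs (red d s b) ρ).reg d = ((p % q : ℕ) : ℤ) := by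
  simp [execs, red, Instr.exec, IntOp.eval, hs, hb, h1, h2]
  have := Int.emod_def (p : ℤ) (q : ℤ)
  rw [this, mul_comm]

theorem red_frame {d s b x : ℕ} (ρ : State) (h1 : x ≠ 20) (h2 : x ≠ d) :
    (execs (red d s b) ρ).reg x = ρ.reg x := by
  simp [execs, red, Instr.exec, h1, h2]

theorem red_mem {d s b : ℕ} (ρ : State) : (execs (red d s b) ρ).mem = ρ.mem := rfl

theorem red_cmem {d s b : ℕ} (ρ : State) : (execs (red d s b) ρ).cmem = ρ.cmem := rfl

theorem red_creg {d s b : ℕ} (ρ : State) : (execs (red d s b) ρ).creg = ρ.creg := rfl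

theorem addrCode_tmp (A : Fin 5) (i j k : ℕ) (ρ : State) :
    Tmp ρ (execs (addrCode A i j k) ρ) := by
  refine ⟨fun x hx => ?_, rfl, rfl⟩
  have h10 := vis_ne hx (y := 10) (by norm_num) (by norm_num)
  have h11 := vis_ne hx (y := 11) (by norm_num) (by norm_num)
  have h12 := vis_ne hx (y := 12) (by norm_num) (by norm_num)
  have h20 := vis_ne hx (y := 20) (by norm_num) (by norm_num)
  simp [execs, addrCode, red, Instr.exec, h10, h11, h12, h20]

theorem addrCode_reg {n m : ℕ} {cm : ℕ → ℝ} {σ : St} {ρ : State} (h : Rel n m cm σ ρ)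
    (A : Fin 5) {i j k : ℕ} (hi : vis i = true) (hj : vis j = true) (hk : vis k = true) :
    (execs (addrCode A i j k) ρ).reg 10 =
      (addr n m A (σ.v i % (2 * n)) (σ.v j % (2 * n)) (σ.v k % (m + 1)) : ℕ) := by
  have hn : ∀ x, vis x = true → x ≠ 10 ∧ x ≠ 11 ∧ x ≠ 12 ∧ x ≠ 20 := fun x hx =>
    ⟨vis_ne hx (by norm_num) (by norm_num), vis_ne hx (by norm_num) (by norm_num),
      vis_ne hx (by norm_num) (by norm_num), vis_ne hx (by norm_num) (by norm_num)⟩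
  obtain ⟨i1, i2, i3, i4⟩ := hn i hi
  obtain ⟨j1, j2, j3, j4⟩ := hn j hj
  obtain ⟨k1, k2, k3, k4⟩ := hn k hk
  have e2 : ρ.reg 2 = ((2 * n : ℕ) : ℤ) := by rw [h.var 2 rfl, h.consts.c2]
  have e3 : ρ.reg 3 = ((m + 1 : ℕ) : ℤ) := by rw [h.var 3 rfl, h.consts.c3]
  have e5 : ρ.reg 5 = ((5 : ℕ) : ℤ) := by rw [h.var 5 rfl, h.consts.c5]
  have e8 : ρ.reg 8 = ((2 * m + 1 : ℕ) : ℤ) := by rw [h.var 8 rfl, h.consts.c8]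
  rw [addrCode, execs_append, execs_append, execs_append]
  set ρ1 := execs (red 10 i 2) ρ with hρ1
  set ρ2 := execs (red 11 j 2) ρ1 with hρ2
  set ρ3 := execs (red 12 k 3) ρ2 with hρ3
  have a1 : ρ1.reg 10 = ((σ.v i % (2 * n) : ℕ) : ℤ) := by
    rw [hρ1, red_reg i4 (by norm_num) ρ _ _ (h.var i hi) e2]
  have a2 : ρ2.reg 11 = ((σ.v j % (2 * n) : ℕ) : ℤ) := by
    rw [hρ2, red_reg j4 (by norm_num) ρ1 (σ.v j) (2 * n)]
    · rw [hρ1, red_frame _ j4 j1, h.var j hj]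
    · rw [hρ1, red_frame _ (by norm_num) (by norm_num), e2]
  have a3 : ρ3.reg 12 = ((σ.v k % (m + 1) : ℕ) : ℤ) := by
    rw [hρ3, red_reg k4 (by norm_num) ρ2 (σ.v k) (m + 1)]
    · rw [hρ2, red_frame _ k4 k2, hρ1, red_frame _ k4 k1, h.var k hk]
    · rw [hρ2, red_frame _ (by norm_num) (by norm_num), hρ1,
        red_frame _ (by norm_num) (by norm_num), e3]
  have a1' : ρ3.reg 10 = ((σ.v i % (2 * n) : ℕ) : ℤ) := by
    rw [hρ3, red_frame _ (by norm_num) (by norm_num), hρ2,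
      red_frame _ (by norm_num) (by norm_num), a1]
  have a2' : ρ3.reg 11 = ((σ.v j % (2 * n) : ℕ) : ℤ) := by
    rw [hρ3, red_frame _ (by norm_num) (by norm_num), a2]
  have fr : ∀ x, vis x = true → ρ3.reg x = ρ.reg x := fun x hx => by
    obtain ⟨x1, x2, x3, x4⟩ := hn x hx
    rw [hρ3, red_frame _ x4 x3, hρ2, red_frame _ x4 x2, hρ1, red_frame _ x4 x1]
  simp [execs, Instr.exec, IntOp.eval, a1', a2', a3, fr, vis, e2, e3, e5, e8, addr]

theorem SpaceOK.of_forall {S : ℕ} {is : List Instr} (h : ∀ i ∈ is, ∀ σ, i.InSpace S σ) (σ : State) :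
    SpaceOK S is σ := by
  induction is generalizing σ with
  | nil => trivial
  | cons i is ih => exact ⟨h i (by simp) σ, ih (fun j hj => h j (by simp [hj])) _⟩

theorem addrCode_space (S : ℕ) (A : Fin 5) (i j k : ℕ) (ρ : State) :
    SpaceOK S (addrCode A i j k) ρ :=
  SpaceOK.of_forall (by simp [addrCode, red, Instr.InSpace]) ρ

theorem addr_lt {n m i j k : ℕ} (A : Fin 5) (hi : i < 2 * n) (hj : j < 2 * n) (hk : k < m + 1) :
    addr n m A i j k < 2 * m + 1 + 20 * n ^ 2 * (m + 1) := by
  have h1 : i * (2 * n) + j + 1 ≤ 2 * n * (2 * n) := by nlinarith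
  have h2 : (i * (2 * n) + j) * (m + 1) + k + 1 ≤ 2 * n * (2 * n) * (m + 1) := by nlinarith
  have := A.2
  have h3 : 2 * n * (2 * n) * (m + 1) * 5 = 20 * n ^ 2 * (m + 1) := by ring
  unfold addr
  omega

theorem pair_inj {b x y x' y' : ℕ} (hy : y < b) (hy' : y' < b) (h : x * b + y = x' * b + y') :
    x = x' ∧ y = y' := by
  have h1 := congrArg (· / b) h
  have h2 := congrArg (· % b) h
  have hb : 0 < b := by omega
  simp only [Nat.mul_add_mod_self_right, Nat.mod_eq_of_lt hy, Nat.mod_eq_of_lt hy'] at h2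
  rw [h2] at h
  exact ⟨Nat.eq_of_mul_eq_mul_right hb (by omega), h2⟩

/-- An address is a mixed-radix numeral whose lowest digit is the array number, so the five arrays
are interleaved above the output cells and distinct cells never collide. -/
theorem addr_inj {n m i j k i' j' k' : ℕ} {A A' : Fin 5} (hj : j < 2 * n)
    (hk : k < m + 1) (hj' : j' < 2 * n) (hk' : k' < m + 1)
    (h : addr n m A i j k = addr n m A' i' j' k') : A = A' ∧ i = i' ∧ j = j' ∧ k = k' := by
  unfold addr at h
  obtain ⟨h1, h2⟩ := pair_inj (b := 5) A.2 A'.2 (by omega :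
    ((i * (2 * n) + j) * (m + 1) + k) * 5 + (A : ℕ) =
      ((i' * (2 * n) + j') * (m + 1) + k') * 5 + (A' : ℕ))
  obtain ⟨h3, h4⟩ := pair_inj hk hk' h1
  obtain ⟨h5, h6⟩ := pair_inj hj hj' h3
  exact ⟨Fin.ext h2, h5, h6, h4⟩

theorem Rel.put {n m : ℕ} {cm : ℕ → ℝ} {σ : St} {ρ ρ' : State} (h : Rel n m cm σ ρ) {x c : ℕ}
    (hx : 40 ≤ x) (hreg : ∀ y, vis y = true → y ≠ x → ρ'.reg y = ρ.reg y) (hc : ρ'.reg x = c)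
    (hm : ρ'.mem = ρ.mem) (hcm : ρ'.cmem = ρ.cmem) : Rel n m cm (σ.put x c) ρ' where
  consts := by
    have : ∀ y < 10, Function.update σ.v x c y = σ.v y := fun y hy =>
      Function.update_of_ne (by omega) _ _
    constructor <;> simp only [St.put] <;> rw [this _ (by norm_num)]
    exacts [h.consts.c0, h.consts.c1, h.consts.c2, h.consts.c3, h.consts.c4, h.consts.c5,
      h.consts.c6, h.consts.c7, h.consts.c8]
  var y hy := by
    by_cases hyx : y = x
    · subst hyx; simp [St.put, hc]
    · simp [St.put, hyx, hreg y hy hyx, h.var y hy]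
  raw i hi := by rw [hm]; exact h.raw i hi
  arr A i j k hi hj hk := by rw [hm]; exact h.arr A i j k hi hj hk
  cmem := hcm.trans h.cmem

theorem vis_of_le {x : ℕ} (h : 40 ≤ x) : vis x = true := by simp [vis, h]

/-- The space used for `n` points and gons with at most `m` vertices. -/
def space (n m : ℕ) : ℕ := 2 * m + 1 + 20 * n ^ 2 * (m + 1) + 2 * n + 2

/-- Because indices are reduced modulo the array sizes both in the code and in the semantics,
accesses stay in range without any side condition on the values of the variables. -/
theorem Prim.correct {n m : ℕ} (hn : 0 < n) {cm : ℕ → ℝ} (p : Prim) (hp : p.wf = true) {σ : St}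
    {ρ : State} (h : Rel n m cm σ ρ) :
    SpaceOK (space n m) p.code ρ ∧ Rel n m cm (p.den n m σ) (execs p.code ρ) := by
  cases p with
  | set x c =>
    simp only [Prim.wf, decide_eq_true_eq] at hp
    refine ⟨SpaceOK.of_forall (by simp [code, Instr.InSpace]) ρ, h.put hp ?_ ?_ rfl rfl⟩
    · intro y _ hyx; simp [code, execs, Instr.exec, hyx]
    · simp [code, execs, Instr.exec]
  | plus x y z =>
    simp only [Prim.wf, decide_eq_true_eq, Bool.and_eq_true] at hp
    obtain ⟨⟨hx, hy⟩, hz⟩ := hp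
    refine ⟨SpaceOK.of_forall (by simp [code, Instr.InSpace]) ρ, h.put hx ?_ ?_ rfl rfl⟩
    · intro y _ hyx; simp [code, execs, Instr.exec, hyx]
    · simp [code, execs, Instr.exec, IntOp.eval, h.var y hy, h.var z hz]
  | modn x y =>
    simp only [Prim.wf, decide_eq_true_eq, Bool.and_eq_true] at hp
    obtain ⟨hx, hy⟩ := hp
    refine ⟨SpaceOK.of_forall (by simp [code, red, Instr.InSpace]) ρ, h.put hx ?_ ?_ rfl rfl⟩
    · intro z hz hyx
      exact red_frame _ (vis_ne hz (by norm_num) (by norm_num)) hyx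
    · exact red_reg (vis_ne hy (by norm_num) (by norm_num)) (by norm_num) _ _ _ (h.var y hy)
        (by rw [h.var 0 rfl, h.consts.c0])
  | ld x A i j k =>
    simp only [Prim.wf, decide_eq_true_eq, Bool.and_eq_true] at hp
    obtain ⟨⟨⟨hx, hi⟩, hj⟩, hk⟩ := hp
    have hreg := addrCode_reg h A hi hj hk
    have ht := addrCode_tmp A i j k ρ
    have li := Nat.mod_lt (σ.v i) (by omega : 0 < 2 * n)
    have lj := Nat.mod_lt (σ.v j) (by omega : 0 < 2 * n)
    have lk := Nat.mod_lt (σ.v k) (by omega : 0 < m + 1)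
    have hlt := addr_lt A li lj lk
    constructor
    · refine SpaceOK.append (addrCode_space _ _ _ _ _ _) ⟨?_, trivial⟩
      simp only [Instr.InSpace, hreg, space]
      omega
    · rw [code, execs_append]
      refine (h.tmp ht).put hx ?_ ?_ rfl rfl
      · intro y _ hyx; simp [execs, Instr.exec, hyx]
      · simp only [execs, Instr.exec, Function.update_self, hreg, Int.toNat_natCast]
        exact (h.tmp ht).arr A _ _ _ li lj lk
  | st A i j k x =>
    simp only [Prim.wf, Bool.and_eq_true] at hp
    obtain ⟨⟨⟨hi, hj⟩, hk⟩, hx⟩ := hp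
    have hreg := addrCode_reg h A hi hj hk
    have ht := addrCode_tmp A i j k ρ
    have li := Nat.mod_lt (σ.v i) (by omega : 0 < 2 * n)
    have lj := Nat.mod_lt (σ.v j) (by omega : 0 < 2 * n)
    have lk := Nat.mod_lt (σ.v k) (by omega : 0 < m + 1)
    have hlt := addr_lt A li lj lk
    constructor
    · refine SpaceOK.append (addrCode_space _ _ _ _ _ _) ⟨?_, trivial⟩
      simp only [Instr.InSpace, hreg, space]
      omega
    · rw [code, execs_append]
      have h' := h.tmp ht
      have hge : 2 * m + 1 ≤ addr n m A (σ.v i % (2 * n)) (σ.v j % (2 * n)) (σ.v k % (m + 1)) := by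
        unfold addr; omega
      refine ⟨h.consts, fun y hy => h'.var y hy, fun r hr => ?_, fun A' i' j' k' hi' hj' hk' => ?_,
        h'.cmem⟩
      · simp only [execs, Instr.exec, hreg, Int.toNat_natCast]
        rw [Function.update_of_ne (by omega)]
        exact h'.raw r hr
      · simp only [execs, Instr.exec, hreg, Int.toNat_natCast, Prim.den]
        by_cases hA : A' = A ∧ i' = σ.v i % (2 * n) ∧ j' = σ.v j % (2 * n) ∧ k' = σ.v k % (m + 1)
        · obtain ⟨rfl, rfl, rfl, rfl⟩ := hA
          simp [upd, h'.var x hx]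
        · rw [Function.update_of_ne, h'.arr A' i' j' k' hi' hj' hk']
          · by_cases hAA : A' = A
            · subst hAA
              simp only [true_and] at hA
              simp [upd, hA]
            · simp [hAA]
          · intro he
            exact hA (addr_inj hj' hk' lj lk he)
  | out x y =>
    simp only [Prim.wf, Bool.and_eq_true] at hp
    obtain ⟨hx, hy⟩ := hp
    have x20 := vis_ne hx (y := 20) (by norm_num) (by norm_num)
    have y11 := vis_ne hy (y := 11) (by norm_num) (by norm_num)
    have y10 := vis_ne hy (y := 10) (by norm_num) (by norm_num)
    have y20 := vis_ne hy (y := 20) (by norm_num) (by norm_num)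
    have hreg : (execs (red 10 x 8) ρ).reg 10 = ((σ.v x % (2 * m + 1) : ℕ) : ℤ) :=
      red_reg x20 (by norm_num) _ _ _ (h.var x hx) (by rw [h.var 8 rfl, h.consts.c8])
    have hregy : (execs (red 10 x 8) ρ).reg y = σ.v y := by
      rw [red_frame _ y20 y10, h.var y hy]
    have hlt := Nat.mod_lt (σ.v x) (by omega : 0 < 2 * m + 1)
    have hraw := h.raw _ hlt
    constructor
    · refine SpaceOK.append (SpaceOK.of_forall (by simp [red, Instr.InSpace]) _) ?_
      have : ((σ.v x % (2 * m + 1) : ℕ) : ℤ) < (space n m : ℕ) := by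
        unfold space
        omega
      simp only [SpaceOK, Instr.InSpace, Instr.exec, hreg, and_true, true_and, this]
      simp only [ne_eq, Nat.reduceEqDiff, not_false_eq_true,
        Function.update_of_ne, hreg, this, and_true]
      omega
    · rw [code, execs_append]
      refine ⟨h.consts, fun z hz => ?_, fun r hr => ?_, fun A i j k hi hj hk => ?_, h.cmem⟩
      · have z11 := vis_ne hz (y := 11) (by norm_num) (by norm_num)
        have z10 := vis_ne hz (y := 10) (by norm_num) (by norm_num)
        have z20 := vis_ne hz (y := 20) (by norm_num) (by norm_num)
        simp only [execs, Instr.exec, ne_eq, z11, not_false_eq_true, Function.update_of_ne]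
        rw [red_frame _ z20 z10, h.var z hz]
        rfl
      · simp only [execs, Instr.exec, IntOp.eval, Prim.den]
        simp only [ne_eq, Nat.reduceEqDiff, not_false_eq_true,
          Function.update_of_ne, hreg, Int.toNat_natCast, Function.update_self, red_mem, y11,
          hregy]
        rw [hraw]
        by_cases hr' : r = σ.v x % (2 * m + 1)
        · subst hr'; simp
        · simp [hr', h.raw r hr]
      · simp only [execs, Instr.exec, IntOp.eval, Prim.den]
        simp only [ne_eq, Nat.reduceEqDiff, not_false_eq_true,
          Function.update_of_ne, hreg, Int.toNat_natCast, Function.update_self, red_mem]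
        rw [Function.update_of_ne, h.arr A i j k hi hj hk]
        unfold addr
        omega

end RAM

/-! ### Orientation tests on signed points -/

/-- The determinant of three vectors. -/
def det3 (x y z : Fin 3 → ℝ) : ℝ :=
  x 0 * (y 1 * z 2 - y 2 * z 1) - x 1 * (y 0 * z 2 - y 2 * z 0) + x 2 * (y 0 * z 1 - y 1 * z 0)

namespace RAM

/-- The signed point with number `u`, read from the coordinate memory. -/
noncomputable def sgnPt (n : ℕ) (cm : ℕ → ℝ) (u : ℕ) : Fin 3 → ℝ :=
  ![cm (2 * (u % (2 * n) % n)) * cm (2 * n + u % (2 * n) / n),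
    cm (2 * (u % (2 * n) % n) + 1) * cm (2 * n + u % (2 * n) / n),
    cm (2 * n + u % (2 * n) / n)]

/-- Integers cannot be converted to coordinates, so the sign is fetched from coordinate memory:
cells `2n` and `2n + 1` hold `1` and `-1`. The quotient by `n` selects the sign, the remainder
selects the point, and the sign also serves as the third homogeneous coordinate. -/
theorem ptCode_spec {n m : ℕ} (hn : 0 < n) {cm : ℕ → ℝ} {σ : St} {ρ : State}
    (h : Rel n m cm σ ρ) {u : ℕ} (d : ℕ) (hu : vis u = true) :
    SpaceOK (space n m) (ptCode u d) ρ ∧ Tmp ρ (execs (ptCode u d) ρ) ∧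
      (execs (ptCode u d) ρ).creg d = sgnPt n cm (σ.v u) 0 ∧
      (execs (ptCode u d) ρ).creg (d + 1) = sgnPt n cm (σ.v u) 1 ∧
      (execs (ptCode u d) ρ).creg (d + 2) = sgnPt n cm (σ.v u) 2 ∧
      ∀ e, e ≠ d → e ≠ d + 1 → e ≠ d + 2 → (execs (ptCode u d) ρ).creg e = ρ.creg e := by
  have u20 := vis_ne hu (y := 20) (by norm_num) (by norm_num)
  have hreg : (execs (red 10 u 2) ρ).reg 10 = ((σ.v u % (2 * n) : ℕ) : ℤ) :=
    red_reg u20 (by norm_num) _ _ _ (h.var u hu) (by rw [h.var 2 rfl, h.consts.c2])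
  have hr : ∀ x, x ≠ 20 → x ≠ 10 → (execs (red 10 u 2) ρ).reg x = ρ.reg x :=
    fun x h1 h2 => red_frame _ h1 h2
  have e0 : ρ.reg 0 = (n : ℤ) := by rw [h.var 0 rfl, h.consts.c0]
  have e2 : ρ.reg 2 = ((2 * n : ℕ) : ℤ) := by rw [h.var 2 rfl, h.consts.c2]
  have e6 : ρ.reg 6 = 1 := by rw [h.var 6 rfl, h.consts.c6]; rfl
  set t := σ.v u % (2 * n) with ht
  have htn : t < 2 * n := Nat.mod_lt _ (by omega)
  have hq : t / n < 2 := Nat.div_lt_of_lt_mul (by omega)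
  have hs : t % n < n := Nat.mod_lt _ hn
  have hmod : (t : ℤ) - (t : ℤ) / n * n = ((t % n : ℕ) : ℤ) := by
    have := Int.emod_def (t : ℤ) (n : ℤ)
    push_cast
    rw [this, mul_comm]
  have a1 : ((t % n : ℕ) : ℤ) + ((t % n : ℕ) : ℤ) = ((2 * (t % n) : ℕ) : ℤ) := by
    push_cast; ring
  have a2 : ((2 * (t % n) : ℕ) : ℤ) + 1 = ((2 * (t % n) + 1 : ℕ) : ℤ) := by
    push_cast; ring
  have a3 : (t : ℤ) / n + ((2 * n : ℕ) : ℤ) = ((2 * n + t / n : ℕ) : ℤ) := by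
    push_cast; ring
  have hsp : space n m = 2 * m + 1 + 20 * n ^ 2 * (m + 1) + 2 * n + 2 := rfl
  have b1 : ((2 * (t % n) : ℕ) : ℤ) < (space n m : ℕ) := by rw [hsp]; omega
  have b2 : ((2 * (t % n) + 1 : ℕ) : ℤ) < (space n m : ℕ) := by rw [hsp]; omega
  have b3 : ((2 * n + t / n : ℕ) : ℤ) < (space n m : ℕ) := by rw [hsp]; omega
  have c1 : (0 : ℤ) ≤ ((2 * (t % n) : ℕ) : ℤ) := Int.natCast_nonneg _
  have c2 : (0 : ℤ) ≤ ((2 * (t % n) + 1 : ℕ) : ℤ) := Int.natCast_nonneg _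
  have c3 : (0 : ℤ) ≤ ((2 * n + t / n : ℕ) : ℤ) := Int.natCast_nonneg _
  refine ⟨?_, ⟨fun x hx => ?_, rfl, rfl⟩, ?_⟩
  · refine SpaceOK.append (SpaceOK.of_forall (by simp [red, Instr.InSpace]) _) ?_
    simp only [SpaceOK, Instr.InSpace, Instr.exec, IntOp.eval, true_and, and_true]
    simp only [Function.update_apply, Nat.reduceEqDiff, reduceIte, hreg, hr, ne_eq,
      not_false_eq_true, e0, e2, e6, hmod, a1, a2, a3, b1, b2, b3, OfNat.zero_ne_ofNat,
      c1, c2, c3, and_true]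
  · have x20 := vis_ne hx (y := 20) (by norm_num) (by norm_num)
    have x10 := vis_ne hx (y := 10) (by norm_num) (by norm_num)
    have x11 := vis_ne hx (y := 11) (by norm_num) (by norm_num)
    have x12 := vis_ne hx (y := 12) (by norm_num) (by norm_num)
    rw [ptCode, execs_append]
    simp [execs, Instr.exec, x10, x11, x12, hr x x20 x10]
  · rw [ptCode, execs_append]
    have n1 : d ≠ d + 1 := by omega
    have n2 : d ≠ d + 2 := by omega
    have n3 : d + 1 ≠ d + 2 := by omega
    have n4 : d + 1 ≠ d := by omega
    have n5 : d + 2 ≠ d := by omega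
    have n6 : d + 2 ≠ d + 1 := by omega
    simp only [execs, Instr.exec, IntOp.eval, CoordOp.eval]
    simp only [Function.update_apply, Nat.reduceEqDiff, reduceIte, hreg, hr, ne_eq,
      not_false_eq_true, e0, e2, e6, hmod, a1, a2, a3, OfNat.zero_ne_ofNat,
      n1, n2, n3, n4, n5, n6, Int.toNat_natCast, red_cmem, red_creg, h.cmem]
    refine ⟨rfl, rfl, rfl, fun e h1 h2 h3 => ?_⟩
    simp only [h1, h2, h3, if_false]

/-- The orientation predicate computed by the machine. -/
def orient (n : ℕ) (cm : ℕ → ℝ) (u v w : ℕ) : Prop :=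
  0 < det3 (sgnPt n cm u) (sgnPt n cm v) (sgnPt n cm w)

theorem detCode_spec (ρ : State) (S : ℕ) : SpaceOK S detCode ρ ∧ Tmp ρ (execs detCode ρ) ∧
    (execs detCode ρ).creg 9 = 0 ∧ (execs detCode ρ).creg 10 =
      det3 ![ρ.creg 0, ρ.creg 1, ρ.creg 2] ![ρ.creg 3, ρ.creg 4, ρ.creg 5]
        ![ρ.creg 6, ρ.creg 7, ρ.creg 8] := by
  refine ⟨SpaceOK.of_forall (by simp [detCode, Instr.InSpace]) _,
    ⟨fun _ _ => rfl, rfl, rfl⟩, ?_, ?_⟩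
  · simp [detCode, execs, Instr.exec]
  · simp only [detCode, execs, Instr.exec, CoordOp.eval]
    simp [det3]
    ring

theorem Test.correct {n m : ℕ} (hn : 0 < n) {cm : ℕ → ℝ} (t : Test) (ht : t.wf = true) {σ : St}
    {ρ : State} (h : Rel n m cm σ ρ) :
    SpaceOK (space n m) t.code ρ ∧ Rel n m cm σ (execs t.code ρ) ∧
      ∀ l S, (t.jump l).InSpace S (execs t.code ρ) ∧
        Rel n m cm σ ((t.jump l).exec (execs t.code ρ)) ∧
        (t.Holds (orient n cm) σ → ((t.jump l).exec (execs t.code ρ)).pc = l) ∧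
        (¬ t.Holds (orient n cm) σ →
          ((t.jump l).exec (execs t.code ρ)).pc = (execs t.code ρ).pc + 1) := by
  cases t with
  | lt x y =>
    simp only [Test.wf, Bool.and_eq_true] at ht
    refine ⟨trivial, h, fun l S => ⟨trivial, h.tmp ⟨fun _ _ => rfl, rfl, rfl⟩, ?_, ?_⟩⟩ <;>
    · intro hh
      simp only [Test.Holds] at hh
      simp [Test.code, Test.jump, execs, Instr.exec, h.var x ht.1, h.var y ht.2, hh]
  | pos u v w =>
    simp only [Test.wf, Bool.and_eq_true] at ht
    obtain ⟨⟨hu, hv⟩, hw⟩ := ht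
    obtain ⟨s1, t1, a0, a1, a2, -⟩ := ptCode_spec hn h 0 hu
    have h1 := h.tmp t1
    obtain ⟨s2, t2, b0, b1, b2, fb⟩ := ptCode_spec hn h1 3 hv
    have h2 := h1.tmp t2
    obtain ⟨s3, t3, c0, c1, c2, fc⟩ := ptCode_spec hn h2 6 hw
    have h3 := h2.tmp t3
    obtain ⟨s4, t4, d0, d1⟩ := detCode_spec
      (execs (ptCode w 6) (execs (ptCode v 3) (execs (ptCode u 0) ρ))) (space n m)
    have h4 := h3.tmp t4
    have hex : execs (Test.pos u v w).code ρ =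
        execs detCode (execs (ptCode w 6) (execs (ptCode v 3) (execs (ptCode u 0) ρ))) := by
      simp only [Test.code, execs_append]
    have hdet : (execs (Test.pos u v w).code ρ).creg 10 =
        det3 (sgnPt n cm (σ.v u)) (sgnPt n cm (σ.v v)) (sgnPt n cm (σ.v w)) := by
      rw [hex, d1]
      simp only [zero_add, Nat.reduceAdd] at a0 a1 a2 b0 b1 b2 c0 c1 c2
      rw [c0, c1, c2, fc 0, fc 1, fc 2, fc 3, fc 4, fc 5, b0, b1, b2, fb 0, fb 1, fb 2, a0, a1,
        a2] <;> first | rfl | norm_num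
    rw [← hex] at d0 h4
    refine ⟨s1.append (s2.append (s3.append s4)), h4,
      fun l S => ⟨trivial, h4.tmp ⟨fun _ _ => rfl, rfl, rfl⟩, fun hh => ?_, fun hh => ?_⟩⟩
    · simp only [Test.jump, Instr.exec, d0, hdet]
      exact if_pos hh
    · simp only [Test.jump, Instr.exec, d0, hdet]
      exact if_neg hh

theorem Prim.straight (p : Prim) : ∀ i ∈ p.code, i.straight = true := by
  cases p <;> simp [Prim.code, addrCode, red, Instr.straight]

theorem Test.straight (t : Test) : ∀ i ∈ t.code, i.straight = true := by
  cases t <;> simp [Test.code, ptCode, detCode, red, Instr.straight]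

theorem Consts.eq {n m : ℕ} {v v' : ℕ → ℕ} (hv : Consts n m v) (hv' : Consts n m v') {b : ℕ}
    (hb : b < 9) : v b = v' b := by
  interval_cases b
  exacts [hv.c0.trans hv'.c0.symm, hv.c1.trans hv'.c1.symm, hv.c2.trans hv'.c2.symm,
    hv.c3.trans hv'.c3.symm, hv.c4.trans hv'.c4.symm, hv.c5.trans hv'.c5.symm,
    hv.c6.trans hv'.c6.symm, hv.c7.trans hv'.c7.symm, hv.c8.trans hv'.c8.symm]

/-- Correctness of the compiler. -/
theorem Cmd.correct {n m : ℕ} (hn : 0 < n) {cm : ℕ → ℝ} {prog : Program} {bd : ℕ → ℕ}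
    (hbd : ∀ v, Consts n m v → ∀ b < 9, v b ≤ bd b) (c : Cmd) (hc : c.wf = true) :
    ∀ (l : ℕ) (σ : St) (ρ : State), At prog l (c.code l) → ρ.pc = l → Rel n m cm σ ρ →
      ∃ t ρ', t ≤ c.cost bd ∧ Run prog (space n m) ρ t ρ' ∧ ρ'.pc = l + c.len ∧
        Rel n m cm (c.den n m (orient n cm) σ) ρ' := by
  induction c with
  | prim p =>
    rintro l σ ρ hat rfl h
    obtain ⟨h1, h2⟩ := Prim.correct hn p hc h
    obtain ⟨h3, h4⟩ := run_straight p.straight hat h1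
    exact ⟨_, _, le_rfl, h3, h4, h2⟩
  | skip =>
    rintro l σ ρ - rfl h
    exact ⟨0, ρ, le_rfl, Run.refl _, rfl, h⟩
  | seq c d ihc ihd =>
    intro l σ ρ hat hl h
    simp only [Cmd.wf, Bool.and_eq_true] at hc
    obtain ⟨t1, ρ1, ht1, r1, p1, h1⟩ := ihc hc.1 l σ ρ hat.left hl h
    have hat2 := hat.right
    rw [Cmd.length_code] at hat2
    obtain ⟨t2, ρ2, ht2, r2, p2, h2⟩ := ihd hc.2 _ _ ρ1 hat2 p1 h1
    exact ⟨t1 + t2, ρ2, add_le_add ht1 ht2, r1.trans r2, by rw [p2, Cmd.len]; omega, h2⟩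
  | ite t c d ihc ihd =>
    rintro l σ ρ hat rfl h
    simp only [Cmd.wf, Bool.and_eq_true] at hc
    obtain ⟨⟨htw, hcw⟩, hdw⟩ := hc
    obtain ⟨s1, h1, h2⟩ := Test.correct hn t htw h
    obtain ⟨r1, p1⟩ := run_straight t.straight hat.left s1
    have hat1 := hat.right
    have hat2 := hat1.right
    have hat3 := hat2.right
    have hat4 := hat3.right
    rw [Cmd.length_code] at hat3 hat4
    simp only [List.length_singleton] at hat2 hat3 hat4
    obtain ⟨i1, h3, j1, j2⟩ := h2 (ρ.pc + t.code.length + 1 + d.len + 1) (space n m)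
    have r2 : Run prog (space n m) (execs t.code ρ) 1 _ := Run.one (by
      rw [p1]; exact hat1.head) i1
    by_cases hh : t.Holds (orient n cm) σ
    · obtain ⟨t2, ρ2, ht2, r3, p2, h4⟩ := ihc hcw _ _ _ hat4 (j1 hh) h3
      refine ⟨_, ρ2, ?_, (r1.trans r2).trans r3, ?_, ?_⟩
      · simp only [Cmd.cost]; omega
      · rw [p2, Cmd.len]; omega
      · simpa only [Cmd.den, hh, if_true] using h4
    · obtain ⟨t2, ρ2, ht2, r3, p2, h4⟩ := ihd hdw _ _ _ hat2.left (by rw [j2 hh, p1]) h3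
      have r4 : Run prog (space n m) ρ2 1 _ :=
          Run.one (by rw [p2]; exact hat3.head) (by exact trivial)
      refine ⟨_, _, ?_, ((r1.trans r2).trans r3).trans r4, ?_, ?_⟩
      · simp only [Cmd.cost]; omega
      · simp only [Instr.exec, Cmd.len]; omega
      · simp only [Cmd.den, hh, if_false]
        exact h4.tmp ⟨fun _ _ => rfl, rfl, rfl⟩
  | loop x b c ih =>
    rintro l σ ρ hat rfl h
    simp only [Cmd.wf, Bool.and_eq_true, decide_eq_true_eq, Bool.not_eq_true'] at hc
    obtain ⟨⟨⟨hx, hb⟩, hcw⟩, hxw⟩ := hc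
    have hxw : x ∉ c.wr := by simpa using hxw
    have hbv : vis b = true := by
      simp only [vis, Bool.or_eq_true, decide_eq_true_eq]
      omega
    have hat1 := hat.left
    have hat2 := hat.right
    simp only [List.length_cons, List.length_nil] at hat2
    have hat3 := hat2.right
    rw [Cmd.length_code] at hat3
    -- the loop is entered
    have r0 : Run prog (space n m) ρ 1 _ := Run.one hat1.head trivial
    set ρ0 := (Instr.const x 0).exec ρ with hρ0
    have h0 : Rel n m cm (σ.put x 0) ρ0 := h.put hx
      (fun y _ hyx => by simp [hρ0, Instr.exec, hyx]) (by simp [hρ0, Instr.exec]) rfl rfl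
    -- After `i` rounds the machine stands at the loop test with counter `i`. Each round costs three
    -- instructions besides the body: test, increment and jump back.
    have key : ∀ i ≤ σ.v b, ∃ t ρ', t ≤ i * (c.cost bd + 3) ∧
        Run prog (space n m) ρ0 t ρ' ∧ ρ'.pc = ρ.pc + 1 ∧
        Rel n m cm ((iter (fun i τ => c.den n m (orient n cm) (τ.put x i)) i σ).put x i) ρ' := by
      intro i
      induction i with
      | zero => exact fun _ => ⟨0, ρ0, by simp, Run.refl _, rfl, h0⟩
      | succ i ihi =>
        intro hi
        obtain ⟨t, ρ1, ht, r1, p1, h1⟩ := ihi (by omega)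
        set τ := iter (fun i τ => c.den n m (orient n cm) (τ.put x i)) i σ with hτ
        have hτb : (τ.put x i).v b = σ.v b := h1.consts.eq h.consts hb
        have hlt : ρ1.reg x < ρ1.reg b := by
          rw [h1.var x (vis_of_le hx), h1.var b hbv, hτb]
          simp only [St.put, Function.update_self]
          exact_mod_cast (by omega : i < σ.v b)
        have r2 : Run prog (space n m) ρ1 1 _ :=
          Run.one (by rw [p1]; exact hat1.tail.head) (by exact trivial)
        set ρ2 := (Instr.jumpLt x b (ρ.pc + 3)).exec ρ1 with hρ2
        have p2 : ρ2.pc = ρ.pc + 3 := by simp [hρ2, Instr.exec, hlt]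
        have h2 : Rel n m cm (τ.put x i) ρ2 := h1.tmp ⟨fun _ _ => rfl, rfl, rfl⟩
        obtain ⟨t3, ρ3, ht3, r3, p3, h3⟩ := ih hcw _ _ _ hat2.left p2 h2
        have r4 : Run prog (space n m) ρ3 1 _ :=
          Run.one (by rw [p3]; exact hat3.head) (by exact trivial)
        set ρ4 := (Instr.arith .add x x 6).exec ρ3 with hρ4
        have r5 : Run prog (space n m) ρ4 1 _ := Run.one (by
          rw [hρ4]; simp only [Instr.exec, p3]; exact hat3.tail.head) (by exact trivial)
        have hxi : ρ3.reg x = (i : ℤ) := by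
          rw [h3.var x (vis_of_le hx), Cmd.den_v c hxw]
          simp [St.put]
        refine ⟨_, _, ?_, (((r1.trans r2).trans r3).trans r4).trans r5, rfl, ?_⟩
        · rw [Nat.succ_mul]; omega
        · refine (h3.put hx (c := i + 1) ?_ ?_ rfl rfl)
          · intro y _ hyx; simp [hρ4, Instr.exec, hyx]
          · simp [hρ4, Instr.exec, IntOp.eval, hxi, h3.var 6 rfl, h3.consts.c6]
    obtain ⟨t, ρ1, ht, r1, p1, h1⟩ := key _ le_rfl
    have hnlt : ¬ ρ1.reg x < ρ1.reg b := by
      rw [h1.var x (vis_of_le hx), h1.var b hbv, h1.consts.eq h.consts hb]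
      simp [St.put]
    have r2 : Run prog (space n m) ρ1 1 _ :=
          Run.one (by rw [p1]; exact hat1.tail.head) (by exact trivial)
    set ρ2 := (Instr.jumpLt x b (ρ.pc + 3)).exec ρ1 with hρ2
    have p2 : ρ2.pc = ρ.pc + 2 := by simp [hρ2, Instr.exec, hnlt, p1]
    have r3 : Run prog (space n m) ρ2 1 _ := Run.one (by
      rw [p2]; exact hat1.tail.tail.head) (by exact trivial)
    refine ⟨_, _, ?_, ((r0.trans r1).trans r2).trans r3, ?_, ?_⟩
    · have := hbd _ h.consts b hb
      have := Nat.mul_le_mul_right (c.cost bd + 3) this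
      simp only [Cmd.cost]; omega
    · simp only [Instr.exec, Cmd.len]; omega
    · exact h1.tmp ⟨fun _ _ => rfl, rfl, rfl⟩

/-! ### Initialisation and the passage from commands to machine programs -/

/-- Sets up the constants. -/
def prologue : List Instr :=
  [.const 6 1, .const 5 5, .arith .add 2 0 0, .arith .add 3 1 6, .arith .sub 4 0 6,
   .arith .add 8 1 1, .arith .add 8 8 6, .cconst 0 1, .cstore 2 0, .cconst 0 (-1),
   .arith .add 10 2 6, .cstore 10 0]

/-- Initial values of the variables. -/
def initV (n m : ℕ) (x : ℕ) : ℕ :=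
  if x = 0 then n else if x = 1 then m else if x = 2 then 2 * n else if x = 3 then m + 1
  else if x = 4 then n - 1 else if x = 5 then 5 else if x = 6 then 1
  else if x = 8 then 2 * m + 1 else 0

/-- Initial abstract state. -/
def initSt (n m : ℕ) : St := ⟨initV n m, fun _ _ _ _ => 0, fun _ => 0⟩

/-- Coordinate memory after the prologue. -/
noncomputable def initC {n : ℕ} (p : Fin n → ℝ × ℝ) (j : ℕ) : ℝ :=
  if j = 2 * n + 1 then -1 else if j = 2 * n then 1 else (start 0 p).cmem j

theorem consts_init (n m : ℕ) : Consts n m (initV n m) := by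
  constructor <;> simp [initV]

theorem prologue_spec {n m : ℕ} (hn : 0 < n) (p : Fin n → ℝ × ℝ) :
    SpaceOK (space n m) prologue (start m p) ∧
      Rel n m (initC p) (initSt n m) (execs prologue (start m p)) := by
  have a1 : (n : ℤ) + n = ((2 * n : ℕ) : ℤ) := by push_cast; ring
  have a2 : ((2 * n : ℕ) : ℤ) + 1 = ((2 * n + 1 : ℕ) : ℤ) := by push_cast; ring
  have a3 : (n : ℤ) - 1 = ((n - 1 : ℕ) : ℤ) := by push_cast [Nat.cast_sub hn]; ring
  have a4 : (m : ℤ) + m + 1 = ((2 * m + 1 : ℕ) : ℤ) := by push_cast; ring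
  have hsp : space n m = 2 * m + 1 + 20 * n ^ 2 * (m + 1) + 2 * n + 2 := rfl
  have b1 : ((2 * n : ℕ) : ℤ) < (space n m : ℕ) := by rw [hsp]; omega
  have b2 : ((2 * n + 1 : ℕ) : ℤ) < (space n m : ℕ) := by rw [hsp]; omega
  have c1 : (0 : ℤ) ≤ ((2 * n : ℕ) : ℤ) := Int.natCast_nonneg _
  have c2 : (0 : ℤ) ≤ ((2 * n + 1 : ℕ) : ℤ) := Int.natCast_nonneg _
  constructor
  · simp only [prologue, SpaceOK, Instr.InSpace, Instr.exec, IntOp.eval, true_and, and_true, start]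
    simp only [Function.update_apply, Nat.reduceEqDiff, reduceIte, OfNat.zero_ne_ofNat,
      OfNat.one_ne_ofNat, a1, a2, b1, b2, c1, c2, and_self]
  · refine ⟨consts_init n m, fun x hx => ?_, fun _ _ => rfl, fun _ _ _ _ _ _ _ => rfl, ?_⟩
    · have h10 := vis_ne hx (y := 10) (by norm_num) (by norm_num)
      simp only [prologue, execs, Instr.exec, IntOp.eval, start, initSt, initV]
      simp only [Function.update_apply, Nat.reduceEqDiff, reduceIte, OfNat.zero_ne_ofNat,
        OfNat.one_ne_ofNat, h10, one_ne_zero, a1, a3, a4]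
      split_ifs <;> first | rfl | omega
    · simp only [prologue, execs, Instr.exec, IntOp.eval, start]
      simp only [Function.update_apply, Nat.reduceEqDiff, reduceIte, OfNat.zero_ne_ofNat,
        OfNat.one_ne_ofNat, a1, a2, Int.toNat_natCast]
      funext j
      simp [Function.update_apply, initC, start]

/-- A command, compiled and preceded by the prologue, solves its problem. -/
theorem solves_of_cmd {n m : ℕ} (hn : 0 < n) (p : Fin n → ℝ × ℝ) (c : Cmd) (hc : c.wf = true)
    {bd : ℕ → ℕ} (hbd : ∀ b < 9, initV n m b ≤ bd b) {T S : ℕ} (hT : 12 + c.cost bd ≤ T)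
    (hS : space n m ≤ S) {Out : (ℕ → ℤ) → Prop}
    (hout : ∀ f : ℕ → ℤ, (∀ i, i < 2 * m + 1 →
      f i = (c.den n m (orient n (initC p)) (initSt n m)).raw i) → Out f) :
    Solves (prologue ++ c.code 12) m p T S Out := by
  obtain ⟨h1, h2⟩ := prologue_spec (m := m) hn p
  obtain ⟨r1, p1⟩ := run_straight (prog := prologue ++ c.code 12) (S := space n m)
    (is := prologue) (by simp [prologue, Instr.straight]) (σ := start m p)
    ⟨[], c.code 12, by simp, rfl⟩ h1
  obtain ⟨t, τ, ht, r2, p2, h3⟩ := Cmd.correct hn (prog := prologue ++ c.code 12)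
    (fun v hv b hb => (hv.eq (consts_init n m) hb).trans_le (hbd b hb)) c hc 12 _ _
    ⟨prologue, [], by simp, rfl⟩ p1 h2
  -- The compiled run is confined to `space n m` cells; a larger allowance only weakens the
  -- requirement on addresses.
  have mono : ∀ {σ τ : State} {t : ℕ}, Run (prologue ++ c.code 12) (space n m) σ t τ →
      Run (prologue ++ c.code 12) S σ t τ := by
    intro σ τ t h
    induction h with
    | refl => exact Run.refl _
    | step hi hs _ ih =>
      refine Run.step hi ?_ ih
      have hS' : ((space n m : ℕ) : ℤ) ≤ (S : ℤ) := by exact_mod_cast hS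
      rename_i i _
      cases i <;> first | trivial | exact ⟨hs.1, hs.2.trans_le hS'⟩
  refine ⟨_, τ, ?_, mono (r1.trans r2), ?_, hout _ h3.raw⟩
  · have : prologue.length = 12 := rfl
    omega
  · have : prologue.length = 12 := rfl
    simp only [Halted, List.length_append, Cmd.length_code, p2, this, le_refl]

end RAM

/-! ### The counting program -/

namespace RAM

open Classical

/-- The three kinds of objects that are counted. -/
inductive Mode
  | gon | hole | island

/-- Adds to variable `56` the number of points before `y` (variable `43`) in the angular order
around `z`, starting from `s`. -/
def rankCmd (z s : ℕ) : Cmd :=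
  .loop 44 2 (.ite (.pos z s 44) (.ite (.pos z 44 43) (.prim (.plus 56 56 6)) .skip) .skip)

/-- Writes the point `y` (variable `43`) to its position in the angular order around `z`. -/
def sortStep (A : Fin 5) (row z s : ℕ) : Cmd :=
  .ite (.pos z s 43)
    (.seq (.prim (.set 56 1)) (.seq (rankCmd z s) (.prim (.st A row 56 7 43)))) .skip

/-- Sorts the points `y` to the left of the ray from `z` to `s` by angle around `z`, by rank
counting. The result is preceded by `s` and written to a row of an array. -/
def sortCmd (A : Fin 5) (row z s : ℕ) : Cmd :=
  .seq (.prim (.st A row 7 7 s)) (.loop 43 2 (sortStep A row z s))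

/-- Computes in variable `49` the weight of the step from `a` (variable `42`) to `y`
(variable `43`), given that variable `57` holds the number of points in the triangle and that
variable `49` holds `m + 1`. -/
def modeCmd : Mode → Cmd
  | .gon => .prim (.set 49 1)
  | .hole => .ite (.lt 7 57) .skip (.prim (.set 49 1))
  | .island => .prim (.plus 49 57 6)

/-- Adds to variable `57` the number of points in the triangle spanned by the variables
`40`, `42`, `43`. -/
def triCmd : Cmd :=
  .loop 44 2 (.ite (.pos 40 42 44) (.ite (.pos 42 43 44) (.ite (.pos 43 40 44)
    (.prim (.plus 57 57 6)) .skip) .skip) .skip)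

/-- Computes and stores the weight of the step from variable `42` to variable `43`. -/
def shiftStep (md : Mode) : Cmd :=
  .seq (.prim (.set 57 0)) (.seq triCmd (.seq (.prim (.modn 48 43)) (.seq (.prim (.plus 49 3 7))
    (.seq (.ite (.lt 40 48) (modeCmd md) .skip) (.prim (.st 1 42 43 7 49))))))

/-- Computes the table of the weights of all steps, for the root in variable `40`. -/
def shiftCmd (md : Mode) : Cmd := .loop 42 2 (.loop 43 2 (shiftStep md))

/-- Initializes the row of the root `r` (variable `40`) in the table of the numbers of chains;
variable `41` is the second vertex. -/
def initCmd : Cmd :=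
  .seq (.loop 43 2 (.loop 45 3 (.prim (.st 2 40 43 45 7))))
    (.seq (.prim (.set 50 2)) (.prim (.st 2 40 41 50 6)))

/-- Prolongs the chains with index `45`. -/
def extendStep : Cmd :=
  .seq (.prim (.plus 53 45 49)) (.ite (.lt 53 3)
    (.seq (.prim (.ld 50 4 7 7 45)) (.seq (.prim (.st 2 42 43 53 50))
      (.seq (.prim (.plus 52 53 54)) (.prim (.out 52 50))))) .skip)

/-- Extends the accumulated chains that end in `a` (variable `42`) by `y` (variable `43`). -/
def extendCmd : Cmd :=
  .seq (.prim (.ld 49 1 42 43 7))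
    (.seq (.loop 45 3 (.prim (.st 2 42 43 45 7))) (.loop 45 3 extendStep))

/-- Accumulates the chains with index `45`. -/
def gatherStep : Cmd :=
  .seq (.prim (.ld 50 4 7 7 45)) (.seq (.prim (.ld 51 2 48 42 45))
    (.seq (.prim (.plus 50 50 51)) (.prim (.st 4 7 7 45 50))))

/-- Accumulates the chains whose last step is from the antipode of `y` (variable `43`) to `a`. -/
def gatherCmd : Cmd := .seq (.prim (.plus 48 43 0)) (.loop 45 3 gatherStep)

/-- One step of the sweep. -/
def sweepStep : Cmd :=
  .seq (.prim (.ld 43 0 42 47 7)) (.ite (.pos 40 41 43) extendCmd gatherCmd)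

/-- The rotational sweep around `a`. -/
def sweepCmd : Cmd :=
  .seq (.prim (.ld 42 3 7 46 7))
    (.seq (.loop 45 3 (.prim (.st 4 7 7 45 7)))
      (.loop 47 4 sweepStep))

/-- All chains with the first two vertices in variables `40` and `41`. -/
def chainCmd : Cmd :=
  .seq initCmd (.seq (sortCmd 3 7 40 41) (.loop 46 4 sweepCmd))

/-- The chains with first vertex in variable `40` and second vertex in variable `41`, if the latter
exceeds the former. -/
def secondCmd : Cmd := .seq (.prim (.modn 48 41)) (.ite (.lt 40 48) chainCmd .skip)

/-- The polygons with root in variable `40`. -/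
def rootCmd (md : Mode) : Cmd :=
  .seq (.prim (.plus 55 40 0)) (.seq (.loop 42 2 (sortCmd 0 42 42 55))
    (.seq (shiftCmd md) (.loop 41 2 secondCmd)))

/-- All polygons, with the numbers of the vertices (or points) shifted by variable `54`. -/
def runCmd (md : Mode) : Cmd := .loop 40 0 (rootCmd md)

/-- Program for gons and holes. -/
def gonCmd : Cmd :=
  .seq (.prim (.set 54 0)) (.seq (runCmd .gon)
    (.seq (.prim (.plus 54 1 7)) (runCmd .hole)))

/-- Program for islands. -/
def islandCmd : Cmd := .seq (.prim (.set 54 0)) (runCmd .island)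

theorem gonCmd_wf : gonCmd.wf = true := by decide

theorem islandCmd_wf : islandCmd.wf = true := by decide

/-! ### Running time and space -/

/-- Bounds for the loop limits. -/
def bounds (n m : ℕ) (b : ℕ) : ℕ := if b = 3 then 2 * m else if b = 4 then n else initV n m b

theorem initV_le_bounds {n m : ℕ} (hm : 3 ≤ m) (b : ℕ) : initV n m b ≤ bounds n m b := by
  unfold bounds
  split_ifs with h3 h4
  · subst h3; simp [initV]; omega
  · subst h4; simp [initV]
  · exact le_rfl

theorem pow_mul_le_mul_pow {n m : ℕ} (hn : 1 ≤ n) (hm : 3 ≤ m) {i : ℕ} (hi : i ≤ 4) :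
    n ^ i ≤ m * n ^ 4 ∧ m * n ^ i ≤ m * n ^ 4 := by
  have h := Nat.pow_le_pow_right hn hi
  exact ⟨h.trans (Nat.le_mul_of_pos_left _ (by omega)), Nat.mul_le_mul_left _ h⟩

/-- The deepest nest consists of loops over `r`, `b`, `a`, the sweep position and the weight, around
a body of constant size; sorting and the triangle counts take `O(n⁴)`. Replacing the limits `n - 1`
and `m + 1` by `n` and `2m` turns the cost into a polynomial with monomials `n ^ i` and `m * n ^ i`,
`i ≤ 4`, each at most `m * n ^ 4`. -/
theorem runCmd_cost (md : Mode) {n m : ℕ} (hn : 1 ≤ n) (hm : 3 ≤ m) :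
    (runCmd md).cost (bounds n m) ≤ 10000 * (m * n ^ 4) := by
  have hmode : (modeCmd md).cost (bounds n m) ≤ 10 := by
    cases md <;> simp [modeCmd, Cmd.cost, Prim.code, Test.code]
  simp only [runCmd, rootCmd, secondCmd, chainCmd, sweepCmd, sweepStep, gatherCmd, gatherStep,
    extendCmd, extendStep, initCmd, shiftCmd, shiftStep, triCmd, sortCmd, sortStep, rankCmd,
    Cmd.cost, bounds, initV, Prim.code, Test.code, addrCode, red, ptCode, detCode]
  set q := (modeCmd md).cost _ with hq
  have hq10 : q ≤ 10 := hmode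
  clear_value q
  simp
  have h1 : n * n * n * q ≤ n * n * n * 10 := Nat.mul_le_mul_left _ hq10
  obtain ⟨a0, b0⟩ := pow_mul_le_mul_pow hn hm (i := 0) (by norm_num)
  obtain ⟨a1, b1⟩ := pow_mul_le_mul_pow hn hm (i := 1) (by norm_num)
  obtain ⟨a2, b2⟩ := pow_mul_le_mul_pow hn hm (i := 2) (by norm_num)
  obtain ⟨a3, b3⟩ := pow_mul_le_mul_pow hn hm (i := 3) (by norm_num)
  obtain ⟨a4, b4⟩ := pow_mul_le_mul_pow hn hm (i := 4) (by norm_num)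
  linarith

/-- The constant is twice the cost of one run, plus twelve instructions of prologue and two
assignments of the output offset. -/
theorem gonCmd_cost {n m : ℕ} (hn : 1 ≤ n) (hm : 3 ≤ m) :
    12 + gonCmd.cost (bounds n m) ≤ 20014 * (m * n ^ 4) := by
  have h1 := runCmd_cost .gon hn hm
  have h2 := runCmd_cost .hole hn hm
  have h3 := (pow_mul_le_mul_pow hn hm (i := 0) (by norm_num)).1
  simp only [gonCmd, Cmd.cost, Prim.code, List.length_singleton, pow_zero] at h3 ⊢
  omega

/-- Islands need a single run, so `O(m * n ^ 4)` already holds; the factor `m * n ≥ 1` is slack. -/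
theorem islandCmd_cost {n m : ℕ} (hn : 1 ≤ n) (hm : 3 ≤ m) :
    12 + islandCmd.cost (bounds n m) ≤ 20014 * (m ^ 2 * n ^ 5) := by
  have h1 := runCmd_cost .island hn hm
  have h3 := (pow_mul_le_mul_pow hn hm (i := 0) (by norm_num)).1
  have h4 : m * n ^ 4 * (1 * 1) ≤ m * n ^ 4 * (m * n) :=
    Nat.mul_le_mul_left _ (Nat.mul_le_mul (by omega) hn)
  have h5 : m * n ^ 4 * (m * n) = m ^ 2 * n ^ 5 := by ring
  simp only [islandCmd, Cmd.cost, Prim.code, List.length_singleton, pow_zero] at h3 ⊢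
  omega

theorem space_le {n m : ℕ} (hn : 1 ≤ n) (hm : 3 ≤ m) : space n m ≤ 60 * (m * n ^ 2) := by
  have h1 : 1 ≤ n ^ 2 := Nat.one_le_pow _ _ hn
  have h2 : n ≤ n ^ 2 := by nlinarith
  have h3 : m * 1 ≤ m * n ^ 2 := Nat.mul_le_mul_left _ h1
  have h4 : 3 * n ^ 2 ≤ m * n ^ 2 := Nat.mul_le_mul_right _ hm
  unfold space
  nlinarith

theorem space_le_mul {n m : ℕ} (hn : 1 ≤ n) (hm : 3 ≤ m) :
    space n m ≤ 60 * (m ^ 2 * n ^ 3) := by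
  have h4 : m * n ^ 2 * (1 * 1) ≤ m * n ^ 2 * (m * n) :=
    Nat.mul_le_mul_left _ (Nat.mul_le_mul (by omega) hn)
  have h5 : m * n ^ 2 * (m * n) = m ^ 2 * n ^ 3 := by ring
  have := space_le hn hm
  omega

/-! ### What the subroutines compute -/

theorem Cmd.le_of_mem_wr (c : Cmd) (hc : c.wf = true) : ∀ y ∈ c.wr, 40 ≤ y := by
  induction c with
  | prim p => cases p <;> simp_all [Cmd.wf, Prim.wf, Cmd.wr]
  | skip => simp [Cmd.wr]
  | seq c d h1 h2 =>
    intro y hy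
    simp only [Cmd.wf, Bool.and_eq_true] at hc
    simp only [Cmd.wr, List.mem_append] at hy
    exact hy.elim (h1 hc.1 y) (h2 hc.2 y)
  | ite t c d h1 h2 =>
    intro y hy
    simp only [Cmd.wf, Bool.and_eq_true] at hc
    simp only [Cmd.wr, List.mem_append] at hy
    exact hy.elim (h1 hc.1.2 y) (h2 hc.2 y)
  | loop x b c h1 =>
    intro y hy
    simp only [Cmd.wf, Bool.and_eq_true, decide_eq_true_eq] at hc
    simp only [Cmd.wr, List.mem_cons] at hy
    exact hy.elim (fun h => h ▸ hc.1.1.1) (h1 hc.1.2 y)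

theorem Consts.of_eq {n m : ℕ} {v v' : ℕ → ℕ} (h : Consts n m v) (he : ∀ x < 10, v' x = v x) :
    Consts n m v' := by
  constructor <;> rw [he _ (by norm_num)]
  exacts [h.c0, h.c1, h.c2, h.c3, h.c4, h.c5, h.c6, h.c7, h.c8]

theorem Cmd.den_consts {n m : ℕ} {o : ℕ → ℕ → ℕ → Prop} {c : Cmd} (hc : c.wf = true) {σ : St}
    (h : Consts n m σ.v) : Consts n m (c.den n m o σ).v :=
  h.of_eq fun x hx => Cmd.den_v c (fun hm => by have := c.le_of_mem_wr hc x hm; omega) σ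

/-- Used for both counting loops, the angular rank and the number of points in a triangle. -/
theorem count_loop {n m : ℕ} {o : ℕ → ℕ → ℕ → Prop} {σ : St} (hσ : σ.v 2 = 2 * n) {K : ℕ}
    (hK : K ≠ 44) {c : Cmd} {p : ℕ → Prop} [DecidablePred p]
    (h : ∀ i (τ : St), (∀ y, y ≠ 44 → y ∉ c.wr → τ.v y = σ.v y) →
      (c.den n m o (τ.put 44 i)).v K = τ.v K + if p i then 1 else 0) :
    ((Cmd.loop 44 2 c).den n m o σ).v K = σ.v K + Nat.count p (2 * n) := by
  refine Cmd.loop_rule hσ (fun i (τ : St) => τ.v K = σ.v K + Nat.count p i) (by simp) ?_ ?_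
  · intro i _ τ h1 _ _ h4
    rw [h i τ h1, h4, Nat.count_succ, add_assoc]
  · intro τ hτ
    simpa [St.put, hK] using hτ

/-- Number of points that precede `y` in the angular order around `z`, starting from `s`. -/
noncomputable def rk (n : ℕ) (o : ℕ → ℕ → ℕ → Prop) (z s y : ℕ) : ℕ :=
  Nat.count (fun x => o z s x ∧ o z x y) (2 * n)

/-- The sequence `f` starts with `s` and continues with the points to the left of the ray from `z`
to `s` in angular order around `z`. -/
structure IsSort (n : ℕ) (o : ℕ → ℕ → ℕ → Prop) (z s : ℕ) (f : ℕ → ℕ) : Prop where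
  zero : f 0 = s
  rank : ∀ y < 2 * n, o z s y → f (rk n o z s y + 1) = y

/-- Ranks are distinct and in range. -/
structure Sortable (n : ℕ) (o : ℕ → ℕ → ℕ → Prop) (z s : ℕ) : Prop where
  lt : ∀ y < 2 * n, o z s y → rk n o z s y + 1 < 2 * n
  inj : ∀ y < 2 * n, o z s y → ∀ y' < 2 * n, o z s y' → rk n o z s y = rk n o z s y' → y = y'

theorem Cmd.den_ite_pos {n m : ℕ} {o : ℕ → ℕ → ℕ → Prop} {t : Test} {c d : Cmd} {σ : St}
    (h : t.Holds o σ) : (Cmd.ite t c d).den n m o σ = c.den n m o σ := if_pos h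

theorem Cmd.den_ite_neg {n m : ℕ} {o : ℕ → ℕ → ℕ → Prop} {t : Test} {c d : Cmd} {σ : St}
    (h : ¬ t.Holds o σ) : (Cmd.ite t c d).den n m o σ = d.den n m o σ := if_neg h

theorem Cmd.den_seq {n m : ℕ} {o : ℕ → ℕ → ℕ → Prop} {c d : Cmd} {σ : St} :
    (Cmd.seq c d).den n m o σ = d.den n m o (c.den n m o σ) := rfl

theorem Cmd.den_prim {n m : ℕ} {o : ℕ → ℕ → ℕ → Prop} {p : Prim} {σ : St} :
    (Cmd.prim p).den n m o σ = p.den n m σ := rfl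

theorem rankCmd_spec {n m : ℕ} {o : ℕ → ℕ → ℕ → Prop} {z s : ℕ} {σ : St} (hc : Consts n m σ.v)
    (hz : z ∉ [44, 56]) (hs : s ∉ [44, 56]) :
    ((rankCmd z s).den n m o σ).v 56 = σ.v 56 + rk n o (σ.v z) (σ.v s) (σ.v 43) := by
  simp only [List.mem_cons, List.not_mem_nil, or_false, not_or] at hz hs
  rw [rankCmd, rk]
  refine count_loop (K := 56) hc.c2 (by norm_num) fun i τ hτ => ?_
  have e1 : τ.v z = σ.v z := hτ z hz.1 (by simp [Cmd.wr, hz.2])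
  have e2 : τ.v s = σ.v s := hτ s hs.1 (by simp [Cmd.wr, hs.2])
  have e3 : τ.v 43 = σ.v 43 := hτ 43 (by norm_num) (by simp [Cmd.wr])
  have e4 : τ.v 6 = 1 := by rw [hτ 6 (by norm_num) (by simp [Cmd.wr]), hc.c6]
  simp only [Cmd.den, Test.Holds, St.put, Prim.den, Function.update_self,
    Function.update_of_ne hz.1, Function.update_of_ne hs.1, ne_eq, Nat.reduceEqDiff,
    not_false_eq_true, Function.update_of_ne, e1, e2, e3]
  split_ifs <;> simp_all

/-- The rank counter starts at 1 because position 0 of the row is reserved for `s`. -/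
theorem sortStep_spec {n m : ℕ} {o : ℕ → ℕ → ℕ → Prop} (A : Fin 5) {row z s : ℕ} {σ : St}
    (hc : Consts n m σ.v) (hz : z ∉ [44, 56]) (hs : s ∉ [44, 56])
    (hr : row ∉ [44, 56]) (hrow : σ.v row < 2 * n)
    (hlt : o (σ.v z) (σ.v s) (σ.v 43) → rk n o (σ.v z) (σ.v s) (σ.v 43) + 1 < 2 * n) :
    ((sortStep A row z s).den n m o σ).a A = if o (σ.v z) (σ.v s) (σ.v 43) then
      upd (σ.a A) (σ.v row) (rk n o (σ.v z) (σ.v s) (σ.v 43) + 1) 0 (σ.v 43) else σ.a A := by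
  by_cases ho : o (σ.v z) (σ.v s) (σ.v 43)
  · rw [if_pos ho, sortStep, Cmd.den_ite_pos (show Test.Holds o (.pos z s 43) σ from ho),
      Cmd.den_seq, Cmd.den_seq, Cmd.den_prim, Cmd.den_prim]
    have hz' := hz
    have hs' := hs
    simp only [List.mem_cons, List.not_mem_nil, or_false, not_or] at hz' hs' hr
    set σ1 : St := (Prim.set 56 1).den n m σ with hσ1
    have c1 : Consts n m σ1.v := Cmd.den_consts (c := .prim (.set 56 1)) (o := o) (by decide) hc
    have h1 : ∀ x, x ≠ 56 → σ1.v x = σ.v x := fun x hx => by simp [hσ1, Prim.den, St.put, hx]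
    have h2 := rankCmd_spec (o := o) c1 hz hs
    rw [h1 z hz'.2, h1 s hs'.2, h1 43 (by norm_num)] at h2
    have h3 : ∀ x, x ≠ 44 → x ≠ 56 → ((rankCmd z s).den n m o σ1).v x = σ.v x := fun x a b => by
      rw [Cmd.den_v _ (by simp [rankCmd, Cmd.wr, a, b]), h1 x b]
    have h4 : ((rankCmd z s).den n m o σ1).a A = σ.a A :=
      Cmd.den_a _ (by simp [rankCmd, Cmd.wrA]) _
    have h5 : σ1.v 56 = 1 := by simp [hσ1, Prim.den, St.put]
    simp only [Prim.den, Function.update_self]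
    rw [h4, h3 row hr.1 hr.2, h2, h3 7 (by norm_num) (by norm_num),
      h3 43 (by norm_num) (by norm_num), hc.c7, h5, Nat.mod_eq_of_lt hrow, Nat.zero_mod, add_comm 1,
      Nat.mod_eq_of_lt (hlt ho)]
  · rw [if_neg ho, sortStep, Cmd.den_ite_neg (show ¬ Test.Holds o (.pos z s 43) σ from ho), Cmd.den]

/-- Distinct points have distinct ranks, so no entry written earlier in the loop is overwritten.
Cells that correspond to no rank keep arbitrary contents, which `IsSort` leaves unspecified. -/
theorem sortCmd_spec {n m : ℕ} {o : ℕ → ℕ → ℕ → Prop} (A : Fin 5) {row z s : ℕ} {σ : St}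
    (hc : Consts n m σ.v) (hz : z ∉ [43, 44, 56]) (hs : s ∉ [43, 44, 56])
    (hr : row ∉ [43, 44, 56]) (hrow : σ.v row < 2 * n)
    (hS : Sortable n o (σ.v z) (σ.v s)) :
    IsSort n o (σ.v z) (σ.v s) (fun t => ((sortCmd A row z s).den n m o σ).a A (σ.v row) t 0) ∧
      ∀ i, i ≠ σ.v row → ((sortCmd A row z s).den n m o σ).a A i = σ.a A i := by
  simp only [List.mem_cons, List.not_mem_nil, or_false, not_or] at hz hs hr
  obtain ⟨z1, z2, z3⟩ := hz
  obtain ⟨s1, s2, s3⟩ := hs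
  obtain ⟨r1, r2, r3⟩ := hr
  have hrm := Nat.mod_eq_of_lt hrow
  rw [sortCmd, Cmd.den]
  set σ1 := (Cmd.prim (.st A row 7 7 s)).den n m o σ with hσ1
  have hv1 : σ1.v = σ.v := rfl
  have key := Cmd.loop_rule (n := n) (m := m) (o := o) (x := 43) (b := 2) (σ := σ1) (N := 2 * n)
    (c := sortStep A row z s) (by rw [hv1, hc.c2])
    (fun i (τ : St) => τ.a A (σ.v row) 0 0 = σ.v s ∧
      (∀ y < i, o (σ.v z) (σ.v s) y → τ.a A (σ.v row) (rk n o (σ.v z) (σ.v s) y + 1) 0 = y) ∧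
      ∀ i, i ≠ σ.v row → τ.a A i = σ.a A i)
    ?_ ?_ (fun τ h => h)
  · exact ⟨⟨key.1, key.2.1⟩, key.2.2⟩
  · refine ⟨?_, by simp, fun i hi => ?_⟩
    · simp [hσ1, Cmd.den, Prim.den, upd, hrm, hc.c7]
    · simp only [hσ1, Cmd.den, Prim.den, Function.update_self, hrm]
      funext j k
      simp [upd, hi]
  · rintro i hi τ h1 - - ⟨h4, h5, h6⟩
    have hv : ∀ x, x ≠ 43 → x ≠ 44 → x ≠ 56 → (τ.put 43 i).v x = σ.v x := fun x a b c => by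
      rw [← hv1, ← h1 x a (by simp [sortStep, rankCmd, Cmd.wr, b, c])]
      simp [St.put, a]
    have h43 : (τ.put 43 i).v 43 = i := by simp [St.put]
    have hz' := hv z z1 z2 z3
    have hs' := hv s s1 s2 s3
    have hr' := hv row r1 r2 r3
    have hstep := sortStep_spec (m := m) (o := o) A (row := row) (z := z) (s := s) (σ := τ.put 43 i)
      (hc.of_eq fun x hx => hv x (by omega) (by omega) (by omega)) (by simp [z2, z3])
      (by simp [s2, s3]) (by simp [r2, r3]) (by rw [hr']; exact hrow)
      (by rw [hz', hs', h43]; exact hS.lt i hi)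
    rw [hstep, hz', hs', hr', h43]
    have ha : (τ.put 43 i).a A = τ.a A := rfl
    rw [ha]
    split_ifs with ho
    · refine ⟨by simp [upd, h4], fun y hy hoy => ?_, fun k hk => ?_⟩
      · simp only [upd, true_and, and_true, Nat.add_right_cancel_iff]
        rcases Nat.lt_succ_iff_lt_or_eq.1 hy with hy | rfl
        · have hne : rk n o (σ.v z) (σ.v s) y ≠ rk n o (σ.v z) (σ.v s) i := fun he => by
            have := hS.inj y (by omega) hoy i hi ho he
            omega
          rw [if_neg hne]
          exact h5 y hy hoy
        · simp
      · funext j l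
        simp [upd, hk, h6 k hk]
    · refine ⟨h4, fun y hy hoy => ?_, h6⟩
      rcases Nat.lt_succ_iff_lt_or_eq.1 hy with hy | rfl
      · exact h5 y hy hoy
      · exact absurd hoy ho

/-- Number of points inside the triangle `r a y`. -/
noncomputable def tri (n : ℕ) (o : ℕ → ℕ → ℕ → Prop) (r a y : ℕ) : ℕ :=
  Nat.count (fun x => o r a x ∧ o a y x ∧ o y r x) (2 * n)

/-- Weight of the last vertex, given the number of points in the last triangle. -/
def Mode.weight (m : ℕ) : Mode → ℕ → ℕ
  | .gon, _ => 1
  | .hole, t => if 0 < t then m + 1 else 1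
  | .island, t => t + 1

/-- Weight of the step from `a` to `y`; vertices that do not exceed the root are excluded by a
large weight. -/
noncomputable def shift (md : Mode) (n m : ℕ) (o : ℕ → ℕ → ℕ → Prop) (r a y : ℕ) : ℕ :=
  if r < y % n then md.weight m (tri n o r a y) else m + 1

theorem modeCmd_wr (md : Mode) : ∀ x ∈ (modeCmd md).wr, x = 49 := by
  cases md <;> simp [modeCmd, Cmd.wr]

theorem modeCmd_wrA (md : Mode) : (modeCmd md).wrA = [] := by
  cases md <;> simp [modeCmd, Cmd.wrA]

theorem modeCmd_spec {n m : ℕ} {o : ℕ → ℕ → ℕ → Prop} (md : Mode) {σ : St}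
    (hc : Consts n m σ.v) (h : σ.v 49 = m + 1) :
    ((modeCmd md).den n m o σ).v 49 = md.weight m (σ.v 57) := by
  cases md
  · simp [modeCmd, Cmd.den, Prim.den, St.put, Mode.weight]
  · simp only [modeCmd, Cmd.den, Test.Holds, hc.c7, Mode.weight]
    split_ifs
    · exact h
    · simp [Prim.den, St.put]
  · simp [modeCmd, Cmd.den, Prim.den, St.put, Mode.weight, hc.c6]

theorem triCmd_spec {n m : ℕ} {o : ℕ → ℕ → ℕ → Prop} {σ : St} (hc : Consts n m σ.v) :
    (triCmd.den n m o σ).v 57 = σ.v 57 + tri n o (σ.v 40) (σ.v 42) (σ.v 43) := by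
  rw [triCmd, tri]
  refine count_loop (K := 57) hc.c2 (by norm_num) fun i τ hτ => ?_
  have e1 : τ.v 40 = σ.v 40 := hτ 40 (by norm_num) (by simp [Cmd.wr])
  have e2 : τ.v 42 = σ.v 42 := hτ 42 (by norm_num) (by simp [Cmd.wr])
  have e3 : τ.v 43 = σ.v 43 := hτ 43 (by norm_num) (by simp [Cmd.wr])
  have e4 : τ.v 6 = 1 := by rw [hτ 6 (by norm_num) (by simp [Cmd.wr]), hc.c6]
  simp only [Cmd.den, Test.Holds, St.put, Prim.den, Function.update_self, ne_eq, Nat.reduceEqDiff,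
    not_false_eq_true, Function.update_of_ne, e1, e2, e3]
  split_ifs <;> simp_all

/-- Variable 49 is preset to `m + 1`, so the branches that do nothing (index not above the root, or
a nonempty triangle in hole mode) leave the prohibitive weight in place. -/
theorem shiftStep_spec {n m : ℕ} {o : ℕ → ℕ → ℕ → Prop} (md : Mode) {σ : St}
    (hc : Consts n m σ.v) (h2 : σ.v 42 < 2 * n) (h3 : σ.v 43 < 2 * n) :
    ((shiftStep md).den n m o σ).a 1 =
      upd (σ.a 1) (σ.v 42) (σ.v 43) 0 (shift md n m o (σ.v 40) (σ.v 42) (σ.v 43)) := by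
  rw [shiftStep, Cmd.den_seq]
  set σ1 := (Cmd.prim (.set 57 0)).den n m o σ with hσ1
  rw [Cmd.den_seq]
  set σ2 := triCmd.den n m o σ1 with hσ2
  have c1 : Consts n m σ1.v := Cmd.den_consts (by decide) hc
  have c2 : Consts n m σ2.v := Cmd.den_consts (by decide) c1
  have t2 : σ2.v 57 = tri n o (σ.v 40) (σ.v 42) (σ.v 43) := by
    rw [hσ2, triCmd_spec c1]; simp [hσ1, Cmd.den, Prim.den, St.put]
  have f2 : ∀ x, x ≠ 44 → x ≠ 57 → σ2.v x = σ.v x := fun x a b => by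
    rw [hσ2, Cmd.den_v _ (by simp [triCmd, Cmd.wr, a, b])]
    simp [hσ1, Cmd.den, Prim.den, St.put, b]
  have a2 : σ2.a 1 = σ.a 1 := by
    rw [hσ2, Cmd.den_a _ (by simp [triCmd, Cmd.wrA])]; rfl
  rw [Cmd.den_seq, Cmd.den_seq]
  set σ3 := (Cmd.prim (.plus 49 3 7)).den n m o ((Cmd.prim (.modn 48 43)).den n m o σ2) with hσ3
  have c3 : Consts n m σ3.v := Cmd.den_consts (by decide) (Cmd.den_consts (by decide) c2)
  have f3 : ∀ x, x ≠ 44 → x ≠ 57 → x ≠ 48 → x ≠ 49 → σ3.v x = σ.v x := fun x a b c d => by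
    rw [← f2 x a b]; simp [hσ3, Cmd.den, Prim.den, St.put, c, d]
  have v49 : σ3.v 49 = m + 1 := by simp [hσ3, Cmd.den, Prim.den, St.put, c2.c3, c2.c7]
  have v48 : σ3.v 48 = σ.v 43 % n := by simp [hσ3, Cmd.den, Prim.den, St.put, f2]
  have v57 : σ3.v 57 = tri n o (σ.v 40) (σ.v 42) (σ.v 43) := by
    rw [← t2]; simp [hσ3, Cmd.den, Prim.den, St.put]
  have a3 : σ3.a 1 = σ.a 1 := by rw [← a2]; rfl
  rw [Cmd.den_seq]
  set σ4 := (Cmd.ite (.lt 40 48) (modeCmd md) .skip).den n m o σ3 with hσ4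
  have f4 : ∀ x, x ≠ 49 → σ4.v x = σ3.v x := fun x a =>
    Cmd.den_v _ (by simp only [Cmd.wr, List.append_nil]; exact fun h => a (modeCmd_wr md x h)) _
  have a4 : σ4.a 1 = σ.a 1 := by
    rw [← a3]; exact Cmd.den_a _ (by simp [Cmd.wrA, modeCmd_wrA]) _
  have v49' : σ4.v 49 = shift md n m o (σ.v 40) (σ.v 42) (σ.v 43) := by
    have e40 : σ3.v 40 = σ.v 40 := f3 40 (by norm_num) (by norm_num) (by norm_num) (by norm_num)
    rw [hσ4, Cmd.den, Test.Holds, v48, e40, shift]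
    split_ifs
    · rw [modeCmd_spec md c3 v49, v57]
    · exact v49
  have e42 : σ4.v 42 = σ.v 42 := by rw [f4, f3] <;> norm_num
  have e43 : σ4.v 43 = σ.v 43 := by rw [f4, f3] <;> norm_num
  have e7 : σ4.v 7 = 0 := by rw [f4, c3.c7]; norm_num
  rw [Cmd.den_prim]
  simp only [Prim.den, Function.update_self, a4, e42, e43, e7, v49',
    Nat.mod_eq_of_lt h2, Nat.mod_eq_of_lt h3, Nat.zero_mod]

theorem shiftStep_wr (md : Mode) : ∀ x ∈ (shiftStep md).wr, x ∈ [44, 48, 49, 57] := by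
  cases md <;> decide

theorem shiftStep_wrA (md : Mode) : ∀ x ∈ (shiftStep md).wrA, x = 1 := by
  cases md <;> decide

theorem shiftCmd_spec {n m : ℕ} {o : ℕ → ℕ → ℕ → Prop} (md : Mode) {σ : St}
    (hc : Consts n m σ.v) :
    ∀ a < 2 * n, ∀ y < 2 * n, ((shiftCmd md).den n m o σ).a 1 a y 0 =
      shift md n m o (σ.v 40) a y := by
  have hm := shiftStep_wr md
  refine Cmd.loop_rule hc.c2 (fun i (τ : St) => ∀ a < i, ∀ y < 2 * n, τ.a 1 a y 0 =
      shift md n m o (σ.v 40) a y) (by simp) ?_ (fun τ h => h)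
  rintro i hi τ h1 - - h4
  have h1' : ∀ x, x ∉ [42, 43, 44, 48, 49, 57] → (τ.put 42 i).v x = σ.v x := fun x hx => by
    simp only [List.mem_cons, List.not_mem_nil, or_false, not_or] at hx hm
    rw [← h1 x hx.1 (by
      simp only [Cmd.wr, List.mem_cons, not_or]
      exact ⟨hx.2.1, fun h => by have := hm x h; omega⟩)]
    simp [St.put, hx.1]
  have key := Cmd.loop_rule (n := n) (m := m) (o := o) (x := 43) (b := 2) (σ := τ.put 42 i)
    (N := 2 * n) (c := shiftStep md) (by rw [h1' 2 (by simp), hc.c2])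
    (fun j (υ : St) => (∀ a < i, ∀ y < 2 * n, υ.a 1 a y 0 = shift md n m o (σ.v 40) a y) ∧
      ∀ y < j, υ.a 1 i y 0 = shift md n m o (σ.v 40) i y)
      ⟨h4, by simp⟩ ?_ (fun τ h => h)
  · intro a ha
    rcases Nat.lt_succ_iff_lt_or_eq.1 ha with ha | rfl
    · exact key.1 a ha
    · exact key.2
  · rintro j hj υ g1 - - ⟨g4, g5⟩
    have g1' : ∀ x, x ∉ [43, 44, 48, 49, 57] → (υ.put 43 j).v x = (τ.put 42 i).v x :=
      fun x hx => by
        simp only [List.mem_cons, List.not_mem_nil, or_false, not_or] at hx hm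
        rw [← g1 x hx.1 fun h => by have := hm x h; omega]
        simp [St.put, hx.1]
    have e42 : (υ.put 43 j).v 42 = i := by rw [g1' 42 (by simp)]; simp [St.put]
    have e43 : (υ.put 43 j).v 43 = j := by simp [St.put]
    have e40 : (υ.put 43 j).v 40 = σ.v 40 := by rw [g1' 40 (by simp), h1' 40 (by simp)]
    have hcυ : Consts n m (υ.put 43 j).v := hc.of_eq fun x hx => by
      rw [g1' x (by simp; omega), h1' x (by simp; omega)]
    rw [shiftStep_spec md hcυ (by rw [e42]; exact hi) (by rw [e43]; exact hj), e42, e43, e40]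
    refine ⟨fun a ha y hy => ?_, fun y hy => ?_⟩
    · rw [← g4 a ha y hy]
      simp [upd, ha.ne, St.put]
    · simp only [upd, true_and, and_true]
      split_ifs with h
      · rw [h]
      · exact g5 y (by omega)

/-- Antipode of a signed point. -/
def anti (n u : ℕ) : ℕ := (u + n) % (2 * n)

/-- Only the row of the root is cleared; the other cells are written before they are read. The
single entry 1 stands for the chain with vertices `r`, `b` alone, which has weight 2. -/
theorem initCmd_spec {n m : ℕ} {o : ℕ → ℕ → ℕ → Prop} {σ : St} (hc : Consts n m σ.v) (hm : 3 ≤ m)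
    (hr : σ.v 40 < 2 * n) (hb : σ.v 41 < 2 * n) : ∀ y < 2 * n, ∀ k < m + 1,
      (initCmd.den n m o σ).a 2 (σ.v 40) y k = if y = σ.v 41 ∧ k = 2 then 1 else 0 := by
  rw [initCmd, Cmd.den_seq]
  set σ1 := Cmd.den n m o _ σ with hσ1
  have hv : ∀ x, x ≠ 43 → x ≠ 45 → σ1.v x = σ.v x := fun x a b =>
    Cmd.den_v _ (by simp [Cmd.wr, a, b]) _
  have key : ∀ y < 2 * n, ∀ k < m + 1, σ1.a 2 (σ.v 40) y k = 0 := by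
    refine Cmd.loop_rule hc.c2 (fun i (τ : St) => ∀ y < i, ∀ k < m + 1, τ.a 2 (σ.v 40) y k = 0)
      (by simp) ?_ (fun τ h => h)
    rintro i hi τ h1 - - h4
    have h1' : ∀ x, x ≠ 43 → x ≠ 45 → (τ.put 43 i).v x = σ.v x := fun x a b => by
      rw [← h1 x a (by simp [Cmd.wr, b])]; simp [St.put, a]
    have := Cmd.loop_rule (n := n) (m := m) (o := o) (x := 45) (b := 3) (σ := τ.put 43 i)
      (N := m + 1) (c := .prim (.st 2 40 43 45 7)) (by rw [h1' 3 (by simp) (by simp), hc.c3])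
      (fun j (υ : St) => (∀ y < i, ∀ k < m + 1, υ.a 2 (σ.v 40) y k = 0) ∧
        ∀ k < j, υ.a 2 (σ.v 40) i k = 0)
        ⟨h4, by simp⟩ ?_ (fun τ h => h)
    · intro y hy
      rcases Nat.lt_succ_iff_lt_or_eq.1 hy with hy | rfl
      · exact this.1 y hy
      · exact this.2
    · rintro j hj υ g1 - - ⟨g4, g5⟩
      have e40 : υ.v 40 = σ.v 40 := by rw [g1 40 (by simp) (by simp [Cmd.wr]), h1'] <;> simp
      have e43 : υ.v 43 = i := by rw [g1 43 (by simp) (by simp [Cmd.wr])]; simp [St.put]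
      have e7 : υ.v 7 = 0 := by
        rw [g1 7 (by simp) (by simp [Cmd.wr]), h1' 7 (by simp) (by simp), hc.c7]
      simp only [Cmd.den_prim, Prim.den, St.put, ne_eq, Nat.reduceEqDiff, not_false_eq_true,
        Function.update_of_ne, Function.update_self, e40, e43, e7, Nat.mod_eq_of_lt hi,
        Nat.mod_eq_of_lt hj, Nat.mod_eq_of_lt hr, upd, true_and]
      refine ⟨fun y hy k hk => ?_, fun k hk => ?_⟩
      · rw [if_neg (by omega), g4 y hy k hk]
      · split_ifs with h
        · rfl
        · exact g5 k (by omega)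
  intro y hy k hk
  have e40 : σ1.v 40 = σ.v 40 := hv 40 (by simp) (by simp)
  have e41 : σ1.v 41 = σ.v 41 := hv 41 (by simp) (by simp)
  have e6 : σ1.v 6 = 1 := by rw [hv 6 (by simp) (by simp), hc.c6]
  simp only [Cmd.den_seq, Cmd.den_prim, Prim.den, St.put, ne_eq, Nat.reduceEqDiff,
    not_false_eq_true, Function.update_of_ne, Function.update_self, e40, e41, e6,
    Nat.mod_eq_of_lt hr, Nat.mod_eq_of_lt hb, upd, true_and,
    Nat.mod_eq_of_lt (show 2 < m + 1 by omega), key y hy k hk]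

/-- Weights above `m` are dropped here. This truncation is what discards every step of weight `m +
1`. -/
theorem extendStep_spec {n m : ℕ} {o : ℕ → ℕ → ℕ → Prop} {σ : St} (hc : Consts n m σ.v)
    (h2 : σ.v 42 < 2 * n) (h3 : σ.v 43 < 2 * n) (hk : σ.v 45 < m + 1) (hoff : σ.v 54 ≤ m) :
    ((extendStep.den n m o σ).a 2 = if σ.v 45 + σ.v 49 < m + 1 then
      upd (σ.a 2) (σ.v 42) (σ.v 43) (σ.v 45 + σ.v 49) (σ.a 4 0 0 (σ.v 45)) else σ.a 2) ∧
    (extendStep.den n m o σ).raw = if σ.v 45 + σ.v 49 < m + 1 then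
      Function.update σ.raw (σ.v 45 + σ.v 49 + σ.v 54)
        (σ.raw (σ.v 45 + σ.v 49 + σ.v 54) + σ.a 4 0 0 (σ.v 45)) else σ.raw := by
  rw [extendStep, Cmd.den_seq]
  by_cases h : σ.v 45 + σ.v 49 < m + 1
  · rw [Cmd.den_ite_pos]
    · simp only [Cmd.den_seq, Cmd.den_prim, Prim.den, St.put, ne_eq, Nat.reduceEqDiff,
        not_false_eq_true, Function.update_of_ne, Function.update_self, hc.c7, Nat.zero_mod, h,
        if_true, Nat.mod_eq_of_lt h2, Nat.mod_eq_of_lt h3, Nat.mod_eq_of_lt hk, Nat.mod_eq_of_lt h,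
        Nat.mod_eq_of_lt (show σ.v 45 + σ.v 49 + σ.v 54 < 2 * m + 1 by omega),
        and_self]
    · simp [Test.Holds, Cmd.den_prim, Prim.den, St.put, hc.c3, h]
  · rw [Cmd.den_ite_neg]
    · simp [h, Cmd.den, Prim.den, St.put]
    · simp [Test.Holds, Cmd.den_prim, Prim.den, St.put, hc.c3]
      omega

/-- The new cells are the accumulator shifted by the weight of the step. The same numbers go to the
output, since every chain with at least three vertices already closes up to a polygon. -/
theorem extendCmd_spec {n m : ℕ} {o : ℕ → ℕ → ℕ → Prop} {σ : St} (hc : Consts n m σ.v)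
    (h2 : σ.v 42 < 2 * n) (h3 : σ.v 43 < 2 * n) (hoff : σ.v 54 ≤ m) {e : ℕ → ℕ}
    (he : ∀ k < m + 1, e k = if k < σ.a 1 (σ.v 42) (σ.v 43) 0 then 0 else
      σ.a 4 0 0 (k - σ.a 1 (σ.v 42) (σ.v 43) 0)) :
    (∀ k < m + 1, (extendCmd.den n m o σ).a 2 (σ.v 42) (σ.v 43) k = e k) ∧
    (∀ i, i ≠ σ.v 42 → (extendCmd.den n m o σ).a 2 i = σ.a 2 i) ∧
    (∀ j, j ≠ σ.v 43 → (extendCmd.den n m o σ).a 2 (σ.v 42) j = σ.a 2 (σ.v 42) j) ∧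
    ∀ x < 2 * m + 1, (extendCmd.den n m o σ).raw x = σ.raw x +
      if σ.v 54 ≤ x ∧ x ≤ σ.v 54 + m then e (x - σ.v 54) else 0 := by
  set sh := σ.a 1 (σ.v 42) (σ.v 43) 0 with hsh
  rw [extendCmd, Cmd.den_seq, Cmd.den_seq]
  set σ1 := (Cmd.prim (.ld 49 1 42 43 7)).den n m o σ with hσ1
  have v1 : ∀ x, x ≠ 49 → σ1.v x = σ.v x := fun x h => Cmd.den_v _ (by simp [Cmd.wr, h]) _
  have v49 : σ1.v 49 = sh := by
    simp [hσ1, Cmd.den, Prim.den, St.put, Nat.mod_eq_of_lt h2, Nat.mod_eq_of_lt h3, hc.c7, hsh]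
  have c1 : Consts n m σ1.v := Cmd.den_consts (by decide) hc
  have a1 : σ1.a = σ.a := rfl
  have r1 : σ1.raw = σ.raw := rfl
  set σ2 := Cmd.den n m o _ σ1 with hσ2
  have v2 : ∀ x, x ≠ 45 → σ2.v x = σ1.v x := fun x h => Cmd.den_v _ (by simp [Cmd.wr, h]) _
  have r2 : σ2.raw = σ.raw := Cmd.den_raw _ (by simp [Cmd.quiet]) _
  have ac2 : σ2.a 4 = σ.a 4 := Cmd.den_a _ (by simp [Cmd.wrA]) _
  have e42 : σ2.v 42 = σ.v 42 := by rw [v2, v1] <;> simp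
  have e43 : σ2.v 43 = σ.v 43 := by rw [v2, v1] <;> simp
  have e54 : σ2.v 54 = σ.v 54 := by rw [v2, v1] <;> simp
  have e49 : σ2.v 49 = sh := by rw [v2, v49]; simp
  have c2 : Consts n m σ2.v := Cmd.den_consts (by decide) c1
  have k2 : (∀ k < m + 1, σ2.a 2 (σ.v 42) (σ.v 43) k = 0) ∧
      (∀ i, i ≠ σ.v 42 → σ2.a 2 i = σ.a 2 i) ∧
      (∀ j, j ≠ σ.v 43 → σ2.a 2 (σ.v 42) j = σ.a 2 (σ.v 42) j) := by
    refine Cmd.loop_rule c1.c3 (fun i (τ : St) => (∀ k < i, τ.a 2 (σ.v 42) (σ.v 43) k = 0) ∧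
      (∀ i, i ≠ σ.v 42 → τ.a 2 i = σ.a 2 i) ∧
      (∀ j, j ≠ σ.v 43 → τ.a 2 (σ.v 42) j = σ.a 2 (σ.v 42) j))
      ⟨by simp, fun _ _ => rfl, fun _ _ => rfl⟩ ?_ (fun τ h => h)
    rintro i hi τ g1 - - ⟨g2, g3, g4⟩
    have f42 : τ.v 42 = σ.v 42 := by rw [g1 42, v1] <;> simp [Cmd.wr]
    have f43 : τ.v 43 = σ.v 43 := by rw [g1 43, v1] <;> simp [Cmd.wr]
    have f7 : τ.v 7 = 0 := by rw [g1 7, c1.c7] <;> simp [Cmd.wr]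
    simp only [Cmd.den_prim, Prim.den, St.put, ne_eq, Nat.reduceEqDiff, not_false_eq_true,
      Function.update_of_ne, Function.update_self, f42, f43, f7, Nat.mod_eq_of_lt h2,
      Nat.mod_eq_of_lt h3, Nat.mod_eq_of_lt hi]
    refine ⟨fun k hk => ?_, fun i' hi' => ?_, fun j hj => ?_⟩
    · simp only [upd, true_and]
      split_ifs with h
      · rfl
      · exact g2 k (by omega)
    · funext j k
      simp [upd, hi', g3 i' hi']
    · funext k
      simp [upd, hj, g4 j hj]
  -- After `i` rounds exactly the indices from `sh` to `i + sh - 1` that do not exceed `m` carry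
  -- shifted accumulator values; the output shows the same window, moved by the offset in variable
  -- 54.
  have key := Cmd.loop_rule (n := n) (m := m) (o := o) (x := 45) (b := 3) (σ := σ2)
    (N := m + 1) (c := extendStep) c2.c3
    (fun i (τ : St) => (∀ k < m + 1, τ.a 2 (σ.v 42) (σ.v 43) k =
        if sh ≤ k ∧ k < i + sh then σ.a 4 0 0 (k - sh) else 0) ∧
      (∀ i, i ≠ σ.v 42 → τ.a 2 i = σ.a 2 i) ∧
      (∀ j, j ≠ σ.v 43 → τ.a 2 (σ.v 42) j = σ.a 2 (σ.v 42) j) ∧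
      ∀ x < 2 * m + 1, τ.raw x = σ.raw x + if σ.v 54 + sh ≤ x ∧ x < σ.v 54 + i + sh ∧
        x ≤ σ.v 54 + m then σ.a 4 0 0 (x - σ.v 54 - sh) else 0)
    ?_ ?_ (fun τ h => h)
  · obtain ⟨q1, q2, q3, q4⟩ := key
    refine ⟨fun k hk => ?_, q2, q3, fun x hx => ?_⟩
    · rw [q1 k hk, he k hk]
      by_cases h : k < sh
      · rw [if_neg (by omega), if_pos h]
      · rw [if_pos (by omega), if_neg h]
    · rw [q4 x hx]
      by_cases h : σ.v 54 ≤ x ∧ x ≤ σ.v 54 + m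
      · rw [if_pos h, he _ (by omega)]
        by_cases h' : x - σ.v 54 < sh
        · rw [if_neg (by omega), if_pos h']
        · rw [if_pos (by omega), if_neg h']
      · rw [if_neg h, if_neg (by omega)]
  · refine ⟨fun k hk => ?_, k2.2.1, k2.2.2, fun x hx => ?_⟩
    · rw [if_neg (by omega), k2.1 k hk]
    · rw [if_neg (by omega), r2, add_zero]
  · rintro i hi τ g1 g2 - ⟨g3, g4, g5, g6⟩
    have w : ∀ x, x ≠ 45 → x ∉ extendStep.wr → (τ.put 45 i).v x = σ2.v x := fun x a b => by
      rw [← g1 x a b]; simp [St.put, a]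
    have w42 : (τ.put 45 i).v 42 = σ.v 42 := by rw [w 42 (by simp) (by decide), e42]
    have w43 : (τ.put 45 i).v 43 = σ.v 43 := by rw [w 43 (by simp) (by decide), e43]
    have w54 : (τ.put 45 i).v 54 = σ.v 54 := by rw [w 54 (by simp) (by decide), e54]
    have w49 : (τ.put 45 i).v 49 = sh := by rw [w 49 (by simp) (by decide), e49]
    have w45 : (τ.put 45 i).v 45 = i := by simp [St.put]
    have wa : (τ.put 45 i).a 4 = σ.a 4 := by rw [← ac2]; exact g2 4 (by decide)
    have wa' : (τ.put 45 i).a 2 = τ.a 2 := rfl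
    have wr' : (τ.put 45 i).raw = τ.raw := rfl
    have hcτ : Consts n m (τ.put 45 i).v := c2.of_eq fun x hx => w x (by omega) fun h => by
      have := Cmd.le_of_mem_wr extendStep (by decide) x h
      omega
    obtain ⟨s1, s2⟩ := extendStep_spec (o := o) hcτ (by rw [w42]; exact h2) (by rw [w43]; exact h3)
      (by rw [w45]; exact hi) (by rw [w54]; exact hoff)
    rw [w42, w43, w45, w49, wa, wa'] at s1
    rw [w45, w49, w54, wa, wr'] at s2
    rw [s1, s2]
    by_cases h : i + sh < m + 1
    · simp only [if_pos h]
      refine ⟨fun k hk => ?_, fun i' hi' => ?_, fun j hj => ?_, fun x hx => ?_⟩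
      · simp only [upd, true_and]
        split_ifs with p1 p2 p2
        · rw [p1, Nat.add_sub_cancel]
        · omega
        · rw [g3 k hk, if_pos (by omega)]
        · rw [g3 k hk, if_neg (by omega)]
      · funext j k
        simp [upd, hi', g4 i' hi']
      · funext k
        simp [upd, hj, g5 j hj]
      · rw [Function.update_apply]
        split_ifs with p1 p2 p2
        · rw [← p1, g6 x hx, if_neg (by omega), add_zero]
          congr 2
          omega
        · omega
        · rw [g6 x hx, if_pos (by omega)]
        · rw [g6 x hx, if_neg (by omega)]
    · simp only [if_neg h]
      refine ⟨fun k hk => ?_, g4, g5, fun x hx => ?_⟩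
      · rw [g3 k hk]
        by_cases p : sh ≤ k
        · rw [if_pos (by omega), if_pos (by omega)]
        · rw [if_neg (by omega), if_neg (by omega)]
      · rw [g6 x hx]
        by_cases p : σ.v 54 + sh ≤ x ∧ x ≤ σ.v 54 + m
        · rw [if_pos (by omega), if_pos (by omega)]
        · rw [if_neg (by omega), if_neg (by omega)]

/-- Storing `y + n` suffices to address the antipode, since array indices are reduced modulo `2 *
n`. -/
theorem gatherCmd_spec {n m : ℕ} {o : ℕ → ℕ → ℕ → Prop} {σ : St} (hc : Consts n m σ.v)
    (h2 : σ.v 42 < 2 * n) : ∀ k < m + 1, (gatherCmd.den n m o σ).a 4 0 0 k =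
      σ.a 4 0 0 k + σ.a 2 (anti n (σ.v 43)) (σ.v 42) k := by
  rw [gatherCmd, Cmd.den_seq]
  set σ1 := (Cmd.prim (.plus 48 43 0)).den n m o σ with hσ1
  have v1 : ∀ x, x ≠ 48 → σ1.v x = σ.v x := fun x h => Cmd.den_v _ (by simp [Cmd.wr, h]) _
  have v48 : σ1.v 48 = σ.v 43 + n := by simp [hσ1, Cmd.den, Prim.den, St.put, hc.c0]
  have c1 : Consts n m σ1.v := Cmd.den_consts (by decide) hc
  have a1 : σ1.a = σ.a := rfl
  have key := Cmd.loop_rule (n := n) (m := m) (o := o) (x := 45) (b := 3) (σ := σ1)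
    (N := m + 1) (c := gatherStep) c1.c3
    (fun i (τ : St) => (∀ k < i, τ.a 4 0 0 k =
      σ.a 4 0 0 k + σ.a 2 (anti n (σ.v 43)) (σ.v 42) k) ∧
      ∀ k, i ≤ k → τ.a 4 0 0 k = σ.a 4 0 0 k) ⟨by simp, fun _ _ => rfl⟩ ?_ (fun τ h => h)
  · exact key.1
  · rintro i hi τ g1 g2 - ⟨g3, g4⟩
    have e42 : τ.v 42 = σ.v 42 := by rw [g1 42 (by simp) (by decide), v1]; simp
    have e48 : τ.v 48 = σ.v 43 + n := by rw [g1 48 (by simp) (by decide), v48]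
    have e7 : τ.v 7 = 0 := by rw [g1 7 (by simp) (by decide), c1.c7]
    have ea : τ.a 2 = σ.a 2 := by rw [g2 2 (by decide), a1]
    simp only [gatherStep, Cmd.den_seq, Cmd.den_prim, Prim.den, St.put, ne_eq, Nat.reduceEqDiff,
      not_false_eq_true, Function.update_of_ne, Function.update_self, e42, e48, e7, ea,
      Nat.zero_mod, Nat.mod_eq_of_lt h2, Nat.mod_eq_of_lt hi, upd, true_and]
    refine ⟨fun k hk => ?_, fun k hk => ?_⟩
    · split_ifs with h
      · rw [g4 i le_rfl, h]; rfl
      · exact g3 k (by omega)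
    · rw [if_neg (by omega)]
      exact g4 k (by omega)

/-- Data about the sweep around `a`: `s` is the angular sequence of points and `g` gives the numbers
of chains. -/
structure SweepOK (n m : ℕ) (o : ℕ → ℕ → ℕ → Prop) (r b a : ℕ) (s sh : ℕ → ℕ)
    (g : ℕ → ℕ → ℕ → ℕ) : Prop where
  lt : ∀ q < n - 1, s q < 2 * n
  ne : ∀ q < n - 1, ¬ o r b (s q) → anti n (s q) ≠ a
  step : ∀ q < n - 1, o r b (s q) → ∀ k < m + 1, g a (s q) k = if k < sh (s q) then 0 else
    ∑ q' ∈ Finset.range q, if o r b (s q') then 0 else g (anti n (s q')) a (k - sh (s q))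

/-- When the sweep reaches position `q`, the accumulator is the sum over all predecessors whose
antipodes occur before `q`. A candidate at `q` reads exactly this partial sum, so no separate
summation per candidate is needed. -/
theorem sweepCmd_spec {n m : ℕ} {o : ℕ → ℕ → ℕ → Prop} {σ : St} (hc : Consts n m σ.v)
    (ht : σ.v 46 < 2 * n) (hoff : σ.v 54 ≤ m) {a : ℕ} (ha : a = σ.a 3 0 (σ.v 46) 0)
    (han : a < 2 * n) {g : ℕ → ℕ → ℕ → ℕ} {s : ℕ → ℕ} (hs : ∀ q, s q = σ.a 0 a q 0)
    (hS : SweepOK n m o (σ.v 40) (σ.v 41) a s (fun y => σ.a 1 a y 0) g)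
    (hg : ∀ q < n - 1, ¬ o (σ.v 40) (σ.v 41) (s q) → ∀ k < m + 1,
      σ.a 2 (anti n (s q)) a k = g (anti n (s q)) a k) :
    (∀ q < n - 1, o (σ.v 40) (σ.v 41) (s q) → ∀ k < m + 1,
      (sweepCmd.den n m o σ).a 2 a (s q) k = g a (s q) k) ∧
    (∀ i, i ≠ a → (sweepCmd.den n m o σ).a 2 i = σ.a 2 i) ∧
    ∀ x < 2 * m + 1, (sweepCmd.den n m o σ).raw x = σ.raw x +
      if σ.v 54 ≤ x ∧ x ≤ σ.v 54 + m then ∑ q ∈ Finset.range (n - 1),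
        if o (σ.v 40) (σ.v 41) (s q) then g a (s q) (x - σ.v 54) else 0 else 0 := by
  rw [sweepCmd, Cmd.den_seq, Cmd.den_seq]
  set σ1 := (Cmd.prim (.ld 42 3 7 46 7)).den n m o σ with hσ1
  have v1 : ∀ x, x ≠ 42 → σ1.v x = σ.v x := fun x h => Cmd.den_v _ (by simp [Cmd.wr, h]) _
  have v42 : σ1.v 42 = a := by
    simp [hσ1, Cmd.den, Prim.den, St.put, Nat.mod_eq_of_lt ht, hc.c7, ha]
  have c1 : Consts n m σ1.v := Cmd.den_consts (by decide) hc
  set σ2 := Cmd.den n m o _ σ1 with hσ2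
  have v2 : ∀ x, x ≠ 45 → σ2.v x = σ1.v x := fun x h => Cmd.den_v _ (by simp [Cmd.wr, h]) _
  have r2 : σ2.raw = σ.raw := Cmd.den_raw _ (by simp [Cmd.quiet]) _
  have A2 : ∀ A, A ≠ 4 → σ2.a A = σ.a A := fun A h => Cmd.den_a _ (by simp [Cmd.wrA, h]) _
  have c2 : Consts n m σ2.v := Cmd.den_consts (by decide) c1
  have k2 : ∀ k < m + 1, σ2.a 4 0 0 k = 0 := by
    refine Cmd.loop_rule c1.c3 (fun i (τ : St) => ∀ k < i, τ.a 4 0 0 k = 0)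
      (by simp) ?_ (fun τ h => h)
    rintro i hi τ g1 - - g2
    have f7 : τ.v 7 = 0 := by rw [g1 7, c1.c7] <;> simp [Cmd.wr]
    intro k hk
    simp only [Cmd.den_prim, Prim.den, St.put, ne_eq, Nat.reduceEqDiff, not_false_eq_true,
      Function.update_of_ne, Function.update_self, f7, Nat.mod_eq_of_lt hi, upd, Nat.zero_mod,
      true_and]
    split_ifs with h
    · rfl
    · exact g2 k (by omega)
  have key := Cmd.loop_rule (n := n) (m := m) (o := o) (x := 47) (b := 4) (σ := σ2)
    (N := n - 1) (c := sweepStep) c2.c4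
    (fun i (τ : St) => (∀ q < i, o (σ.v 40) (σ.v 41) (s q) → ∀ k < m + 1,
        τ.a 2 a (s q) k = g a (s q) k) ∧
      (∀ i, i ≠ a → τ.a 2 i = σ.a 2 i) ∧
      (∀ k < m + 1, τ.a 4 0 0 k = ∑ q ∈ Finset.range i,
        if o (σ.v 40) (σ.v 41) (s q) then 0 else g (anti n (s q)) a k) ∧
      ∀ x < 2 * m + 1, τ.raw x = σ.raw x + if σ.v 54 ≤ x ∧ x ≤ σ.v 54 + m then
        ∑ q ∈ Finset.range i,
          if o (σ.v 40) (σ.v 41) (s q) then g a (s q) (x - σ.v 54) else 0 else 0)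
    ?_ ?_ (fun τ h => h)
  · exact ⟨key.1, key.2.1, key.2.2.2⟩
  · exact ⟨by simp, fun i _ => by rw [A2 2 (by decide)], by simpa using k2,
      fun x _ => by simp [r2]⟩
  · rintro i hi τ g1 g2 - ⟨g3, g4, g5, g6⟩
    set τ1 := (Cmd.prim (.ld 43 0 42 47 7)).den n m o (τ.put 47 i) with hτ1
    have w : ∀ x, x ≠ 47 → x ∉ sweepStep.wr → τ1.v x = σ2.v x := fun x a b => by
      rw [← g1 x a b, hτ1, Cmd.den_v]
      · simp [St.put, a]
      · simp only [sweepStep, Cmd.wr, List.mem_append, not_or] at b ⊢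
        exact b.1
    have w40 : τ1.v 40 = σ.v 40 := by rw [w 40 (by simp) (by decide), v2, v1] <;> simp
    have w41 : τ1.v 41 = σ.v 41 := by rw [w 41 (by simp) (by decide), v2, v1] <;> simp
    have w54 : τ1.v 54 = σ.v 54 := by rw [w 54 (by simp) (by decide), v2, v1] <;> simp
    have w42 : τ1.v 42 = a := by rw [w 42 (by simp) (by decide), v2, v42]; simp
    have wa : τ1.a = τ.a := rfl
    have wr' : τ1.raw = τ.raw := rfl
    have hcτ : Consts n m τ1.v := c2.of_eq fun x hx => w x (by omega) fun h => by
      have := Cmd.le_of_mem_wr sweepStep (by decide) x h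
      omega
    have a0 : τ.a 0 = σ.a 0 := by rw [g2 0 (by decide), A2 0 (by decide)]
    have a1 : τ.a 1 = σ.a 1 := by rw [g2 1 (by decide), A2 1 (by decide)]
    have w43 : τ1.v 43 = s i := by
      have e42 : τ.v 42 = a := by rw [g1 42 (by simp) (by decide), v2, v42]; simp
      have e7 : τ.v 7 = 0 := by rw [g1 7 (by simp) (by decide), c2.c7]
      simp only [hτ1, Cmd.den_prim, Prim.den, St.put, ne_eq, Nat.reduceEqDiff, not_false_eq_true,
        Function.update_of_ne, Function.update_self, e42, e7, Nat.zero_mod, Nat.mod_eq_of_lt han,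
        Nat.mod_eq_of_lt (show i < 2 * n by omega), hs, a0]
    have hsi := hS.lt i hi
    rw [sweepStep, Cmd.den_seq, ← hτ1]
    by_cases ho : o (σ.v 40) (σ.v 41) (s i)
    · rw [Cmd.den_ite_pos (show Test.Holds o (.pos 40 41 43) τ1 by
        simp only [Test.Holds, w40, w41, w43]; exact ho)]
      obtain ⟨s1, s2, s3, s4⟩ := extendCmd_spec (o := o) (σ := τ1) hcτ (by rw [w42]; exact han)
        (by rw [w43]; exact hsi) (by rw [w54]; exact hoff) (e := g a (s i)) (by
          intro k hk
          rw [hS.step i hi ho k hk, w42, w43, wa, a1]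
          by_cases h : k < σ.a 1 a (s i) 0
          · rw [if_pos h, if_pos h]
          · rw [if_neg h, if_neg h, g5 _ (by omega)])
      rw [w42, w43] at s1
      rw [w42, wa] at s2
      rw [w42, w43, wa] at s3
      rw [wr', w54] at s4
      have s5 : (extendCmd.den n m o τ1).a 4 = τ.a 4 := Cmd.den_a _ (by decide) _
      refine ⟨fun q hq hoq k hk => ?_, fun j hj => by rw [s2 j hj, g4 j hj], fun k hk => ?_,
        fun x hx => ?_⟩
      -- Comparing values rather than positions makes injectivity of `s` unnecessary: a repeated
      -- point would receive the same row of `g` again.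
      · by_cases he : s q = s i
        · rw [he, s1 k hk]
        · rw [s3 _ he]
          refine g3 q ?_ hoq k hk
          rcases Nat.lt_succ_iff_lt_or_eq.1 hq with h | rfl
          · exact h
          · exact absurd rfl he
      · rw [s5, g5 k hk, Finset.sum_range_succ, if_pos ho, add_zero]
      · rw [s4 x hx, g6 x hx]
        by_cases h : σ.v 54 ≤ x ∧ x ≤ σ.v 54 + m
        · rw [if_pos h, if_pos h, if_pos h, Finset.sum_range_succ, if_pos ho, add_assoc]
        · rw [if_neg h, if_neg h, if_neg h]
    · rw [Cmd.den_ite_neg (show ¬ Test.Holds o (.pos 40 41 43) τ1 by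
        simp only [Test.Holds, w40, w41, w43]; exact ho)]
      have s1 := gatherCmd_spec (o := o) (σ := τ1) hcτ (by rw [w42]; exact han)
      rw [w42, w43, wa] at s1
      have s2 : (gatherCmd.den n m o τ1).a 2 = τ.a 2 := Cmd.den_a _ (by decide) _
      have s3 : (gatherCmd.den n m o τ1).raw = τ.raw := Cmd.den_raw _ (by decide) _
      rw [s2, s3]
      refine ⟨fun q hq hoq => ?_, g4, fun k hk => ?_, fun x hx => ?_⟩
      · refine g3 q ?_ hoq
        rcases Nat.lt_succ_iff_lt_or_eq.1 hq with h | rfl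
        · exact h
        · exact absurd hoq ho
      -- The row that is read differs from row `a`, hence this sweep has not touched it and `hg`
      -- still describes it.
      · rw [s1 k hk, g5 k hk, Finset.sum_range_succ, if_neg ho, g4 _ (hS.ne i hi ho),
          hg i hi ho k hk]
      · rw [g6 x hx, Finset.sum_range_succ, if_neg ho, add_zero]

/-- Data about the chains that start with `r`, `b`: the ends of the chains are processed in the
order `f`, and `sq a` is the angular sequence around `a`. -/
structure ChainOK (n m : ℕ) (o : ℕ → ℕ → ℕ → Prop) (r b : ℕ) (f : ℕ → ℕ) (sq sh : ℕ → ℕ → ℕ)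
    (g : ℕ → ℕ → ℕ → ℕ) (N : ℕ → ℕ) : Prop where
  lt : ∀ t < n - 1, f t < 2 * n
  ne : ∀ t < n - 1, f t ≠ r
  inj : ∀ t < n - 1, ∀ t' < t, f t' ≠ f t
  sweep : ∀ t < n - 1, SweepOK n m o r b (f t) (sq (f t)) (sh (f t)) g
  prev : ∀ t < n - 1, ∀ q < n - 1, ¬ o r b (sq (f t) q) → anti n (sq (f t) q) = r ∨
    ∃ t' < t, anti n (sq (f t) q) = f t' ∧ o r b (f t) ∧ ∃ q' < n - 1, sq (f t') q' = f t
  base : ∀ y < 2 * n, ∀ k, g r y k = if y = b ∧ k = 2 then 1 else 0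
  total : ∀ k < m + 1, ∑ t ∈ Finset.range (n - 1), ∑ q ∈ Finset.range (n - 1),
    (if o r b (sq (f t) q) then g (f t) (sq (f t) q) k else 0) = N k

/-- The table `g` has to be fixed before the order `f` is known, since `f` is only produced by the
sorting step inside the command; hence the hypothesis quantifies over all sorted `f`. -/
theorem chainCmd_spec {n m : ℕ} {o : ℕ → ℕ → ℕ → Prop} {σ : St} (hc : Consts n m σ.v)
    (hm : 3 ≤ m) (hr : σ.v 40 < 2 * n) (hb : σ.v 41 < 2 * n) (hoff : σ.v 54 ≤ m)
    (hsort : Sortable n o (σ.v 40) (σ.v 41)) {g : ℕ → ℕ → ℕ → ℕ} {N : ℕ → ℕ}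
    (hok : ∀ f, IsSort n o (σ.v 40) (σ.v 41) f → ChainOK n m o (σ.v 40) (σ.v 41) f
      (fun a q => σ.a 0 a q 0) (fun a y => σ.a 1 a y 0) g N) :
    ∀ x < 2 * m + 1, (chainCmd.den n m o σ).raw x = σ.raw x +
      if σ.v 54 ≤ x ∧ x ≤ σ.v 54 + m then N (x - σ.v 54) else 0 := by
  rw [chainCmd, Cmd.den_seq, Cmd.den_seq]
  set σ1 := initCmd.den n m o σ with hσ1
  have v1 : ∀ x, x ∉ initCmd.wr → σ1.v x = σ.v x := fun x h => Cmd.den_v _ h _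
  have A1 : ∀ A, A ∉ initCmd.wrA → σ1.a A = σ.a A := fun A h => Cmd.den_a _ h _
  have r1 : σ1.raw = σ.raw := Cmd.den_raw _ (by decide) _
  have c1 : Consts n m σ1.v := Cmd.den_consts (by decide) hc
  have i1 := initCmd_spec (o := o) hc hm hr hb
  rw [← hσ1] at i1
  have v40 : σ1.v 40 = σ.v 40 := v1 40 (by decide)
  have v41 : σ1.v 41 = σ.v 41 := v1 41 (by decide)
  have hs := (sortCmd_spec (m := m) (o := o) 3 (row := 7) (z := 40) (s := 41) (σ := σ1) c1
    (by decide) (by decide) (by decide) (by rw [c1.c7]; omega) (by rw [v40, v41]; exact hsort)).1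
  set σ2 := (sortCmd 3 7 40 41).den n m o σ1 with hσ2
  rw [v40, v41, c1.c7] at hs
  have v2 : ∀ x, x ∉ (sortCmd 3 7 40 41).wr → σ2.v x = σ1.v x := fun x h => Cmd.den_v _ h _
  have A2 : ∀ A, A ∉ (sortCmd 3 7 40 41).wrA → σ2.a A = σ1.a A := fun A h => Cmd.den_a _ h _
  have r2 : σ2.raw = σ1.raw := Cmd.den_raw _ (by decide) _
  have c2 : Consts n m σ2.v := Cmd.den_consts (by decide) c1
  have a0 : σ2.a 0 = σ.a 0 := by rw [A2 0 (by decide), A1 0 (by decide)]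
  have a1 : σ2.a 1 = σ.a 1 := by rw [A2 1 (by decide), A1 1 (by decide)]
  set f := fun t => σ2.a 3 0 t 0 with hf
  have ok := hok f hs
  have key := Cmd.loop_rule (n := n) (m := m) (o := o) (x := 46) (b := 4) (σ := σ2)
    (N := n - 1) (c := sweepCmd) c2.c4
    (fun i (τ : St) => (∀ y < 2 * n, ∀ k < m + 1, τ.a 2 (σ.v 40) y k = g (σ.v 40) y k) ∧
      (∀ t < i, ∀ q < n - 1, o (σ.v 40) (σ.v 41) (σ.a 0 (f t) q 0) → ∀ k < m + 1,
        τ.a 2 (f t) (σ.a 0 (f t) q 0) k = g (f t) (σ.a 0 (f t) q 0) k) ∧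
      ∀ x < 2 * m + 1, τ.raw x = σ.raw x + if σ.v 54 ≤ x ∧ x ≤ σ.v 54 + m then
        ∑ t ∈ Finset.range i, ∑ q ∈ Finset.range (n - 1),
          if o (σ.v 40) (σ.v 41) (σ.a 0 (f t) q 0) then
            g (f t) (σ.a 0 (f t) q 0) (x - σ.v 54) else 0 else 0)
    ?_ ?_ (fun τ h => h)
  · intro x hx
    rw [key.2.2 x hx]
    by_cases h : σ.v 54 ≤ x ∧ x ≤ σ.v 54 + m
    · rw [if_pos h, if_pos h, ok.total _ (by omega)]
    · rw [if_neg h, if_neg h]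
  · refine ⟨fun y hy k hk => ?_, by simp, fun x hx => by simp [r2, r1]⟩
    rw [A2 2 (by decide), i1 y hy k hk, ok.base y hy k]
  · rintro t ht τ g1 g2 - ⟨g3, g4, g5⟩
    have w : ∀ x, x ≠ 46 → x ∉ sweepCmd.wr → (τ.put 46 t).v x = σ2.v x := fun x a b => by
      rw [← g1 x a b]; simp [St.put, a]
    have w40 : (τ.put 46 t).v 40 = σ.v 40 := by
      rw [w 40 (by simp) (by decide), v2 40 (by decide), v40]
    have w41 : (τ.put 46 t).v 41 = σ.v 41 := by
      rw [w 41 (by simp) (by decide), v2 41 (by decide), v41]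
    have w54 : (τ.put 46 t).v 54 = σ.v 54 := by
      rw [w 54 (by simp) (by decide), v2 54 (by decide), v1 54 (by decide)]
    have w46 : (τ.put 46 t).v 46 = t := by simp [St.put]
    have wa : (τ.put 46 t).a = τ.a := rfl
    have wr' : (τ.put 46 t).raw = τ.raw := rfl
    have hcτ : Consts n m (τ.put 46 t).v := c2.of_eq fun x hx => w x (by omega) fun h => by
      have := Cmd.le_of_mem_wr sweepCmd (by decide) x h
      omega
    have b0 : τ.a 0 = σ.a 0 := by rw [g2 0 (by decide), a0]
    have b1 : τ.a 1 = σ.a 1 := by rw [g2 1 (by decide), a1]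
    have b3 : τ.a 3 = σ2.a 3 := g2 3 (by decide)
    obtain ⟨s1, s2, s3⟩ := sweepCmd_spec (o := o) (σ := τ.put 46 t) hcτ (by rw [w46]; omega)
      (by rw [w54]; exact hoff) (a := f t) (by rw [w46, wa, b3]) (ok.lt t ht) (g := g)
      (s := fun q => σ.a 0 (f t) q 0) (fun q => by rw [wa, b0])
      (by rw [w40, w41, wa, b1]; exact ok.sweep t ht) (by
        rw [w40, w41, wa]
        intro q hq hoq k hk
        -- The entry lies in the row of the root, filled by `initCmd`, or in the row of an end
        -- processed earlier for the same `r`, `b`. Leftovers from other pairs are never read.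
        rcases ok.prev t ht q hq hoq with h | ⟨t', ht', h, hob, q', hq', he⟩
        · rw [h]
          exact g3 _ (ok.lt t ht) k hk
        · rw [h, ← he]
          exact g4 t' ht' q' hq' (by rw [he]; exact hob) k hk)
    rw [w40, w41] at s1
    rw [wa] at s2
    rw [w40, w41, w54, wr'] at s3
    refine ⟨fun y hy k hk => ?_, fun t' ht' q hq hoq k hk => ?_, fun x hx => ?_⟩
    · rw [s2 _ (ok.ne t ht).symm]
      exact g3 y hy k hk
    · rcases Nat.lt_succ_iff_lt_or_eq.1 ht' with h | rfl
      · rw [s2 _ (ok.inj t ht t' h)]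
        exact g4 t' h q hq hoq k hk
      · exact s1 q hq hoq k hk
    · rw [s3 x hx, g5 x hx]
      by_cases h : σ.v 54 ≤ x ∧ x ≤ σ.v 54 + m
      · rw [if_pos h, if_pos h, if_pos h, Finset.sum_range_succ, add_assoc]
      · rw [if_neg h, if_neg h, if_neg h]

/-- All facts about the orientation predicate that the correctness of the program depends on:
`N r b k` is the number of polygons with first vertices `r`, `b` and weight `k`. -/
structure RunOK (md : Mode) (n m : ℕ) (o : ℕ → ℕ → ℕ → Prop) (N : ℕ → ℕ → ℕ → ℕ) : Prop where
  sort₁ : ∀ r < n, ∀ a < 2 * n, Sortable n o a (r + n)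
  sort₂ : ∀ r < n, ∀ b < 2 * n, Sortable n o r b
  chain : ∀ r < n, ∀ b < 2 * n, r < b % n → ∀ sq sh : ℕ → ℕ → ℕ,
    (∀ a < 2 * n, IsSort n o a (r + n) (sq a)) →
    (∀ a < 2 * n, ∀ y < 2 * n, sh a y = shift md n m o r a y) →
    ∃ g, ∀ f, IsSort n o r b f → ChainOK n m o r b f sq sh g (N r b)

/-- The angular orders around all `a` start at the antipode of `r`, and the step weights refer to
triangles at `r`. Neither depends on `b`, so both are tabulated once per root. -/
theorem rootCmd_spec {md : Mode} {n m : ℕ} {o : ℕ → ℕ → ℕ → Prop} {N : ℕ → ℕ → ℕ → ℕ}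
    (hok : RunOK md n m o N) {σ : St} (hc : Consts n m σ.v) (hm : 3 ≤ m) (hr : σ.v 40 < n)
    (hoff : σ.v 54 ≤ m) :
    ∀ x < 2 * m + 1, ((rootCmd md).den n m o σ).raw x = σ.raw x +
      if σ.v 54 ≤ x ∧ x ≤ σ.v 54 + m then ∑ b ∈ Finset.range (2 * n),
        if σ.v 40 < b % n then N (σ.v 40) b (x - σ.v 54) else 0 else 0 := by
  rw [rootCmd, Cmd.den_seq, Cmd.den_seq, Cmd.den_seq]
  set σ1 := (Cmd.prim (.plus 55 40 0)).den n m o σ with hσ1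
  have v1 : ∀ x, x ≠ 55 → σ1.v x = σ.v x := fun x h => Cmd.den_v _ (by simp [Cmd.wr, h]) _
  have v55 : σ1.v 55 = σ.v 40 + n := by simp [hσ1, Cmd.den, Prim.den, St.put, hc.c0]
  have c1 : Consts n m σ1.v := Cmd.den_consts (by decide) hc
  set σ2 := (Cmd.loop 42 2 (sortCmd 0 42 42 55)).den n m o σ1 with hσ2
  have v2 : ∀ x, x ∉ (Cmd.loop 42 2 (sortCmd 0 42 42 55)).wr → σ2.v x = σ1.v x :=
    fun x h => Cmd.den_v _ h _
  have r2 : σ2.raw = σ.raw := Cmd.den_raw _ (by decide) _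
  have c2 : Consts n m σ2.v := Cmd.den_consts (by decide) c1
  have k2 : ∀ a < 2 * n, IsSort n o a (σ.v 40 + n) (fun q => σ2.a 0 a q 0) := by
    refine Cmd.loop_rule c1.c2 (fun i (τ : St) => ∀ a < i,
      IsSort n o a (σ.v 40 + n) (fun q => τ.a 0 a q 0)) (by simp) ?_ (fun τ h => h)
    rintro i hi τ g1 - - g2
    have w : ∀ x, x ≠ 42 → x ∉ (sortCmd 0 42 42 55).wr → (τ.put 42 i).v x = σ1.v x :=
      fun x a b => by rw [← g1 x a b]; simp [St.put, a]
    have w42 : (τ.put 42 i).v 42 = i := by simp [St.put]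
    have w55 : (τ.put 42 i).v 55 = σ.v 40 + n := by rw [w 55 (by simp) (by decide), v55]
    have hcτ : Consts n m (τ.put 42 i).v := c1.of_eq fun x hx => w x (by omega) fun h => by
      have := Cmd.le_of_mem_wr (sortCmd 0 42 42 55) (by decide) x h
      omega
    obtain ⟨s1, s2⟩ := sortCmd_spec (m := m) (o := o) 0 (row := 42) (z := 42) (s := 55)
      (σ := τ.put 42 i) hcτ (by decide) (by decide) (by decide) (by rw [w42]; exact hi)
      (by rw [w42, w55]; exact hok.sort₁ _ hr i hi)
    rw [w42, w55] at s1
    rw [w42] at s2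
    intro a ha
    rcases Nat.lt_succ_iff_lt_or_eq.1 ha with h | rfl
    · rw [s2 a h.ne]
      exact g2 a h
    · exact s1
  set σ3 := (shiftCmd md).den n m o σ2 with hσ3
  have hwr : ∀ x, x ∉ [42, 43, 44, 48, 49, 57] → x ∉ (shiftCmd md).wr := by
    intro x hx hx'
    simp only [shiftCmd, Cmd.wr, List.mem_cons] at hx'
    have := shiftStep_wr md x
    simp only [List.mem_cons, List.not_mem_nil, or_false, not_or] at hx this
    tauto
  have hwrA : ∀ A, A ≠ 1 → A ∉ (shiftCmd md).wrA := fun A h h' =>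
    h (shiftStep_wrA md A h')
  have hwf : (shiftCmd md).wf = true := by cases md <;> decide
  have hq : (shiftCmd md).quiet = true := by cases md <;> decide
  have v3 : ∀ x, x ∉ [42, 43, 44, 48, 49, 57] → σ3.v x = σ2.v x :=
    fun x h => Cmd.den_v _ (hwr x h) _
  have r3 : σ3.raw = σ.raw := by rw [← r2]; exact Cmd.den_raw _ hq _
  have c3 : Consts n m σ3.v := Cmd.den_consts hwf c2
  have a3 : σ3.a 0 = σ2.a 0 := Cmd.den_a _ (hwrA 0 (by decide)) _
  have e40 : σ3.v 40 = σ.v 40 := by rw [v3 40 (by decide), v2 40 (by decide), v1 40 (by decide)]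
  have e54 : σ3.v 54 = σ.v 54 := by rw [v3 54 (by decide), v2 54 (by decide), v1 54 (by decide)]
  have k3 := shiftCmd_spec (o := o) md c2
  rw [← hσ3, v2 40 (by decide), v1 40 (by decide)] at k3
  refine Cmd.loop_rule c3.c2 (fun i (τ : St) => ∀ x < 2 * m + 1, τ.raw x = σ.raw x +
    if σ.v 54 ≤ x ∧ x ≤ σ.v 54 + m then ∑ b ∈ Finset.range i,
      if σ.v 40 < b % n then N (σ.v 40) b (x - σ.v 54) else 0 else 0)
    (by simp [r3]) ?_ (fun τ h => h)
  rintro b hb τ g1 g2 - g3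
  set τ1 := (Cmd.prim (.modn 48 41)).den n m o (τ.put 41 b) with hτ1
  have w : ∀ x, x ≠ 41 → x ∉ secondCmd.wr → τ1.v x = σ3.v x := fun x a b => by
    rw [← g1 x a b, hτ1, Cmd.den_v]
    · simp [St.put, a]
    · simp only [secondCmd, Cmd.wr, List.mem_append, not_or] at b ⊢
      exact b.1
  have w40 : τ1.v 40 = σ.v 40 := by rw [w 40 (by simp) (by decide), e40]
  have w54 : τ1.v 54 = σ.v 54 := by rw [w 54 (by simp) (by decide), e54]
  have w41 : τ1.v 41 = b := by simp [hτ1, Cmd.den, Prim.den, St.put]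
  have w48 : τ1.v 48 = b % n := by simp [hτ1, Cmd.den, Prim.den, St.put]
  have wr' : τ1.raw = τ.raw := rfl
  have hcτ : Consts n m τ1.v := c3.of_eq fun x hx => w x (by omega) fun h => by
    have := Cmd.le_of_mem_wr secondCmd (by decide) x h
    omega
  have b0 : τ1.a 0 = σ2.a 0 := by rw [← a3]; exact g2 0 (by decide)
  have b1 : τ1.a 1 = σ3.a 1 := g2 1 (by decide)
  rw [secondCmd, Cmd.den_seq, ← hτ1]
  by_cases hlt : σ.v 40 < b % n
  · rw [Cmd.den_ite_pos (show Test.Holds o (.lt 40 48) τ1 by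
      simp only [Test.Holds, w40, w48]; exact hlt)]
    obtain ⟨g, hg⟩ := hok.chain _ hr b hb hlt (fun a q => σ2.a 0 a q 0) (fun a y => σ3.a 1 a y 0)
      k2 k3
    have s := chainCmd_spec (o := o) (σ := τ1) hcτ hm (by rw [w40]; omega) (by rw [w41]; exact hb)
      (by rw [w54]; exact hoff) (by rw [w40, w41]; exact hok.sort₂ _ hr b hb) (g := g)
      (N := N (σ.v 40) b) (by rw [w40, w41, b0, b1]; exact hg)
    rw [w54, wr'] at s
    intro x hx
    rw [s x hx, g3 x hx]
    by_cases h : σ.v 54 ≤ x ∧ x ≤ σ.v 54 + m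
    · rw [if_pos h, if_pos h, if_pos h, Finset.sum_range_succ, if_pos hlt, add_assoc]
    · rw [if_neg h, if_neg h, if_neg h]
  · rw [Cmd.den_ite_neg (show ¬ Test.Holds o (.lt 40 48) τ1 by
      simp only [Test.Holds, w40, w48]; exact hlt)]
    intro x hx
    rw [Cmd.den, wr', g3 x hx, Finset.sum_range_succ, if_neg hlt, add_zero]

theorem runCmd_spec {md : Mode} {n m : ℕ} {o : ℕ → ℕ → ℕ → Prop} {N : ℕ → ℕ → ℕ → ℕ}
    (hok : RunOK md n m o N) {σ : St} (hc : Consts n m σ.v) (hm : 3 ≤ m)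
    (hoff : σ.v 54 ≤ m) :
    ∀ x < 2 * m + 1, ((runCmd md).den n m o σ).raw x = σ.raw x +
      if σ.v 54 ≤ x ∧ x ≤ σ.v 54 + m then ∑ r ∈ Finset.range n, ∑ b ∈ Finset.range (2 * n),
        if r < b % n then N r b (x - σ.v 54) else 0 else 0 := by
  have h54 : 54 ∉ (rootCmd md).wr := by cases md <;> decide
  have hwf : (rootCmd md).wf = true := by cases md <;> decide
  refine Cmd.loop_rule hc.c0 (fun i (τ : St) => ∀ x < 2 * m + 1, τ.raw x = σ.raw x +
    if σ.v 54 ≤ x ∧ x ≤ σ.v 54 + m then ∑ r ∈ Finset.range i, ∑ b ∈ Finset.range (2 * n),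
      if r < b % n then N r b (x - σ.v 54) else 0 else 0) (by simp) ?_ (fun τ h => h)
  rintro r hr τ g1 - - g2
  have w : ∀ x, x ≠ 40 → x ∉ (rootCmd md).wr → (τ.put 40 r).v x = σ.v x :=
    fun x a b => by rw [← g1 x a b]; simp [St.put, a]
  have w40 : (τ.put 40 r).v 40 = r := by simp [St.put]
  have w54 : (τ.put 40 r).v 54 = σ.v 54 := w 54 (by simp) h54
  have wr' : (τ.put 40 r).raw = τ.raw := rfl
  have hcτ : Consts n m (τ.put 40 r).v := hc.of_eq fun x hx => w x (by omega) fun h => by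
    have := Cmd.le_of_mem_wr (rootCmd md) hwf x h
    omega
  have s := rootCmd_spec hok (σ := τ.put 40 r) hcτ hm (by rw [w40]; exact hr)
    (by rw [w54]; exact hoff)
  rw [w40, w54, wr'] at s
  intro x hx
  rw [s x hx, g2 x hx]
  by_cases h : σ.v 54 ≤ x ∧ x ≤ σ.v 54 + m
  · rw [if_pos h, if_pos h, if_pos h, Finset.sum_range_succ, add_assoc]
  · rw [if_neg h, if_neg h, if_neg h]

/-- Total number of polygons of weight `k`. -/
def total (n : ℕ) (N : ℕ → ℕ → ℕ → ℕ) (k : ℕ) : ℕ :=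
  ∑ r ∈ Finset.range n, ∑ b ∈ Finset.range (2 * n), if r < b % n then N r b k else 0

theorem islandCmd_spec {n m : ℕ} {o : ℕ → ℕ → ℕ → Prop} {N : ℕ → ℕ → ℕ → ℕ} (hm : 3 ≤ m)
    (hok : RunOK .island n m o N) {k : ℕ} (hk : k ≤ m) :
    (islandCmd.den n m o (initSt n m)).raw k = total n N k := by
  rw [islandCmd, Cmd.den_seq]
  have hv : ((Cmd.prim (.set 54 0)).den n m o (initSt n m)).v 54 = 0 := by
    simp [Cmd.den, Prim.den, St.put]
  rw [runCmd_spec hok (Cmd.den_consts (by decide) (consts_init n m)) hm (by rw [hv]; omega) k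
    (by omega), hv, if_pos (by omega)]
  simp [Cmd.den, Prim.den, St.put, initSt, total]

/-- Gons of weight `k` go to cell `k`, holes to cell `m + k`. The ranges overlap only in cell `m`,
shared by gons of weight `m` and holes of weight 0; `h0` makes the latter contribute nothing. -/
theorem gonCmd_spec {n m : ℕ} {o : ℕ → ℕ → ℕ → Prop} {N N' : ℕ → ℕ → ℕ → ℕ} (hm : 3 ≤ m)
    (hok : RunOK .gon n m o N) (hok' : RunOK .hole n m o N') (h0 : total n N' 0 = 0) {k : ℕ}
    (hk0 : 0 < k) (hk : k ≤ m) :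
    (gonCmd.den n m o (initSt n m)).raw k = total n N k ∧
      (gonCmd.den n m o (initSt n m)).raw (m + k) = total n N' k := by
  rw [gonCmd, Cmd.den_seq, Cmd.den_seq, Cmd.den_seq]
  set σ1 := (Cmd.prim (.set 54 0)).den n m o (initSt n m) with hσ1
  have c1 : Consts n m σ1.v := Cmd.den_consts (by decide) (consts_init n m)
  have v1 : σ1.v 54 = 0 := by simp [hσ1, Cmd.den, Prim.den, St.put]
  set σ2 := (runCmd .gon).den n m o σ1 with hσ2
  have c2 : Consts n m σ2.v := Cmd.den_consts (by decide) c1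
  set σ3 := (Cmd.prim (.plus 54 1 7)).den n m o σ2 with hσ3
  have c3 : Consts n m σ3.v := Cmd.den_consts (by decide) c2
  have v3 : σ3.v 54 = m := by simp [hσ3, Cmd.den, Prim.den, St.put, c2.c1, c2.c7]
  have r1 := fun x hx => runCmd_spec hok c1 hm (by rw [v1]; omega) x hx
  have r2 := fun x hx => runCmd_spec hok' c3 hm v3.le x hx
  rw [v1, ← hσ2] at r1
  rw [v3] at r2
  have e3 : σ3.raw = σ2.raw := rfl
  have e1 : ∀ x, σ1.raw x = 0 := fun x => rfl
  have t0 : ∀ j, ∑ r ∈ Finset.range n, ∑ b ∈ Finset.range (2 * n),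
    (if r < b % n then N' r b j else 0) = total n N' j := fun _ => rfl
  have t1 : ∀ j, ∑ r ∈ Finset.range n, ∑ b ∈ Finset.range (2 * n),
    (if r < b % n then N r b j else 0) = total n N j := fun _ => rfl
  rw [r2 k (by omega), r2 (m + k) (by omega), e3, r1 k (by omega), r1 (m + k) (by omega), e1, e1,
    t0, t0, t1, t1]
  constructor
  · rw [if_pos (by omega)]
    -- The shared cell, where the run for holes adds its count of weight 0.
    by_cases h : k = m
    · subst h
      simp [h0]
    · rw [if_neg (by omega)]
      simp
  · rw [if_neg (by omega), if_pos (by omega)]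
    simp

end RAM

/-! ### Determinant identities -/

theorem det3_cyc (x y z : Fin 3 → ℝ) : det3 x y z = det3 y z x := by unfold det3; ring

theorem det3_swap (x y z : Fin 3 → ℝ) : det3 y x z = -det3 x y z := by unfold det3; ring

theorem det3_swap_right (x y z : Fin 3 → ℝ) : det3 x z y = -det3 x y z := by unfold det3; ring

theorem det3_neg_left (x y z : Fin 3 → ℝ) : det3 (-x) y z = -det3 x y z := by
  simp only [det3, Pi.neg_apply]; ring

theorem det3_neg_mid (x y z : Fin 3 → ℝ) : det3 x (-y) z = -det3 x y z := by
  simp only [det3, Pi.neg_apply]; ring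

theorem det3_neg_right (x y z : Fin 3 → ℝ) : det3 x y (-z) = -det3 x y z := by
  simp only [det3, Pi.neg_apply]; ring

theorem det3_self_left (x y : Fin 3 → ℝ) : det3 x x y = 0 := by unfold det3; ring

theorem det3_self_right (x y : Fin 3 → ℝ) : det3 x y y = 0 := by unfold det3; ring

theorem det3_self_outer (x y : Fin 3 → ℝ) : det3 x y x = 0 := by unfold det3; ring

/-- The Grassmann–Plücker relation for the lines through `z`. -/
theorem det3_plucker (z a b c d : Fin 3 → ℝ) :
    det3 z a b * det3 z c d = det3 z a c * det3 z b d + det3 z a d * det3 z c b := by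
  unfold det3; ring

/-- The vectors `x`, `y`, `t` to the left of `s` as seen from `z` are linearly ordered. -/
theorem det3_trans {z s x y t : Fin 3 → ℝ} (hx : 0 < det3 z s x) (hy : 0 < det3 z s y)
    (ht : 0 < det3 z s t) (h1 : 0 < det3 z x y) (h2 : 0 < det3 z y t) : 0 < det3 z x t := by
  have := det3_plucker z s y x t
  have h3 : 0 < det3 z s y * det3 z x t := by rw [this]; positivity
  exact pos_of_mul_pos_right h3 hy.le

namespace RAM

open Classical

/-! ### Signed points and angular orders -/

/-- The vector `w u` is to the left of the line from `w z` to `w s`. -/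
def ori (w : ℕ → Fin 3 → ℝ) (z s u : ℕ) : Prop := 0 < det3 (w z) (w s) (w u)

/-- The vectors `w u` and `w (u + n)` for `u < n` represent `n` points in general position, with
both signs. -/
structure Config (n : ℕ) (w : ℕ → Fin 3 → ℝ) : Prop where
  pos : 0 < n
  add : ∀ u, w (u + n) = -w u
  gen : ∀ u v x, u % n ≠ v % n → u % n ≠ x % n → v % n ≠ x % n → det3 (w u) (w v) (w x) ≠ 0

theorem anti_lt {n : ℕ} (hn : 0 < n) (u : ℕ) : anti n u < 2 * n := Nat.mod_lt _ (by omega)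

theorem anti_eq {n u : ℕ} (hu : u < 2 * n) : anti n u = if u < n then u + n else u - n := by
  unfold anti
  split_ifs
  · exact Nat.mod_eq_of_lt (by omega)
  · rw [Nat.mod_eq_sub_mod (by omega), Nat.mod_eq_of_lt (by omega)]
    omega

theorem anti_anti {n u : ℕ} (hu : u < 2 * n) : anti n (anti n u) = u := by
  rw [anti_eq (anti_lt (by omega) u), anti_eq hu]
  split_ifs <;> omega

theorem mod_eq {n u : ℕ} (hu : u < 2 * n) : u % n = if u < n then u else u - n := by
  split_ifs
  · exact Nat.mod_eq_of_lt (by omega)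
  · rw [Nat.mod_eq_sub_mod (by omega), Nat.mod_eq_of_lt (by omega)]

theorem anti_mod {n u : ℕ} (hu : u < 2 * n) : anti n u % n = u % n := by
  rw [mod_eq (anti_lt (by omega) u), mod_eq hu, anti_eq hu]
  split_ifs <;> omega

theorem eq_or_eq_anti {n u v : ℕ} (hu : u < 2 * n) (hv : v < 2 * n) (h : u % n = v % n) :
    u = v ∨ u = anti n v := by
  rw [mod_eq hu, mod_eq hv] at h
  rw [anti_eq hv]
  split_ifs at * <;> omega

theorem Config.anti {n : ℕ} {w : ℕ → Fin 3 → ℝ} (hw : Config n w)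
    {u : ℕ} (hu : u < 2 * n) : w (anti n u) = -w u := by
  rw [anti_eq hu]
  split_ifs with h
  · exact hw.add u
  · rw [← neg_eq_iff_eq_neg, ← hw.add, Nat.sub_add_cancel (by omega)]

theorem Config.ne_of_ori {n : ℕ} {w : ℕ → Fin 3 → ℝ} (hw : Config n w)
    {z s u : ℕ} (hz : z < 2 * n) (hs : s < 2 * n) (hu : u < 2 * n)
    (h : ori w z s u) : z % n ≠ s % n ∧ z % n ≠ u % n ∧ s % n ≠ u % n := by
  unfold ori at h
  refine ⟨fun e => ?_, fun e => ?_, fun e => ?_⟩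
  · rcases eq_or_eq_anti hz hs e with rfl | rfl
    · rw [det3_self_left] at h; exact h.false
    · rw [hw.anti hs, det3_neg_left, det3_self_left, neg_zero] at h; exact h.false
  · rcases eq_or_eq_anti hz hu e with rfl | rfl
    · rw [det3_self_outer] at h; exact h.false
    · rw [hw.anti hu, det3_neg_left, det3_self_outer, neg_zero] at h; exact h.false
  · rcases eq_or_eq_anti hs hu e with rfl | rfl
    · rw [det3_self_right] at h; exact h.false
    · rw [hw.anti hu, det3_neg_mid, det3_self_right, neg_zero] at h; exact h.false

theorem Config.ori_total {n : ℕ} {w : ℕ → Fin 3 → ℝ} (hw : Config n w)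
    {z x y : ℕ} (h1 : z % n ≠ x % n) (h2 : z % n ≠ y % n)
    (h3 : x % n ≠ y % n) : ori w z x y ∨ ori w z y x := by
  unfold ori
  rcases (hw.gen z x y h1 h2 h3).lt_or_gt with h | h
  · right
    rw [det3_swap_right]
    linarith
  · exact Or.inl h

/-- The numbers of the signed points to the left of the ray from `z` to `s`. -/
noncomputable def left (n : ℕ) (o : ℕ → ℕ → ℕ → Prop) (z s : ℕ) : Finset ℕ :=
  (Finset.range (2 * n)).filter (o z s)

theorem mem_left {n : ℕ} {o : ℕ → ℕ → ℕ → Prop} {z s u : ℕ} :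
    u ∈ left n o z s ↔ u < 2 * n ∧ o z s u := by simp [left]

theorem rk_eq_card (n : ℕ) (o : ℕ → ℕ → ℕ → Prop) (z s y : ℕ) :
    rk n o z s y = ((left n o z s).filter (fun x => o z x y)).card := by
  rw [rk, Nat.count_eq_card_filter_range, left, Finset.filter_filter]

/-- Antipodes lie on opposite sides of any line through the origin's plane of `z` and `s`, so at
most one sign of each point is to the left. -/
theorem Config.eq_of_mod {n : ℕ} {w : ℕ → Fin 3 → ℝ} (hw : Config n w)
    {z s x y : ℕ} (hx : x ∈ left n (ori w) z s) (hy : y ∈ left n (ori w) z s)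
    (h : x % n = y % n) : x = y := by
  rw [mem_left] at hx hy
  rcases eq_or_eq_anti hx.1 hy.1 h with h | rfl
  · exact h
  · have h1 := hx.2
    have h2 := hy.2
    unfold ori at h1 h2
    rw [hw.anti hy.1, det3_neg_right] at h1
    linarith

/-- By general position, each of the `n` points other than those of `z` and `s` has exactly one of
its two signs on the left. -/
theorem Config.card_left {n : ℕ} {w : ℕ → Fin 3 → ℝ} (hw : Config n w)
    {z s : ℕ} (hz : z < 2 * n) (hs : s < 2 * n) (h : z % n ≠ s % n) :
    (left n (ori w) z s).card = n - 2 := by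
  have h1 : ((Finset.range n).erase (z % n)).erase (s % n) =
      (left n (ori w) z s).image (· % n) := by
    ext j
    simp only [Finset.mem_erase, Finset.mem_range, Finset.mem_image, mem_left]
    constructor
    · rintro ⟨js, jz, jn⟩
      have jm := Nat.mod_eq_of_lt jn
      rcases (hw.gen z s j h (by rw [jm]; exact jz.symm) (by rw [jm]; exact js.symm)).lt_or_gt
        with h' | h'
      · refine ⟨j + n, ⟨by omega, ?_⟩, by rw [Nat.add_mod_right, jm]⟩
        unfold ori
        rw [hw.add, det3_neg_right]
        linarith
      · exact ⟨j, ⟨by omega, h'⟩, jm⟩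
    · rintro ⟨u, ⟨hu, ho⟩, rfl⟩
      obtain ⟨-, h2, h3⟩ := hw.ne_of_ori hz hs hu ho
      exact ⟨h3.symm, h2.symm, Nat.mod_lt _ hw.pos⟩
  have h2 : ((left n (ori w) z s).image (· % n)).card = (left n (ori w) z s).card :=
    Finset.card_image_of_injOn fun x hx y hy h => hw.eq_of_mod hx hy h
  rw [← h2, ← h1, Finset.card_erase_of_mem, Finset.card_erase_of_mem, Finset.card_range]
  · omega
  · simpa using Nat.mod_lt _ hw.pos
  · simpa using ⟨Ne.symm h, Nat.mod_lt _ hw.pos⟩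

/-- On an open half-plane the angular order is transitive, so the predecessors of `x` precede `y`;
the point `x` itself makes the inclusion strict. -/
theorem ori_rk_lt_rk {n : ℕ} {w : ℕ → Fin 3 → ℝ}
    {z s x y : ℕ} (hx : x ∈ left n (ori w) z s) (hy : y ∈ left n (ori w) z s)
    (h : ori w z x y) : rk n (ori w) z s x < rk n (ori w) z s y := by
  rw [rk_eq_card, rk_eq_card]
  refine Finset.card_lt_card ⟨fun t ht => ?_, fun hss => ?_⟩
  · rw [Finset.mem_filter] at ht ⊢
    exact ⟨ht.1, det3_trans (mem_left.1 ht.1).2 (mem_left.1 hx).2 (mem_left.1 hy).2 ht.2 h⟩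
  · have : x ∈ (left n (ori w) z s).filter (fun t => ori w z t x) :=
      hss (Finset.mem_filter.2 ⟨hx, h⟩)
    have := (Finset.mem_filter.1 this).2
    unfold ori at this
    rw [det3_self_right] at this
    exact this.false

theorem ori_rk_lt {n : ℕ} {w : ℕ → Fin 3 → ℝ}
    {z s y : ℕ} (hy : y ∈ left n (ori w) z s) :
    rk n (ori w) z s y < (left n (ori w) z s).card := by
  rw [rk_eq_card]
  refine Finset.card_lt_card ⟨Finset.filter_subset _ _, fun hss => ?_⟩
  have := (Finset.mem_filter.1 (hss hy)).2
  unfold ori at this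
  rw [det3_self_right] at this
  exact this.false

theorem Config.rk_lt_iff {n : ℕ} {w : ℕ → Fin 3 → ℝ} (hw : Config n w)
    {z s x y : ℕ} (hz : z < 2 * n) (hs : s < 2 * n)
    (hx : x ∈ left n (ori w) z s) (hy : y ∈ left n (ori w) z s) :
    rk n (ori w) z s x < rk n (ori w) z s y ↔ ori w z x y := by
  refine ⟨fun h => ?_, ori_rk_lt_rk hx hy⟩
  by_cases hxy : x = y
  · subst hxy; exact absurd h (lt_irrefl _)
  have h1 := hw.ne_of_ori hz hs (mem_left.1 hx).1 (mem_left.1 hx).2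
  have h2 := hw.ne_of_ori hz hs (mem_left.1 hy).1 (mem_left.1 hy).2
  rcases hw.ori_total h1.2.1 h2.2.1 fun e => hxy (hw.eq_of_mod hx hy e) with h3 | h3
  · exact h3
  · exact absurd (ori_rk_lt_rk hy hx h3) (by omega)

theorem Config.rk_inj {n : ℕ} {w : ℕ → Fin 3 → ℝ} (hw : Config n w)
    {z s x y : ℕ} (hz : z < 2 * n) (hs : s < 2 * n)
    (hx : x ∈ left n (ori w) z s) (hy : y ∈ left n (ori w) z s)
    (h : rk n (ori w) z s x = rk n (ori w) z s y) : x = y := by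
  by_contra hxy
  have h1 := hw.ne_of_ori hz hs (mem_left.1 hx).1 (mem_left.1 hx).2
  have h2 := hw.ne_of_ori hz hs (mem_left.1 hy).1 (mem_left.1 hy).2
  rcases hw.ori_total h1.2.1 h2.2.1 fun e => hxy (hw.eq_of_mod hx hy e) with h3 | h3
  · have := ori_rk_lt_rk hx hy h3
    omega
  · have := ori_rk_lt_rk hy hx h3
    omega

theorem Config.sortable {n : ℕ} {w : ℕ → Fin 3 → ℝ} (hw : Config n w)
    {z s : ℕ} (hz : z < 2 * n) (hs : s < 2 * n) :
    Sortable n (ori w) z s where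
  lt y hy h := by
    have h1 := ori_rk_lt (mem_left.2 ⟨hy, h⟩)
    rw [hw.card_left hz hs (hw.ne_of_ori hz hs hy h).1] at h1
    omega
  inj y hy h y' hy' h' e := hw.rk_inj hz hs (mem_left.2 ⟨hy, h⟩) (mem_left.2 ⟨hy', h'⟩) e

/-- Pigeonhole: the ranks of the `n - 2` points on the left are distinct and less than `n - 2`. This
is why the positions below `n - 1` of a sorted row are all meaningful. -/
theorem Config.exists_rk {n : ℕ} {w : ℕ → Fin 3 → ℝ} (hw : Config n w)
    {z s q : ℕ} (hz : z < 2 * n) (hs : s < 2 * n) (h : z % n ≠ s % n)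
    (hq : q < n - 2) : ∃ y ∈ left n (ori w) z s, rk n (ori w) z s y = q := by
  have h1 : (left n (ori w) z s).image (rk n (ori w) z s) = Finset.range (n - 2) := by
    apply Finset.eq_of_subset_of_card_le
    · intro j hj
      obtain ⟨y, hy, rfl⟩ := Finset.mem_image.1 hj
      rw [Finset.mem_range, ← hw.card_left hz hs h]
      exact ori_rk_lt hy
    · rw [Finset.card_image_of_injOn fun x hx y hy h => hw.rk_inj hz hs hx hy h,
        hw.card_left hz hs h, Finset.card_range]
  have : q ∈ (left n (ori w) z s).image (rk n (ori w) z s) := by rw [h1]; simpa using hq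
  simpa using this

/-- In the sequence `f`, the elements with positive index are the points to the left, in order. -/
theorem IsSort.spec {n : ℕ} {w : ℕ → Fin 3 → ℝ} (hw : Config n w) {z s : ℕ} (hz : z < 2 * n)
    (hs : s < 2 * n) (hzs : z % n ≠ s % n) {f : ℕ → ℕ} (hf : IsSort n (ori w) z s f) :
    (∀ q < n - 1, f q < 2 * n) ∧ (∀ q, 0 < q → q < n - 1 → ori w z s (f q)) ∧
    (∀ y < 2 * n, ori w z s y → ∃ q, 0 < q ∧ q < n - 1 ∧ f q = y) ∧
    (∀ q q', 0 < q → q < n - 1 → 0 < q' → q' < n - 1 → (q < q' ↔ ori w z (f q) (f q'))) ∧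
    ∀ q q', q < q' → q' < n - 1 → f q ≠ f q' := by
  have key : ∀ q, 0 < q → q < n - 1 →
      f q ∈ left n (ori w) z s ∧ rk n (ori w) z s (f q) = q - 1 := by
    intro q h0 h1
    obtain ⟨y, hy, e⟩ := hw.exists_rk hz hs hzs (show q - 1 < n - 2 by omega)
    have : f q = y := by
      rw [← hf.rank y (mem_left.1 hy).1 (mem_left.1 hy).2, e, Nat.sub_add_cancel h0]
    rw [this]
    exact ⟨hy, e⟩
  refine ⟨fun q hq => ?_, fun q h0 hq => (mem_left.1 (key q h0 hq).1).2, fun y hy h => ?_,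
    fun q q' h0 hq h0' hq' => ?_, fun q q' hqq hq' e => ?_⟩
  · rcases Nat.eq_zero_or_pos q with rfl | h0
    · rw [hf.zero]; exact hs
    · exact (mem_left.1 (key q h0 hq).1).1
  · have h1 := ori_rk_lt (mem_left.2 ⟨hy, h⟩)
    rw [hw.card_left hz hs hzs] at h1
    exact ⟨_, Nat.succ_pos _, by omega, hf.rank y hy h⟩
  · rw [← hw.rk_lt_iff hz hs (key q h0 hq).1 (key q' h0' hq').1, (key q h0 hq).2,
      (key q' h0' hq').2]
    omega
  · have k' := key q' (by omega) hq'
    rcases Nat.eq_zero_or_pos q with rfl | h0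
    · rw [hf.zero] at e
      have := (mem_left.1 k'.1).2
      unfold ori at this
      rw [← e, det3_self_right] at this
      exact this.false
    · have k := key q h0 (by omega)
      have := k.2
      rw [e, k'.2] at this
      omega

/-! ### Chains and the correctness of the recursion -/

/-- Vertex lists, in clockwise order, of convex chains with first vertices `r` and `b`. -/
inductive Chain (n : ℕ) (o : ℕ → ℕ → ℕ → Prop) (r b : ℕ) : List ℕ → Prop
  | base : Chain n o r b [b, r]
  | step {y a c : ℕ} {L : List ℕ} (hy : y < 2 * n) (h : Chain n o r b (a :: c :: L))
      (h1 : o r b y) (h2 : o r a y) (h3 : o c a y) : Chain n o r b (y :: a :: c :: L)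

/-- The weight of a chain. -/
def wt (sh : ℕ → ℕ → ℕ) : List ℕ → ℕ
  | y :: a :: c :: L => wt sh (a :: c :: L) + sh a y
  | _ => 2

/-- Lists of length at most `K` of numbers less than `2 * n`. -/
noncomputable def lists (n K : ℕ) : Finset (List ℕ) :=
  ((List.finite_length_le (Fin (2 * n)) K).image (List.map Fin.val)).toFinset

theorem mem_lists {n K : ℕ} {L : List ℕ} :
    L ∈ lists n K ↔ L.length ≤ K ∧ ∀ x ∈ L, x < 2 * n := by
  simp only [lists, Set.Finite.mem_toFinset, Set.mem_image, Set.mem_ofPred_eq]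
  constructor
  · rintro ⟨L, h, rfl⟩
    refine ⟨by simpa using h, fun x hx => ?_⟩
    obtain ⟨y, -, rfl⟩ := List.mem_map.1 hx
    exact y.2
  · rintro ⟨h1, h2⟩
    exact ⟨L.pmap (fun x hx => ⟨x, hx⟩) h2, by simpa using h1, by simp [List.map_pmap]⟩

/-- The chains of weight `k`. -/
noncomputable def chains (n m : ℕ) (o : ℕ → ℕ → ℕ → Prop) (r b : ℕ) (sh : ℕ → ℕ → ℕ) (k : ℕ) :
    Finset (List ℕ) :=
  (lists n m).filter fun L => Chain n o r b L ∧ wt sh L = k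

theorem Chain.lt {n : ℕ} {o : ℕ → ℕ → ℕ → Prop} {r b : ℕ} {L : List ℕ} (h : Chain n o r b L)
    (hr : r < 2 * n) (hb : b < 2 * n) : ∀ x ∈ L, x < 2 * n := by
  induction h with
  | base => simp [hr, hb]
  | step hy _ _ _ _ ih => exact List.forall_mem_cons.2 ⟨hy, ih⟩

/-- Each step weighs at least 1, so chains of weight at most `m` have at most `m` vertices and
belong to the finite set `lists n m`. -/
theorem Chain.length_le {n : ℕ} {o : ℕ → ℕ → ℕ → Prop} {r b : ℕ} {L : List ℕ}
    (h : Chain n o r b L) {sh : ℕ → ℕ → ℕ} (hsh : ∀ a y, 1 ≤ sh a y) : L.length ≤ wt sh L := by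
  induction h with
  | base => simp [wt]
  | @step y a c L _ _ _ _ _ ih =>
    have := hsh a y
    rw [wt, List.length_cons]
    omega

theorem mem_chains {n m : ℕ} {o : ℕ → ℕ → ℕ → Prop} {r b : ℕ} {sh : ℕ → ℕ → ℕ} {k : ℕ}
    (hr : r < 2 * n) (hb : b < 2 * n) (hsh : ∀ a y, 1 ≤ sh a y) (hk : k ≤ m) {L : List ℕ} :
    L ∈ chains n m o r b sh k ↔ Chain n o r b L ∧ wt sh L = k := by
  rw [chains, Finset.mem_filter, mem_lists, and_iff_right_iff_imp]
  exact fun h => ⟨(h.1.length_le hsh).trans (h.2.le.trans hk), h.1.lt hr hb⟩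

theorem one_le_shift (md : Mode) (n m : ℕ) (o : ℕ → ℕ → ℕ → Prop) (r a y : ℕ) :
    1 ≤ shift md n m o r a y := by
  unfold shift
  split_ifs
  · cases md
    · exact le_rfl
    · simp only [Mode.weight]; split_ifs <;> omega
    · simp [Mode.weight]
  · omega

/-- The number of chains of weight `k` with at least three vertices. -/
noncomputable def chainCount (md : Mode) (n m : ℕ) (o : ℕ → ℕ → ℕ → Prop) (r b k : ℕ) : ℕ :=
  ((chains n m o r b (shift md n m o r) k).filter fun L => 3 ≤ L.length).card

/-- The successor of `r` or of a vertex to the left of `r` and `b` lies to the left, too. -/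
theorem Chain.head {n : ℕ} {w : ℕ → Fin 3 → ℝ} {r b a c : ℕ} {L : List ℕ}
    (h : Chain n (ori w) r b (a :: c :: L)) :
    (a = b ∧ c = r ∧ L = []) ∨ (a < 2 * n ∧ ori w r b a ∧ ori w r c a ∧ (c = b ∨ ori w r b c)) := by
  rcases h with _ | ⟨hy, h, h1, h2, h3⟩
  · exact Or.inl ⟨rfl, rfl, rfl⟩
  · refine Or.inr ⟨hy, h1, h2, ?_⟩
    rcases h with _ | ⟨hy, h, h4, h5, h6⟩
    · exact Or.inl rfl
    · exact Or.inr h4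

theorem sum_ite_card_eq {ι α β : Type*} {s : Finset ι} {p : ι → Prop} [DecidablePred p]
    {A : ι → Finset α}
    {B : Finset β} {φ : α → β} (hφ : Function.Injective φ)
    (hB : ∀ x, x ∈ B ↔ ∃ i ∈ s, p i ∧ ∃ y ∈ A i, φ y = x)
    (hA : ∀ i ∈ s, p i → ∀ j ∈ s, p j → ∀ x ∈ A i, x ∈ A j → i = j) :
    ∑ i ∈ s, (if p i then (A i).card else 0) = B.card := by
  rw [← Finset.sum_filter, ← Finset.card_biUnion, ← Finset.card_image_of_injective _ hφ]
  · congr 1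
    ext x
    rw [hB]
    simp only [Finset.mem_image, Finset.mem_biUnion, Finset.mem_filter]
    constructor
    · rintro ⟨y, ⟨i, ⟨hi, hp⟩, hy⟩, rfl⟩
      exact ⟨i, hi, hp, y, hy, rfl⟩
    · rintro ⟨i, hi, hp, y, hy, rfl⟩
      exact ⟨y, ⟨i, ⟨hi, hp⟩, hy⟩, rfl⟩
  · intro i hi j hj hij
    rw [Finset.coe_filter, Set.mem_ofPred_eq] at hi hj
    exact Finset.disjoint_left.2 fun x hx hx' => hij (hA i hi.1 hi.2 j hj.1 hj.2 x hx hx')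

/-- The table `g a y k` counts the chains of weight `k` that begin with `y :: a`, the head of a list
being the last vertex. Removing `y` leaves a chain `a :: c :: T`. Antipodes translate the conditions
on `c` into the sweep around `a`: positivity of `(r,c,a)` means that the antipode of `c` occurs in
the sequence, and positivity of `(c,a,y)` that it occurs before `y`. Positivity of `(r,c,a)` also
says that `c` precedes `a` in the order `f`, so its row is complete when `a` is processed. -/
theorem runOK {n : ℕ} {w : ℕ → Fin 3 → ℝ} (hw : Config n w) (md : Mode) {m : ℕ} (hm : 3 ≤ m) :
    RunOK md n m (ori w) (chainCount md n m (ori w)) where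
  sort₁ r hr a ha := hw.sortable ha (by omega)
  sort₂ r hr b hb := hw.sortable (by omega) hb
  chain r hr b hb hrb sq sh hsq hsh := by
    have hr2 : r < 2 * n := by omega
    have hn := hw.pos
    have hrm : r % n = r := Nat.mod_eq_of_lt hr
    have hrb' : r % n ≠ b % n := by omega
    have hrn : (r + n) % n = r := by rw [Nat.add_mod_right, hrm]
    have har : anti n (r + n) = r := by rw [anti_eq (by omega)]; split_ifs <;> omega
    have mem := fun {k} (hk : k < m + 1) {L} => mem_chains (m := m) (o := ori w) (L := L) hr2 hb
      (one_le_shift md n m (ori w) r) (k := k) (by omega)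
    -- orientation and antipodes
    have ori_anti₂ : ∀ {a c y}, c < 2 * n → (ori w a (anti n c) y ↔ ori w c a y) := by
      intro a c y hc
      unfold ori
      rw [hw.anti hc, det3_neg_mid, ← det3_swap]
    have ori_rn : ∀ {a y}, (ori w a (r + n) y ↔ ori w r a y) := by
      intro a y
      unfold ori
      rw [hw.add, det3_neg_mid, ← det3_swap]
    refine ⟨fun a y k => ((chains n m (ori w) r b (shift md n m (ori w) r) k).filter
      fun L => ∃ T, L = y :: a :: T).card, fun f hf => ?_⟩
    obtain ⟨f1, f2, f3, f4, f5⟩ := hf.spec hw hr2 hb hrb'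
    have fr : ∀ t < n - 1, r % n ≠ f t % n := by
      intro t ht
      rcases Nat.eq_zero_or_pos t with rfl | h0
      · rw [hf.zero]; exact hrb'
      · exact (hw.ne_of_ori hr2 hb (f1 t ht) (f2 t h0 ht)).2.1
    have fe : ∀ a < 2 * n, (a = b ∨ ori w r b a) → ∃ t < n - 1, f t = a := by
      rintro a ha (rfl | h)
      · refine ⟨0, ?_, hf.zero⟩
        have := Nat.mod_lt a hn
        omega
      · obtain ⟨q, -, h2, h3⟩ := f3 a ha h
        exact ⟨q, h2, h3⟩
    have S := fun t ht => (hsq (f t) (f1 t ht)).spec hw (f1 t ht) (show r + n < 2 * n by omega)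
      (by rw [hrn, ← hrm]; exact (fr t ht).symm)
    have s0 := fun t ht => (hsq (f t) (f1 t ht)).zero
    -- Position 0 of each sweep holds the antipode of `r` and is therefore gathered, never extended;
    -- through it the initial chain `[b, r]` enters the recursion.
    have nb : ¬ ori w r b (r + n) := by
      unfold ori
      rw [hw.add, det3_neg_right, det3_self_outer]
      simp
    have hnr : ∀ c L, ¬ Chain n (ori w) r b (r :: c :: L) := by
      intro c L h
      rcases h.head with h | h
      · exact hrb' (congrArg (· % n) h.1)
      · have := h.2.1
        unfold ori at this
        rw [det3_self_outer] at this
        exact this.false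
    refine ⟨f1, fun t ht e => fr t ht (by rw [e]), fun t ht t' htt e => f5 t' t htt ht e,
      fun t ht => ⟨(S t ht).1, fun q hq hob e => ?_, fun q hq hob k hk => ?_⟩,
      fun t ht q hq hob => ?_, fun y hy k => ?_, fun k hk => ?_⟩
    · rcases Nat.eq_zero_or_pos q with rfl | h0
      · rw [s0 t ht, har] at e
        exact fr t ht (by rw [← e])
      · have h1 := hw.ne_of_ori (f1 t ht) (by omega) ((S t ht).1 q hq) ((S t ht).2.1 q h0 hq)
        exact h1.2.1 ((congrArg (· % n) e).symm.trans (anti_mod ((S t ht).1 q hq)))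
    · have hy := (S t ht).1 q hq
      have h0 : 0 < q := Nat.pos_of_ne_zero fun h => nb (by rw [h, s0 t ht] at hob; exact hob)
      have hry := ori_rn.1 ((S t ht).2.1 q h0 hq)
      rw [hsh _ (f1 t ht) _ hy]
      generalize hay : shift md n m (ori w) r (f t) (sq (f t) q) = d
      have hd : 1 ≤ d := hay ▸ one_le_shift md n m (ori w) r (f t) (sq (f t) q)
      -- For fixed `a` and `y`, two of the three conditions on the new vertex hold already by `hob`
      -- and `hry`; only the turn at `a` depends on `c`.
      have split : ∀ c T, Chain n (ori w) r b (sq (f t) q :: f t :: c :: T) ∧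
          wt (shift md n m (ori w) r) (sq (f t) q :: f t :: c :: T) = k ↔
          d ≤ k ∧ (Chain n (ori w) r b (f t :: c :: T) ∧
            wt (shift md n m (ori w) r) (f t :: c :: T) = k - d) ∧ ori w c (f t) (sq (f t) q) := by
        intro c T
        rw [wt, hay]
        constructor
        · rintro ⟨h1, h2⟩
          rcases h1 with _ | ⟨hy, h, h1, h2, h3⟩
          exact ⟨by omega, ⟨h, by omega⟩, h3⟩
        · rintro ⟨h1, ⟨h2, h3⟩, h4⟩
          exact ⟨.step hy h2 hob hry h4, by omega⟩
      have nil : ¬ Chain n (ori w) r b [sq (f t) q, f t] := by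
        intro h
        generalize hv : sq (f t) q = v at h
        generalize hu : f t = u at h
        rcases h with _ | _
        exact fr t ht (by rw [hu])
      split_ifs with hkd
      · rw [Finset.card_eq_zero, Finset.filter_eq_empty_iff]
        rintro L hL ⟨T, rfl⟩
        rw [mem hk] at hL
        rcases T with _ | ⟨c, T⟩
        · exact nil hL.1
        · have := ((split c T).1 hL).1
          omega
      · simp only [← ite_not (p := ori w r b _)]
        symm
        refine sum_ite_card_eq (φ := List.cons (sq (f t) q)) (List.cons_injective)
          (fun L => ?_) fun i hi hoi j hj hoj L hL hL' => ?_
        · rw [Finset.mem_filter, mem hk]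
          constructor
          · rintro ⟨hL, T, rfl⟩
            rcases T with _ | ⟨c, T⟩
            · exact absurd hL.1 nil
            obtain ⟨-, h2, h3⟩ := (split c T).1 hL
            obtain ⟨q', hq', hoq, rfl⟩ : ∃ q' < q, ¬ ori w r b (sq (f t) q') ∧
                anti n (sq (f t) q') = c := by
              have hc : c < 2 * n := h2.1.lt hr2 hb c (by simp)
              rcases h2.1.head with ⟨-, h, -⟩ | ⟨h4, h5, h6, h7⟩
              · refine ⟨0, h0, ?_, ?_⟩
                · rw [s0 t ht]; exact nb
                · rw [s0 t ht, har, h]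
              -- The two sign changes cancel: `det (a,-r,-c) = det (r,c,a)`, so the antipode of `c`
              -- is among the sorted points around `a`.
              · obtain ⟨q', h8, h9, h10⟩ := (S t ht).2.2.1 (anti n c) (anti_lt hn _) (by
                  unfold ori at h6 ⊢
                  rw [hw.add, hw.anti hc, det3_neg_mid, det3_neg_right, neg_neg, det3_cyc]
                  exact h6)
                refine ⟨q', ?_, ?_, ?_⟩
                · rw [(S t ht).2.2.2.1 q' q h8 h9 h0 hq, h10, ori_anti₂ hc]
                  exact h3
                · rw [h10]
                  unfold ori
                  rw [hw.anti hc, det3_neg_right, not_lt, neg_nonpos]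
                  rcases h7 with rfl | h7
                  · rw [det3_self_right]
                  · exact h7.le
                · rw [h10, anti_anti hc]
            refine ⟨q', Finset.mem_range.2 hq', hoq, f t :: anti n (sq (f t) q') :: T, ?_, rfl⟩
            rw [Finset.mem_filter, mem (by omega)]
            exact ⟨h2, T, rfl⟩
          · rintro ⟨q', hq', hoq, L, hL, rfl⟩
            rw [Finset.mem_range] at hq'
            rw [Finset.mem_filter, mem (by omega)] at hL
            obtain ⟨h1, T, rfl⟩ := hL
            refine ⟨(split _ T).2 ⟨by omega, h1, ?_⟩, _, rfl⟩
            have hy' := (S t ht).1 q' (by omega)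
            rcases Nat.eq_zero_or_pos q' with rfl | h0'
            · rw [s0 t ht, har]
              exact hry
            · have := ((S t ht).2.2.2.1 q' q h0' (by omega) h0 hq).1 hq'
              rwa [← ori_anti₂ (anti_lt hn _), anti_anti hy']
        · rw [Finset.mem_range] at hi hj
          obtain ⟨-, T, rfl⟩ := Finset.mem_filter.1 hL
          obtain ⟨-, T', hT⟩ := Finset.mem_filter.1 hL'
          have e : anti n (sq (f t) i) = anti n (sq (f t) j) := by
            simp only [List.cons.injEq, true_and] at hT
            exact hT.1
          have e' := congrArg (anti n) e
          rw [anti_anti ((S t ht).1 i (by omega)), anti_anti ((S t ht).1 j (by omega))] at e'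
          rcases lt_trichotomy i j with h | h | h
          · exact absurd e' ((S t ht).2.2.2.2 i j h (by omega))
          · exact h
          · exact absurd e'.symm ((S t ht).2.2.2.2 j i h (by omega))
    · rcases Nat.eq_zero_or_pos q with rfl | h0
      · left
        rw [s0 t ht, har]
      · right
        have hy := (S t ht).1 q hq
        have h1 := ori_rn.1 ((S t ht).2.1 q h0 hq)
        set c := anti n (sq (f t) q) with hc
        have hc2 : c < 2 * n := anti_lt hn _
        have hca : anti n c = sq (f t) q := anti_anti hy
        have h2 : ori w r c (f t) := by
          unfold ori at h1 ⊢
          rw [hw.anti hy, det3_neg_mid, ← det3_swap_right]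
          exact h1
        have h3 : c = b ∨ ori w r b c := by
          have h4 : 0 ≤ det3 (w r) (w b) (w c) := by
            have : ¬ 0 < det3 (w r) (w b) (w (anti n c)) := by rw [hca]; exact hob
            rw [hw.anti hc2, det3_neg_right] at this
            linarith
          rcases h4.lt_or_eq with h | h
          · exact Or.inr h
          left
          have h5 := hw.ne_of_ori hr2 hc2 (f1 t ht) h2
          have h6 : b % n = c % n := by
            by_contra h6
            exact hw.gen r b c hrb' h5.1 h6 h.symm
          rcases eq_or_eq_anti hc2 hb h6.symm with h7 | h7
          · exact h7
          -- If `c` were the antipode of `b`, positivity of `(r,c,a)` would put `a = f t` to the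
          -- right of the ray from `r` to `b`, whereas `f t` is `b` or to its left.
          · exfalso
            unfold ori at h2
            rw [h7, hw.anti hb, det3_neg_mid] at h2
            rcases Nat.eq_zero_or_pos t with rfl | h0
            · rw [hf.zero, det3_self_right] at h2
              linarith
            · have := f2 t h0 ht
              unfold ori at this
              linarith
        have h4 : 0 < t := by
          by_contra h0
          obtain rfl : t = 0 := by omega
          rw [hf.zero] at h2
          unfold ori at h2
          rcases h3 with h3 | h3
          · rw [h3, det3_self_right] at h2
            exact h2.false
          · unfold ori at h3
            rw [det3_swap_right] at h3
            linarith
        have h5 : ∃ q' < n - 1, sq c q' = f t := by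
          obtain ⟨u, hu, huc⟩ := fe c hc2 h3
          obtain ⟨q', -, h6, h7⟩ := (S u hu).2.2.1 (f t) (f1 t ht) (by
            rw [huc, ori_rn]
            exact h2)
          exact ⟨q', h6, by rw [← huc, h7]⟩
        obtain ⟨u, hu, huc⟩ := fe c hc2 h3
        refine ⟨u, ?_, huc.symm, f2 t h4 ht, by rw [huc]; exact h5⟩
        rcases Nat.eq_zero_or_pos u with rfl | hu0
        · exact h4
        · rw [f4 u t hu0 hu h4 ht, huc]
          exact h2
    · split_ifs with h
      · obtain ⟨rfl, rfl⟩ := h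
        rw [Finset.card_eq_one]
        refine ⟨[y, r], ?_⟩
        ext L
        rw [Finset.mem_filter, mem (by omega), Finset.mem_singleton]
        constructor
        · rintro ⟨⟨h1, h2⟩, T, rfl⟩
          rcases h1 with _ | ⟨hy, h, h1, h2, h3⟩
          · rfl
          · exact absurd h (hnr _ _)
        · rintro rfl
          exact ⟨⟨.base, rfl⟩, [], rfl⟩
      · rw [Finset.card_eq_zero, Finset.filter_eq_empty_iff]
        rintro L hL ⟨T, rfl⟩
        obtain ⟨h1, h2⟩ := (Finset.mem_filter.1 hL).2
        rcases h1 with _ | ⟨hy, h3, -, -, -⟩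
        · exact h ⟨rfl, h2.symm⟩
        · exact hnr _ _ h3
    -- The chains with at least three vertices are partitioned by their last two vertices, which
    -- correspond to unique positions `t` and `q`.
    · refine Eq.trans ?_ (sum_ite_card_eq (s := Finset.range (n - 1) ×ˢ Finset.range (n - 1))
        (p := fun i => ori w r b (sq (f i.1) i.2)) (φ := fun L => L)
        (A := fun i => (chains n m (ori w) r b (shift md n m (ori w) r) k).filter
          fun L => ∃ T, L = sq (f i.1) i.2 :: f i.1 :: T)
        (fun _ _ h => h) (fun L => ?_) ?_)
      · rw [Finset.sum_product]
      · rw [Finset.mem_filter, mem hk]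
        constructor
        · rintro ⟨h, h3⟩
          have hL := h.1
          rcases hL with _ | @⟨y, a, c, L, hy, hL, h4, h5, h6⟩
          · simp at h3
          obtain ⟨t, ht, rfl⟩ := fe a (hL.lt hr2 hb a (by simp)) (by
            rcases hL.head with h | h
            · exact Or.inl h.1
            · exact Or.inr h.2.1)
          obtain ⟨q, -, hq, rfl⟩ := (S t ht).2.2.1 y hy (ori_rn.2 h5)
          refine ⟨(t, q), by simp [ht, hq], h4, _, ?_, rfl⟩
          rw [Finset.mem_filter, mem hk]
          exact ⟨h, _, rfl⟩
        · rintro ⟨⟨t, q⟩, hi, ho, L, hL, rfl⟩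
          simp only [Finset.mem_product, Finset.mem_range] at hi
          rw [Finset.mem_filter, mem hk] at hL
          obtain ⟨h, T, rfl⟩ := hL
          refine ⟨h, ?_⟩
          rcases T with _ | ⟨c, T⟩
          · exfalso
            have h := h.1
            simp only at h
            generalize hv : sq (f t) q = v at h
            generalize hu : f t = u at h
            rcases h with _ | _
            exact fr t hi.1 (by rw [hu])
          · simp
      · rintro ⟨t, q⟩ hi - ⟨t', q'⟩ hj - L hL hL'
        simp only [Finset.mem_product, Finset.mem_range] at hi hj
        obtain ⟨-, T, rfl⟩ := Finset.mem_filter.1 hL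
        obtain ⟨-, T', hT⟩ := Finset.mem_filter.1 hL'
        simp only [List.cons.injEq] at hT
        obtain ⟨e1, e2, -⟩ := hT
        have ht : t = t' := by
          rcases lt_trichotomy t t' with h | h | h
          · exact absurd e2 (f5 t t' h hj.1)
          · exact h
          · exact absurd e2.symm (f5 t' t h hi.1)
        subst ht
        have hq : q = q' := by
          rcases lt_trichotomy q q' with h | h | h
          · exact absurd e1 ((S t hi.1).2.2.2.2 q q' h hj.2)
          · exact h
          · exact absurd e1.symm ((S t hi.1).2.2.2.2 q' q h hi.2)
        rw [hq]

/-! ### Local conditions imply convexity -/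

/-- Any three of the signed points are ordered clockwise. -/
def Convex (w : ℕ → Fin 3 → ℝ) (L : List ℕ) : Prop :=
  ∀ s q p, [s, q, p].Sublist L → ori w p q s

theorem Convex.tail {w : ℕ → Fin 3 → ℝ} {y : ℕ} {L : List ℕ} (h : Convex w (y :: L)) :
    Convex w L := fun s q p hs => h s q p (hs.cons y)

theorem Convex.head {w : ℕ → Fin 3 → ℝ} {y : ℕ} {L : List ℕ} (h : Convex w (y :: L)) {q p : ℕ}
    (hs : [q, p].Sublist L) : ori w p q y := h y q p (hs.cons_cons y)

theorem Convex.cons {w : ℕ → Fin 3 → ℝ} {y : ℕ} {L : List ℕ} (h : Convex w L)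
    (h' : ∀ q p, [q, p].Sublist L → ori w p q y) : Convex w (y :: L) := by
  intro s q p hs
  rcases List.sublist_cons_iff.1 hs with hs | ⟨r, hr, hs⟩
  · exact h s q p hs
  · obtain ⟨rfl, rfl⟩ := List.cons.inj hr
    exact h' q p hs

theorem sublist_of_concat {l X : List ℕ} {q r : ℕ} (h : (l ++ [q]).Sublist (X ++ [r]))
    (hq : q ≠ r) : (l ++ [q]).Sublist X := by
  obtain ⟨l₁, l₂, e, h₁, h₂⟩ := List.sublist_append_iff.1 h
  rcases List.sublist_singleton.1 h₂ with rfl | rfl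
  · rw [e, List.append_nil]; exact h₁
  · exact absurd (List.append_inj_right' e rfl) (by simpa using hq)

/-- Two exchange arguments add `y` to a convex list. A Plücker relation through the last vertex `a`
extends positivity of `(c,a,y)` to `(x,a,y)` for all earlier `x`; a relation through `q` then passes
from `(q,a,y)` to `(p,q,y)` for arbitrary earlier `p`, `q`. Triples containing `r` follow from
transitivity of the angular order around `r`, restricted to the points left of `b`. -/
theorem Chain.convex {n : ℕ} {w : ℕ → Fin 3 → ℝ} {r b : ℕ} {L : List ℕ}
    (h : Chain n (ori w) r b L) : Convex w L ∧ ∃ T, L = T ++ [b, r] ∧ ∀ x ∈ T, ori w r b x := by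
  induction h with
  | base =>
    refine ⟨fun s q p hs => ?_, [], rfl, by simp⟩
    have := hs.length_le
    simp at this
  | @step y a c L hy h h1 h2 h3 ih =>
    obtain ⟨ih, T, hT, hTb⟩ := ih
    refine ⟨ih.cons ?_, y :: T, by rw [hT]; rfl, List.forall_mem_cons.2 ⟨h1, hTb⟩⟩
    rcases T with _ | ⟨a', T⟩
    · simp only [List.nil_append, List.cons.injEq] at hT
      obtain ⟨rfl, rfl, rfl⟩ := hT
      intro q p hs
      have := hs.eq_of_length rfl
      simp only [List.cons.injEq, and_true] at this
      obtain ⟨rfl, rfl⟩ := this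
      exact h1
    obtain ⟨rfl, hT'⟩ := List.cons.inj hT
    rw [List.cons_append] at hT
    rw [hT] at ih ⊢
    have hT2 : T ++ [b, r] = (T ++ [b]) ++ [r] := by simp
    have hrL : ∀ x ∈ T ++ [b], [x, r].Sublist (T ++ [b, r]) := fun x hx => by
      rw [hT2]
      exact List.Sublist.append (List.singleton_sublist.2 hx) (List.Sublist.refl [r])
    -- all vertices are before `y`, as seen from `r`
    have hr : ∀ x ∈ T ++ [b], ori w r x y := by
      intro x hx
      have hxa := ih.head (hrL x hx)
      rcases List.mem_append.1 hx with hx | hx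
      · exact det3_trans (hTb x (List.mem_cons_of_mem _ hx)) (hTb a (List.mem_cons_self))
          h1 hxa h2
      · rw [List.mem_singleton.1 hx]
        exact h1
    obtain ⟨X, hX⟩ : ∃ X, T ++ [b] = c :: X := by
      rcases T with _ | ⟨e, T⟩
      · exact ⟨[], by simpa using (List.cons.inj hT').1.symm⟩
      · exact ⟨T ++ [b], by rw [(List.cons.inj hT').1]; rfl⟩
    rw [hT2, hX] at ih ⊢
    rw [hX] at hr
    have hl : ∀ {x}, x ∈ c :: X → [x, r].Sublist (c :: X ++ [r]) := fun hx =>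
      List.Sublist.append (List.singleton_sublist.2 hx) (List.Sublist.refl [r])
    have key : ∀ x ∈ c :: X ++ [r], ori w x a y := by
      intro x hx
      rcases List.mem_append.1 hx with hx | hx
      · rcases List.mem_cons.1 hx with rfl | hxX
        · exact h3
        have h4 : ori w r c a := ih.head (hl List.mem_cons_self)
        have h5 : ori w r x a := ih.head (hl hx)
        have h6 : ori w x c a := ih.head
          (((List.singleton_sublist.2 hxX).cons_cons c).trans (List.sublist_append_left _ _))
        unfold ori at *
        -- The Plücker relation among `r`, `c`, `x`, `y` as seen from `a`.
        have h7 : 0 < det3 (w r) (w c) (w a) * det3 (w x) (w a) (w y) := by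
          rw [show det3 (w r) (w c) (w a) * det3 (w x) (w a) (w y) =
            det3 (w r) (w x) (w a) * det3 (w c) (w a) (w y) +
            det3 (w x) (w c) (w a) * det3 (w r) (w a) (w y) by unfold det3; ring]
          positivity
        exact pos_of_mul_pos_right h7 h4.le
      · rw [List.mem_singleton.1 hx]
        exact h2
    intro q p hs
    rcases List.sublist_cons_iff.1 hs with hs | ⟨l, hl', hs⟩
    · by_cases hpr : p = r
      · subst hpr
        have hq : q ∈ c :: X ++ [p] := hs.subset (by simp)
        rcases List.mem_append.1 hq with hq | hq
        · exact hr q hq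
        · have := ih.head hs
          unfold ori at this
          rw [List.mem_singleton.1 hq, det3_self_left] at this
          exact absurd this (lt_irrefl _)
      · have hs' : [q, p].Sublist (c :: X) := sublist_of_concat (l := [q]) hs hpr
        have hq : q ∈ c :: X := hs'.subset (by simp)
        have hp : p ∈ c :: X := hs'.subset (by simp)
        have h4 := ih.head hs
        have h5 := ih.head (hl hq)
        have h6 : ori w r p q :=
          ih.tail q p r (List.Sublist.append hs' (List.Sublist.refl [r]))
        have h7 := key q (List.mem_append_left _ hq)
        have h8 := hr q hq
        unfold ori at *
        -- The Plücker relation among `r`, `a`, `p`, `y` as seen from `q`.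
        have h9 : 0 < det3 (w r) (w q) (w a) * det3 (w p) (w q) (w y) := by
          rw [show det3 (w r) (w q) (w a) * det3 (w p) (w q) (w y) =
            det3 (w q) (w a) (w y) * det3 (w r) (w p) (w q) +
            det3 (w p) (w q) (w a) * det3 (w r) (w q) (w y) by unfold det3; ring]
          positivity
        exact pos_of_mul_pos_right h9 h5.le
    · obtain ⟨rfl, rfl⟩ := List.cons.inj hl'
      exact key p (List.singleton_sublist.1 hs)

/-- The three conditions in `Chain.step` are instances of convexity, for the last pair, the pair of
root and current end, and the last edge. -/
theorem Convex.chain {n : ℕ} {w : ℕ → Fin 3 → ℝ} {r b : ℕ} {T : List ℕ}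
    (h : Convex w (T ++ [b, r])) (hT : ∀ x ∈ T, x < 2 * n) :
    Chain n (ori w) r b (T ++ [b, r]) := by
  induction T with
  | nil => exact .base
  | cons y T ih =>
    have ih := ih h.tail fun x hx => hT x (List.mem_cons_of_mem _ hx)
    have hy := hT y List.mem_cons_self
    have h1 : ori w r b y := h.head (List.sublist_append_right _ _)
    rw [List.cons_append] at h ⊢
    have hl : ∃ a X, T ++ [b, r] = a :: X ++ [r] := by
      rcases T with _ | ⟨a, T⟩
      · exact ⟨b, [], rfl⟩
      · exact ⟨a, T ++ [b], by simp⟩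
    obtain ⟨a, X, e⟩ := hl
    rw [e] at h ih ⊢
    have h2 : ori w r a y := h.head (by
      rw [List.cons_append]
      exact (List.sublist_append_right X [r]).cons_cons a)
    rcases X with _ | ⟨c, X⟩
    · exact .step hy ih h1 h2 h2
    · exact .step hy ih h1 h2 (h.head (by simp))

/-! ### Fan triangulations and weights -/

/-- Points in the triangles with vertex `r` that triangulate a polygon. -/
noncomputable def fan (n : ℕ) (o : ℕ → ℕ → ℕ → Prop) (r : ℕ) : List ℕ → Finset ℕ
  | y :: a :: c :: L => fan n o r (a :: c :: L) ∪
      (Finset.range (2 * n)).filter fun x => o r a x ∧ o a y x ∧ o y r x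
  | _ => ∅

theorem mem_fan {n : ℕ} {o : ℕ → ℕ → ℕ → Prop} {r x : ℕ} {L : List ℕ}
    (h : x ∈ fan n o r (L ++ [r])) :
    x < 2 * n ∧ ∃ q p, [q, p].Sublist L ∧ o r p x ∧ o p q x ∧ o q r x := by
  induction L with
  | nil => simp [fan] at h
  | cons y L ih =>
    rcases L with _ | ⟨a, L⟩
    · simp [fan] at h
    · obtain ⟨c, X, e⟩ : ∃ c X, L ++ [r] = c :: X := by
        rcases L with _ | ⟨c, L⟩
        · exact ⟨r, [], rfl⟩
        · exact ⟨c, L ++ [r], rfl⟩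
      simp only [List.cons_append, e, fan, Finset.mem_union, Finset.mem_filter,
        Finset.mem_range] at h ih
      rcases h with h | ⟨h1, h2⟩
      · obtain ⟨h1, q, p, h2, h3⟩ := ih h
        exact ⟨h1, q, p, h2.cons y, h3⟩
      · exact ⟨h1, y, a, by simp, h2⟩

/-- A point in an earlier fan triangle lies angularly between two vertices `p`, `q` around `r`,
hence before `a`; a point of the next triangle lies after `a`. So the triangle counts add up without
overlap. -/
theorem disjoint_fan {n : ℕ} {w : ℕ → Fin 3 → ℝ} {r a x : ℕ} {L : List ℕ}
    (h : Convex w (a :: L ++ [r])) (hx : x ∈ fan n (ori w) r (a :: L ++ [r])) :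
    ¬ ori w r a x := by
  obtain ⟨-, q, p, hs, h1, h2, h3⟩ := mem_fan hx
  unfold ori at *
  rw [det3_cyc] at h3
  rw [not_lt]
  rcases List.sublist_cons_iff.1 hs with hs | ⟨l, hl, hs⟩
  · have h4 := h.head (((by simp : [q, r].Sublist ([q, p] ++ [r]))).trans
      (hs.append (List.Sublist.refl [r])))
    have h5 := h.head (((by simp : [p, r].Sublist ([q, p] ++ [r]))).trans
      (hs.append (List.Sublist.refl [r])))
    have h6 := h.tail _ _ _ (hs.append (List.Sublist.refl [r]))
    unfold ori at *
    have h7 : 0 < det3 (w r) (w p) (w q) * det3 (w r) (w x) (w a) := by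
      rw [det3_plucker]
      positivity
    have := pos_of_mul_pos_right h7 h6.le
    rw [det3_swap_right]
    linarith
  · obtain ⟨rfl, rfl⟩ := List.cons.inj hl
    rw [det3_swap_right]
    linarith

/-- The number `k` is the size of a polygon with `l` vertices and `t` further points. -/
def Mode.Size : Mode → ℕ → ℕ → ℕ → Prop
  | .gon, l, _, k => l = k
  | .hole, l, t, k => l = k ∧ t = 0
  | .island, l, t, k => l + t = k

/-- A step of weight `m + 1` already exceeds `k ≤ m`, so weight `k` forces every vertex except `r`
to have index above `r` and, for holes, every triangle to be empty. Otherwise the weights sum to the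
size, because triangle counts are additive. -/
theorem Chain.wt_eq_iff {n m : ℕ} {w : ℕ → Fin 3 → ℝ} {r b : ℕ} {L : List ℕ} (md : Mode)
    (h : Chain n (ori w) r b L) (hb : r < b % n) (k : ℕ) (hk : k ≤ m) :
    wt (shift md n m (ori w) r) L = k ↔
      (∀ x ∈ L, x = r ∨ r < x % n) ∧ md.Size L.length (fan n (ori w) r L).card k := by
  induction h generalizing k with
  | base => cases md <;> simp [wt, fan, Mode.Size, hb]
  | @step y a c L hy h h1 h2 h3 ih =>
    have hyr : y ≠ r := by
      rintro rfl
      unfold ori at h1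
      rw [det3_self_outer] at h1
      exact h1.false
    obtain ⟨hcv, X, e⟩ : Convex w (a :: c :: L) ∧ ∃ X, a :: c :: L = a :: X ++ [r] := by
      obtain ⟨h4, T, h5, -⟩ := h.convex
      refine ⟨h4, ?_⟩
      rcases T with _ | ⟨e, T⟩
      · obtain ⟨rfl, h5⟩ := List.cons.inj h5
        exact ⟨[], by rw [h5]; rfl⟩
      · obtain ⟨rfl, h5⟩ := List.cons.inj h5
        exact ⟨T ++ [b], by rw [h5]; simp⟩
    have hcard : (fan n (ori w) r (y :: a :: c :: L)).card =
        (fan n (ori w) r (a :: c :: L)).card + tri n (ori w) r a y := by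
      rw [fan, Finset.card_union_of_disjoint, tri, Nat.count_eq_card_filter_range]
      rw [Finset.disjoint_left]
      intro x hx hx'
      rw [e] at hcv hx
      exact disjoint_fan hcv hx (Finset.mem_filter.1 hx').2.1
    rw [wt, hcard, List.forall_mem_cons, List.length_cons]
    by_cases hry : r < y % n
    · rw [show shift md n m (ori w) r a y = md.weight m (tri n (ori w) r a y) from if_pos hry]
      generalize tri n (ori w) r a y = t
      generalize (fan n (ori w) r (a :: c :: L)).card = u at ih
      have hand : ∀ p : Prop, ((y = r ∨ r < y % n) ∧ p) ↔ p := fun p =>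
        and_iff_right (Or.inr hry)
      rw [hand]
      have hs : 1 ≤ md.weight m t := by
        cases md <;> simp only [Mode.weight] <;> (try split_ifs) <;> omega
      rcases lt_or_ge k (md.weight m t) with hlt | hle
      · refine iff_of_false (by omega) fun h => ?_
        have h := h.2
        cases md <;> simp only [Mode.weight, Mode.Size, List.length_cons] at h hlt
        · omega
        · obtain ⟨h4, h5⟩ := h
          rw [if_neg (by omega)] at hlt
          omega
        · omega
      · have ih := ih (k - md.weight m t) (by omega)
        rw [show wt (shift md n m (ori w) r) (a :: c :: L) + md.weight m t = k ↔
          wt (shift md n m (ori w) r) (a :: c :: L) = k - md.weight m t by omega]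
        rw [ih]
        refine and_congr Iff.rfl ?_
        cases md <;> simp only [Mode.weight, Mode.Size, List.length_cons] at hle ⊢
        · omega
        · split_ifs at hle ⊢ with h0
          · omega
          · omega
        · omega
    · rw [show shift md n m (ori w) r a y = m + 1 from if_neg hry]
      constructor
      · intro; omega
      · rintro ⟨⟨h, -⟩, -⟩
        exact absurd h (by simp [hyr, hry])

/-! ### Normalised polygon lists -/

/-- The list `T ++ [r]` is the clockwise vertex list of a polygon, where `r` is the vertex of
minimal index, with positive sign. -/
structure IsPoly (n : ℕ) (w : ℕ → Fin 3 → ℝ) (r : ℕ) (T : List ℕ) : Prop where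
  root : r < n
  lt : ∀ u ∈ T, u < 2 * n ∧ r < u % n
  length : 2 ≤ T.length
  convex : Convex w (T ++ [r])

/-- The polygons of size `k`. -/
noncomputable def polys (md : Mode) (n m : ℕ) (w : ℕ → Fin 3 → ℝ) (k : ℕ) : Finset (List ℕ) :=
  (lists n m).filter fun L => ∃ r T, L = T ++ [r] ∧ IsPoly n w r T ∧
    md.Size L.length (fan n (ori w) r L).card k

theorem mem_polys {md : Mode} {n m : ℕ} {w : ℕ → Fin 3 → ℝ} {k : ℕ} (hk : k ≤ m) {L : List ℕ} :
    L ∈ polys md n m w k ↔ ∃ r T, L = T ++ [r] ∧ IsPoly n w r T ∧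
      md.Size L.length (fan n (ori w) r L).card k := by
  rw [polys, Finset.mem_filter, mem_lists, and_iff_right_iff_imp]
  rintro ⟨r, T, rfl, hP, hs⟩
  refine ⟨?_, fun x hx => ?_⟩
  · cases md <;> simp only [Mode.Size] at hs <;> omega
  · have := hP.root
    rcases List.mem_append.1 hx with hx | hx
    · exact (hP.lt x hx).1
    · rw [List.mem_singleton.1 hx]
      omega

/-- A polygon list determines the pair `(r, b)` as its last two entries, so the sum over pairs
counts each list once. -/
theorem total_eq_card {n m : ℕ} {w : ℕ → Fin 3 → ℝ} (md : Mode) {k : ℕ} (hk : k ≤ m) :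
    total n (chainCount md n m (ori w)) k = (polys md n m w k).card := by
  have key : ∀ r b, r < n → b < 2 * n → r < b % n → ∀ L,
      L ∈ (chains n m (ori w) r b (shift md n m (ori w) r) k).filter (fun L => 3 ≤ L.length) ↔
        ∃ T, L = T ++ [b, r] ∧ IsPoly n w r (T ++ [b]) ∧
          md.Size L.length (fan n (ori w) r L).card k := by
    intro r b hr hb hrb L
    rw [Finset.mem_filter, mem_chains (by omega) hb (one_le_shift md n m _ r) hk]
    constructor
    · rintro ⟨⟨h, hw⟩, h3⟩
      rw [h.wt_eq_iff md hrb k hk] at hw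
      obtain ⟨hc, T, rfl, hT⟩ := h.convex
      have hlt := h.lt (by omega) hb
      have hT2 : T ++ [b, r] = (T ++ [b]) ++ [r] := by simp
      refine ⟨T, rfl, ⟨hr, fun u hu => ⟨hlt u (by rw [hT2]; exact List.mem_append_left _ hu), ?_⟩,
        by simpa using h3, by rw [← hT2]; exact hc⟩, hw.2⟩
      rcases List.mem_append.1 hu with hu | hu
      · refine (hw.1 u (List.mem_append_left _ hu)).resolve_left ?_
        rintro rfl
        have := hT u hu
        unfold ori at this
        rw [det3_self_outer] at this
        exact this.false
      · rw [List.mem_singleton.1 hu]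
        exact hrb
    · rintro ⟨T, rfl, hP, hs⟩
      have hT2 : T ++ [b, r] = (T ++ [b]) ++ [r] := by simp
      have hC : Chain n (ori w) r b (T ++ [b, r]) :=
        Convex.chain (by rw [hT2]; exact hP.convex) fun x hx => (hP.lt x (by simp [hx])).1
      refine ⟨⟨hC, (hC.wt_eq_iff md hrb k hk).2 ⟨fun x hx => ?_, hs⟩⟩, ?_⟩
      · rw [hT2] at hx
        rcases List.mem_append.1 hx with hx | hx
        · exact Or.inr (hP.lt x hx).2
        · exact Or.inl (List.mem_singleton.1 hx)
      · have := hP.length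
        rw [hT2, List.length_append]
        simpa using this
  rw [total, ← Finset.sum_product']
  refine sum_ite_card_eq (s := Finset.range n ×ˢ Finset.range (2 * n))
    (p := fun i => i.1 < i.2 % n) (φ := fun L => L) (fun _ _ h => h) (fun L => ?_) ?_
  · rw [mem_polys hk]
    constructor
    · rintro ⟨r, T, rfl, hP, hs⟩
      obtain ⟨T', b, rfl⟩ : ∃ T' b, T = T' ++ [b] := by
        rcases List.eq_nil_or_concat T with rfl | ⟨T', b, h⟩
        · exact absurd hP.length (by simp)
        · exact ⟨T', b, by simpa using h⟩
      have hb := hP.lt b (by simp)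
      refine ⟨(r, b), by simp [hP.root, hb.1], hb.2, _, (key r b hP.root hb.1 hb.2 _).2
        ⟨T', ?_, hP, hs⟩, rfl⟩
      simp
    · rintro ⟨⟨r, b⟩, hi, hrb, L, hL, rfl⟩
      simp only [Finset.mem_product, Finset.mem_range] at hi
      obtain ⟨T, rfl, hP, hs⟩ := (key r b hi.1 hi.2 hrb L).1 hL
      exact ⟨r, T ++ [b], by simp, hP, hs⟩
  · rintro ⟨r, b⟩ hi hrb ⟨r', b'⟩ hi' hrb' L hL hL'
    simp only [Finset.mem_product, Finset.mem_range] at hi hi'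
    obtain ⟨T, rfl, -, -⟩ := (key r b hi.1 hi.2 hrb L).1 hL
    obtain ⟨T', e, -, -⟩ := (key r' b' hi'.1 hi'.2 hrb' _).1 hL'
    have := List.append_inj_right' e rfl
    simp only [List.cons.injEq, and_true] at this
    rw [this.1, this.2]

theorem total_hole_zero {n m : ℕ} {w : ℕ → Fin 3 → ℝ} :
    total n (chainCount .hole n m (ori w)) 0 = 0 := by
  rw [total_eq_card .hole (Nat.zero_le m), Finset.card_eq_zero, Finset.eq_empty_iff_forall_notMem]
  intro L hL
  obtain ⟨r, T, rfl, hP, hs⟩ := (mem_polys (Nat.zero_le m)).1 hL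
  have := hs.1
  simp at this

end RAM

/-! ### Cones and projective convex hulls -/

/-- The set of the projective points represented by the nonzero vectors of the convex cone that is
spanned by `S`. -/
def projCone (S : Set (Fin 3 → ℝ)) : Set RP2 :=
  {z | ∃ (v : Fin 3 → ℝ) (hv : v ≠ 0), v ∈ PointedCone.hull ℝ S ∧ z = Projectivization.mk ℝ v hv}

theorem mk_smul_eq {v : Fin 3 → ℝ} (hv : v ≠ 0) {c : ℝ} (h : c • v ≠ 0) :
    Projectivization.mk ℝ (c • v) h = Projectivization.mk ℝ v hv :=
  (Projectivization.mk_eq_mk_iff' ℝ _ _ h hv).2 ⟨c, rfl⟩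

theorem dot_nonneg {S : Set (Fin 3 → ℝ)} {a : Fin 3 → ℝ} (ha : ∀ v ∈ S, 0 ≤ a ⬝ᵥ v)
    {v : Fin 3 → ℝ} (hv : v ∈ PointedCone.hull ℝ S) : 0 ≤ a ⬝ᵥ v := by
  induction hv using Submodule.span_induction with
  | mem x hx => exact ha x hx
  | zero => simp
  | add x y _ _ hx hy => rw [dotProduct_add]; positivity
  | smul c x _ hx =>
    rw [show c • x = (c : ℝ) • x from rfl, dotProduct_smul]
    exact mul_nonneg c.2 hx

theorem dot_pos {S : Set (Fin 3 → ℝ)} {a : Fin 3 → ℝ} (ha : ∀ v ∈ S, 0 < a ⬝ᵥ v)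
    {v : Fin 3 → ℝ} (hv : v ∈ PointedCone.hull ℝ S) : v = 0 ∨ 0 < a ⬝ᵥ v := by
  induction hv using Submodule.span_induction with
  | mem x hx => exact Or.inr (ha x hx)
  | zero => simp
  | add x y _ _ hx hy =>
    rw [dotProduct_add]
    rcases hx with rfl | hx
    · simpa using hy
    · rcases hy with rfl | hy
      · simpa using Or.inr hx
      · exact Or.inr (by positivity)
  | smul c x _ hx =>
    rw [show c • x = (c : ℝ) • x from rfl, dotProduct_smul]
    rcases hx with rfl | hx
    · simp
    · rcases c.2.eq_or_lt with h | h
      · rw [← h]; simp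
      · exact Or.inr (mul_pos h hx)

theorem isProjLine_dot {a : Fin 3 → ℝ} (ha : a ≠ 0) :
    IsProjLine {z | ∃ (v : Fin 3 → ℝ) (hv : v ≠ 0),
      z = Projectivization.mk ℝ v hv ∧ a ⬝ᵥ v = 0} := by
  refine ⟨Projectivization.mk ℝ a ha, ?_⟩
  ext z
  induction z using Projectivization.ind with
  | h v hv =>
    simp only [Set.mem_ofPred_eq, Projectivization.orthogonal_mk]
    constructor
    · rintro ⟨u, hu, e, h⟩
      obtain ⟨c, rfl⟩ := (Projectivization.mk_eq_mk_iff' ℝ _ _ hv hu).1 e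
      rw [dotProduct_smul, h, smul_zero]
    · exact fun h => ⟨v, hv, rfl, h⟩

theorem IsProjLine.exists_dot {L : Set RP2} (h : IsProjLine L) :
    ∃ a : Fin 3 → ℝ, a ≠ 0 ∧ ∀ v hv, Projectivization.mk ℝ v hv ∈ L ↔ a ⬝ᵥ v = 0 := by
  obtain ⟨a, rfl⟩ := h
  induction a using Projectivization.ind with
  | h a ha => exact ⟨a, ha, fun v hv => Projectivization.orthogonal_mk ha hv⟩

/-- A semiconvex set that misses a line contains the cone over any of its subsets. -/
theorem projCone_subset {X : Set RP2} (hX : ProjSemiconvex X) {a : Fin 3 → ℝ}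
    (ha : ∀ v hv, Projectivization.mk ℝ v hv ∈ X → a ⬝ᵥ v ≠ 0) {S : Set (Fin 3 → ℝ)}
    (hS : ∀ v ∈ S, 0 < a ⬝ᵥ v) (hSX : ∀ v ∈ S, ∀ hv, Projectivization.mk ℝ v hv ∈ X) :
    projCone S ⊆ X := by
  have key : ∀ v ∈ PointedCone.hull ℝ S, ∀ hv, Projectivization.mk ℝ v hv ∈ X := by
    intro v hv
    induction hv using Submodule.span_induction with
    | mem x hx => exact hSX x hx
    | zero => exact fun h => absurd rfl h
    | smul c x _ hx =>
      intro h
      have hx0 : x ≠ 0 := by rintro rfl; exact h (smul_zero c)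
      rw [show Projectivization.mk ℝ (c • x) h = Projectivization.mk ℝ x hx0 from
        mk_smul_eq hx0 (c := (c : ℝ)) h]
      exact hx hx0
    | add x y hxS hyS hx hy =>
      intro h
      by_cases hx0 : x = 0
      · subst hx0
        simp only [zero_add] at h ⊢
        exact hy h
      by_cases hy0 : y = 0
      · subst hy0
        simp only [add_zero] at h ⊢
        exact hx h
      have ax := (dot_pos hS hxS).resolve_left hx0
      have ay := (dot_pos hS hyS).resolve_left hy0
      obtain ⟨T, ⟨u, v, hu, hv, eu, ev, rfl⟩, hT⟩ := hX _ (hx hx0) _ (hy hy0)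
      obtain ⟨c, rfl⟩ := (Projectivization.mk_eq_mk_iff' ℝ _ _ hu hx0).1 eu
      obtain ⟨d, rfl⟩ := (Projectivization.mk_eq_mk_iff' ℝ _ _ hv hy0).1 ev
      have hc : c ≠ 0 := by rintro rfl; simp at hu
      have hd : d ≠ 0 := by rintro rfl; simp at hv
      rcases lt_or_gt_of_ne (mul_ne_zero hc hd) with hcd | hcd
      · -- the segment meets the line
        by_cases h0 : (a ⬝ᵥ y) • x - (a ⬝ᵥ x) • y = 0
        · have e : y = ((a ⬝ᵥ x)⁻¹ * (a ⬝ᵥ y)) • x := by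
            rw [← smul_smul, sub_eq_zero.1 h0, smul_smul, inv_mul_cancel₀ ax.ne', one_smul]
          have e' : x + y = (1 + (a ⬝ᵥ x)⁻¹ * (a ⬝ᵥ y)) • x := by
            rw [add_smul, one_smul, ← e]
          have h1 : (1 + (a ⬝ᵥ x)⁻¹ * (a ⬝ᵥ y)) • x ≠ 0 := e' ▸ h
          have := hx hx0
          rw [← mk_smul_eq hx0 h1] at this
          convert this using 2
        -- The representatives have opposite signs, so the segment contains a combination of `x` and
        -- `y` annihilated by `a`; the factors `|c|⁻¹` and `|d|⁻¹` only undo the scaling of the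
        -- representatives.
        · exfalso
          have h1 : (|c|⁻¹ * (a ⬝ᵥ y)) • c • x + (|d|⁻¹ * (a ⬝ᵥ x)) • d • y =
              (|c|⁻¹ * c) • ((a ⬝ᵥ y) • x - (a ⬝ᵥ x) • y) := by
            have : |d|⁻¹ * d = -(|c|⁻¹ * c) := by
              rcases mul_neg_iff.1 hcd with ⟨h1, h2⟩ | ⟨h1, h2⟩
              · rw [abs_of_pos h1, abs_of_neg h2, inv_mul_cancel₀ hc, inv_neg, neg_mul,
                  inv_mul_cancel₀ hd]
              · rw [abs_of_neg h1, abs_of_pos h2, inv_mul_cancel₀ hd, inv_neg, neg_mul,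
                  inv_mul_cancel₀ hc, neg_neg]
            rw [smul_smul, smul_smul, mul_right_comm, mul_right_comm |d|⁻¹, this]
            module
          have h2 := smul_ne_zero (mul_ne_zero (inv_ne_zero (abs_ne_zero.2 hc)) hc) h0
          refine ha _ h2 (hT ⟨_, _, h1 ▸ h2, by positivity, by positivity, ?_⟩) ?_
          · congr 1
            exact h1.symm
          · rw [dotProduct_smul, dotProduct_sub, dotProduct_smul, dotProduct_smul, smul_eq_mul,
              smul_eq_mul, smul_eq_mul]
            ring
      · have h1 : |c|⁻¹ • c • x + |d|⁻¹ • d • y = (|c|⁻¹ * c) • (x + y) := by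
          have : |c|⁻¹ * c = |d|⁻¹ * d := by
            rcases pos_and_pos_or_neg_and_neg_of_mul_pos hcd with ⟨h1, h2⟩ | ⟨h1, h2⟩
            · rw [abs_of_pos h1, abs_of_pos h2, inv_mul_cancel₀ hc, inv_mul_cancel₀ hd]
            · rw [abs_of_neg h1, abs_of_neg h2, inv_neg, inv_neg, neg_mul, neg_mul,
                inv_mul_cancel₀ hc, inv_mul_cancel₀ hd]
          rw [smul_smul, smul_smul, this, smul_add]
        have h2 : (|c|⁻¹ * c) • (x + y) ≠ 0 :=
          smul_ne_zero (mul_ne_zero (inv_ne_zero (abs_ne_zero.2 hc)) hc) h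
        rw [← mk_smul_eq h h2]
        refine hT ⟨|c|⁻¹, |d|⁻¹, by rw [h1]; exact h2, by positivity, by positivity, ?_⟩
        congr 1
        exact h1.symm
  rintro _ ⟨v, hv, h, rfl⟩
  exact key v h hv

theorem projConvex_projCone {a : Fin 3 → ℝ} (ha : a ≠ 0) {S : Set (Fin 3 → ℝ)}
    (hS : ∀ v ∈ S, 0 < a ⬝ᵥ v) : ProjConvex (projCone S) := by
  refine ⟨?_, _, isProjLine_dot ha, ?_⟩
  · rintro _ ⟨x, hx, hxS, rfl⟩ _ ⟨y, hy, hyS, rfl⟩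
    refine ⟨_, ⟨x, y, hx, hy, rfl, rfl, rfl⟩, ?_⟩
    rintro _ ⟨s, t, h, hs, ht, rfl⟩
    exact ⟨_, h, add_mem (PointedCone.smul_mem _ hs hxS) (PointedCone.smul_mem _ ht hyS), rfl⟩
  · rw [Set.disjoint_left]
    rintro _ ⟨x, hx, hxS, rfl⟩ ⟨v, hv, e, h⟩
    obtain ⟨c, rfl⟩ := (Projectivization.mk_eq_mk_iff' ℝ _ _ hx hv).1 e
    have := (dot_pos hS hxS).resolve_left hx
    rw [dotProduct_smul, h, smul_zero] at this
    exact this.false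

theorem mem_projCone {S : Set (Fin 3 → ℝ)} {v : Fin 3 → ℝ} (hv : v ≠ 0) (h : v ∈ S) :
    Projectivization.mk ℝ v hv ∈ projCone S := ⟨v, hv, Submodule.subset_span h, rfl⟩

/-- For minimality, a competing convex set inside the cone misses the line `a = 0` too, whatever
line its own convexity provides. Hence `projCone_subset` applies to it with the same `a`. -/
theorem isProjHull_projCone {a : Fin 3 → ℝ} (ha : a ≠ 0) {S : Set (Fin 3 → ℝ)}
    (hS : ∀ v ∈ S, 0 < a ⬝ᵥ v) {I : Set RP2}
    (hSI : ∀ v ∈ S, ∀ hv, Projectivization.mk ℝ v hv ∈ I) (hI : I ⊆ projCone S) :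
    IsProjHull I (projCone S) := by
  refine ⟨⟨projConvex_projCone ha hS, hI⟩, fun X hX hXS => ?_⟩
  refine projCone_subset hX.1.1 (a := a) (fun v hv h => ?_) hS fun v hv hv0 => hX.2 (hSI v hv hv0)
  obtain ⟨u, hu, huS, e⟩ := hXS h
  obtain ⟨c, rfl⟩ := (Projectivization.mk_eq_mk_iff' ℝ _ _ hv hu).1 e
  have h1 := (dot_pos hS huS).resolve_left hu
  rw [dotProduct_smul]
  exact smul_ne_zero (left_ne_zero_of_smul hv) h1.ne'

/-- Take for `a` the form of a line missed by the hull. The cone over the `a`-positive lifts of `I`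
is convex, contains `I` and lies in the hull, so minimality forces equality. -/
theorem IsProjHull.eq_projCone {I G : Set RP2} (h : IsProjHull I G) :
    ∃ a : Fin 3 → ℝ, a ≠ 0 ∧ (∀ v hv, Projectivization.mk ℝ v hv ∈ G → a ⬝ᵥ v ≠ 0) ∧
      ∀ S : Set (Fin 3 → ℝ), (∀ v ∈ S, 0 < a ⬝ᵥ v) →
        (∀ v ∈ S, ∀ hv, Projectivization.mk ℝ v hv ∈ I) →
        (∀ z ∈ I, ∃ v ∈ S, ∃ hv, Projectivization.mk ℝ v hv = z) → G = projCone S := by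
  obtain ⟨⟨⟨h1, L, hL, hd⟩, h2⟩, hmin⟩ := h
  obtain ⟨a, ha, haL⟩ := hL.exists_dot
  have hG : ∀ v hv, Projectivization.mk ℝ v hv ∈ G → a ⬝ᵥ v ≠ 0 := fun v hv h e =>
    Set.disjoint_left.1 hd h ((haL v hv).2 e)
  refine ⟨a, ha, hG, fun S hS hSI hIS => ?_⟩
  have hsub := projCone_subset h1 hG hS fun v hv hv0 => h2 (hSI v hv hv0)
  refine (hmin ⟨projConvex_projCone ha hS, fun z hz => ?_⟩ hsub).antisymm hsub
  obtain ⟨v, hv, hv0, rfl⟩ := hIS z hz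
  exact mem_projCone hv0 hv

/-! ### Interior points -/

theorem cross_dot_eq_det3 (p q x : Fin 3 → ℝ) : (p ⨯₃ q) ⬝ᵥ x = det3 p q x := by
  rw [cross_apply, Matrix.vec3_dotProduct, det3]
  simp
  ring

theorem isOpen_setOf_mk_mem {U : Set RP2} (hU : IsOpen U) :
    IsOpen {v : Fin 3 → ℝ | ∃ hv : v ≠ 0, Projectivization.mk ℝ v hv ∈ U} := by
  have h1 : IsOpen {v : {v : Fin 3 → ℝ // v ≠ 0} | Projectivization.mk ℝ v.1 v.2 ∈ U} :=
    isOpen_coinduced.1 hU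
  have h2 := (isOpen_ne (x := (0 : Fin 3 → ℝ))).isOpenMap_subtype_val _ h1
  convert h2 using 1
  ext v
  simp

/-- Cramer's rule without division: the coordinates of `p` with respect to `x`, `y`, `z` are the
three edge determinants. -/
theorem det3_cramer (x y z p : Fin 3 → ℝ) :
    det3 x y z • p = det3 y z p • x + det3 z x p • y + det3 x y p • z := by
  ext i
  fin_cases i <;> simp [det3] <;> ring

/-- A vector in the open cone over a triangle is in the cone. -/
theorem mem_hull_of_det3 {x y z p : Fin 3 → ℝ} (h1 : 0 ≤ det3 x y p) (h2 : 0 ≤ det3 y z p)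
    (h3 : 0 ≤ det3 z x p) (h : 0 < det3 x y z) {S : Set (Fin 3 → ℝ)}
    (hx : x ∈ PointedCone.hull ℝ S) (hy : y ∈ PointedCone.hull ℝ S)
    (hz : z ∈ PointedCone.hull ℝ S) : p ∈ PointedCone.hull ℝ S := by
  rw [← PointedCone.smul_mem_iff _ h, det3_cramer]
  exact add_mem (add_mem (PointedCone.smul_mem _ h2 hx) (PointedCone.smul_mem _ h3 hy))
    (PointedCone.smul_mem _ h1 hz)

/-- The open triangle is a neighbourhood of the point: its preimage in `ℝ³ \ {0}` is an open cone
together with its negative. -/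
theorem mk_mem_interior {x y z p : Fin 3 → ℝ} (h1 : 0 < det3 x y p) (h2 : 0 < det3 y z p)
    (h3 : 0 < det3 z x p) (h : 0 < det3 x y z) {S : Set (Fin 3 → ℝ)}
    (hx : x ∈ PointedCone.hull ℝ S) (hy : y ∈ PointedCone.hull ℝ S)
    (hz : z ∈ PointedCone.hull ℝ S) (hp : p ≠ 0) :
    Projectivization.mk ℝ p hp ∈ interior (projCone S) := by
  rw [mem_interior]
  refine ⟨{u | ∃ (v : Fin 3 → ℝ) (hv : v ≠ 0), u = Projectivization.mk ℝ v hv ∧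
    0 < det3 x y v ∧ 0 < det3 y z v ∧ 0 < det3 z x v}, ?_, ?_, ⟨p, hp, rfl, h1, h2, h3⟩⟩
  · rintro _ ⟨v, hv, rfl, h1, h2, h3⟩
    exact ⟨v, hv, mem_hull_of_det3 h1.le h2.le h3.le h hx hy hz, rfl⟩
  · refine isOpen_coinduced.2 ?_
    have e : (fun v : {v : Fin 3 → ℝ // v ≠ 0} => Projectivization.mk ℝ v.1 v.2) ⁻¹'
        {u | ∃ (v : Fin 3 → ℝ) (hv : v ≠ 0), u = Projectivization.mk ℝ v hv ∧
          0 < det3 x y v ∧ 0 < det3 y z v ∧ 0 < det3 z x v} =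
        {v | 0 < det3 x y v.1 ∧ 0 < det3 y z v.1 ∧ 0 < det3 z x v.1} ∪
        {v | det3 x y v.1 < 0 ∧ det3 y z v.1 < 0 ∧ det3 z x v.1 < 0} := by
      ext ⟨v, hv⟩
      simp only [Set.mem_preimage, Set.mem_ofPred_eq, Set.mem_union]
      constructor
      · rintro ⟨u, hu, e, h1, h2, h3⟩
        obtain ⟨c, rfl⟩ := (Projectivization.mk_eq_mk_iff' ℝ _ _ hv hu).1 e
        simp only [← cross_dot_eq_det3, dotProduct_smul, smul_eq_mul] at h1 h2 h3 ⊢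
        rcases lt_or_gt_of_ne (left_ne_zero_of_smul hv) with hc | hc
        · exact Or.inr ⟨mul_neg_of_neg_of_pos hc h1, mul_neg_of_neg_of_pos hc h2,
            mul_neg_of_neg_of_pos hc h3⟩
        · exact Or.inl ⟨mul_pos hc h1, mul_pos hc h2, mul_pos hc h3⟩
      · rintro (⟨h1, h2, h3⟩ | ⟨h1, h2, h3⟩)
        · exact ⟨v, hv, rfl, h1, h2, h3⟩
        · refine ⟨-v, neg_ne_zero.2 hv, ?_, ?_⟩
          · exact (Projectivization.mk_eq_mk_iff' ℝ _ _ _ _).2 ⟨-1, by simp⟩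
          · simp only [det3_neg_right, neg_pos]
            exact ⟨h1, h2, h3⟩
    rw [e]
    have hc : ∀ p q, Continuous fun v : {v : Fin 3 → ℝ // v ≠ 0} => det3 p q v.1 := by
      intro p q
      have : Continuous fun v : Fin 3 → ℝ => det3 p q v := by unfold det3; fun_prop
      exact this.comp continuous_subtype_val
    refine IsOpen.union ?_ ?_
    · exact (isOpen_lt continuous_const (hc _ _)).inter
        ((isOpen_lt continuous_const (hc _ _)).inter (isOpen_lt continuous_const (hc _ _)))
    · exact (isOpen_lt (hc _ _) continuous_const).inter
        ((isOpen_lt (hc _ _) continuous_const).inter (isOpen_lt (hc _ _) continuous_const))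

/-- A point with a supporting line is not an interior point. -/
theorem mk_notMem_interior {S : Set (Fin 3 → ℝ)} {a b v : Fin 3 → ℝ} (ha : ∀ x ∈ S, 0 < a ⬝ᵥ x)
    (hb : ∀ x ∈ S, 0 ≤ b ⬝ᵥ x) (hb0 : b ≠ 0) (hav : 0 < a ⬝ᵥ v) (hbv : b ⬝ᵥ v = 0) (hv : v ≠ 0) :
    Projectivization.mk ℝ v hv ∉ interior (projCone S) := by
  intro h
  have h1 := isOpen_setOf_mk_mem (isOpen_interior (s := projCone S))
  have h2 : IsOpen {x : Fin 3 → ℝ | 0 < a ⬝ᵥ x} := isOpen_lt continuous_const (by fun_prop)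
  -- Moving `v` slightly against `b` keeps `a` positive, which fixes the sign of the representative,
  -- but makes `b` negative; so it leaves the cone.
  have h3 : ∀ᶠ t in nhds (0 : ℝ), v - t • b ∈ {v : Fin 3 → ℝ | ∃ hv : v ≠ 0,
      Projectivization.mk ℝ v hv ∈ interior (projCone S)} ∩ {x : Fin 3 → ℝ | 0 < a ⬝ᵥ x} := by
    have hc : Continuous fun t : ℝ => v - t • b := by fun_prop
    refine hc.continuousAt.eventually ((h1.inter h2).mem_nhds ?_)
    simp only [zero_smul, sub_zero]
    exact ⟨⟨hv, h⟩, hav⟩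
  obtain ⟨t, ⟨⟨ht0, ht⟩, hta⟩, htp⟩ :=
    ((h3.filter_mono nhdsWithin_le_nhds).and (self_mem_nhdsWithin (s := Set.Ioi (0 : ℝ)))).exists
  obtain ⟨u, hu, huS, e⟩ := interior_subset ht
  obtain ⟨c, hc⟩ := (Projectivization.mk_eq_mk_iff' ℝ _ _ ht0 hu).1 e
  have h4 := (dot_pos ha huS).resolve_left hu
  have h5 := dot_nonneg hb huS
  have h6 : 0 < c := by
    rw [Set.mem_ofPred_eq, ← hc, dotProduct_smul] at hta
    exact pos_of_mul_pos_left hta h4.le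
  have h7 : b ⬝ᵥ (v - t • b) < 0 := by
    rw [dotProduct_sub, hbv, dotProduct_smul, zero_sub, neg_lt_zero]
    refine mul_pos htp ?_
    have h8 : 0 ≤ b ⬝ᵥ b := Finset.sum_nonneg fun i _ => mul_self_nonneg (b i)
    exact lt_of_le_of_ne h8 fun h => hb0 (dotProduct_self_eq_zero.1 h.symm)
  rw [← hc, dotProduct_smul] at h7
  have := mul_nonneg h6.le h5
  exact absurd h7 (not_lt.2 this)

/-- The region does not see the global sign, which is what permits the root to be chosen positive.
-/
theorem projCone_neg (S : Set (Fin 3 → ℝ)) : projCone (Neg.neg '' S) = projCone S := by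
  have key : ∀ S : Set (Fin 3 → ℝ), projCone S ⊆ projCone (Neg.neg '' S) := by
    rintro S _ ⟨v, hv, h, rfl⟩
    refine ⟨-v, neg_ne_zero.2 hv, ?_, ?_⟩
    · clear hv
      induction h using Submodule.span_induction with
      | mem x hx => exact Submodule.subset_span ⟨x, hx, rfl⟩
      | zero => simp
      | add x y _ _ hx hy => rw [neg_add]; exact add_mem hx hy
      | smul c x _ hx => rw [← smul_neg]; exact Submodule.smul_mem _ c hx
    · exact (Projectivization.mk_eq_mk_iff' ℝ _ _ _ _).2 ⟨-1, by simp⟩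
  refine Set.Subset.antisymm ?_ (key S)
  have := key (Neg.neg '' S)
  rwa [← Set.image_comp, neg_comp_neg, Set.image_id] at this

/-! ### Regions of polygon lists -/

namespace RAM

open Classical

/-- The vectors `w u` for `u < 2 * n` represent `n` distinct projective points in general position,
with both signs. -/
structure PointConfig (n : ℕ) (w : ℕ → Fin 3 → ℝ) : Prop extends Config n w where
  ne : ∀ u, w u ≠ 0
  inj : ∀ u v, u < 2 * n → v < 2 * n →
    Projectivization.mk ℝ (w u) (ne u) = Projectivization.mk ℝ (w v) (ne v) → u % n = v % n

/-- The projective point with number `u`. -/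
noncomputable def PointConfig.pt {n : ℕ} {w : ℕ → Fin 3 → ℝ} (hw : PointConfig n w) (u : ℕ) : RP2 :=
  Projectivization.mk ℝ (w u) (hw.ne u)

/-- The set of the projective points of a configuration. -/
noncomputable def PointConfig.points {n : ℕ} {w : ℕ → Fin 3 → ℝ} (hw : PointConfig n w) : Set RP2 :=
  hw.pt '' {u | u < 2 * n}

theorem PointConfig.pt_anti {n : ℕ} {w : ℕ → Fin 3 → ℝ} (hw : PointConfig n w) {u : ℕ}
    (hu : u < 2 * n) : hw.pt (RAM.anti n u) = hw.pt u :=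
  (Projectivization.mk_eq_mk_iff' ℝ _ _ _ _).2 ⟨-1, by simp [hw.anti hu]⟩

theorem PointConfig.pt_eq_iff {n : ℕ} {w : ℕ → Fin 3 → ℝ} (hw : PointConfig n w) {u v : ℕ}
    (hu : u < 2 * n) (hv : v < 2 * n) : hw.pt u = hw.pt v ↔ u % n = v % n := by
  refine ⟨hw.inj u v hu hv, fun h => ?_⟩
  rcases eq_or_eq_anti hu hv h with rfl | rfl
  · rfl
  · exact hw.pt_anti hv

theorem PointConfig.mem_hull_of_pt {n : ℕ} {w : ℕ → Fin 3 → ℝ} (hw : PointConfig n w) {u : ℕ}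
    (hu : u < 2 * n) {S : Set (Fin 3 → ℝ)} (h : hw.pt u ∈ projCone S) :
    w u ∈ PointedCone.hull ℝ S ∨ w (RAM.anti n u) ∈ PointedCone.hull ℝ S := by
  obtain ⟨v, hv, hvS, e⟩ := h
  obtain ⟨c, hc⟩ := (Projectivization.mk_eq_mk_iff' ℝ _ _ _ hv).1 e
  rcases le_total 0 c with h | h
  · exact Or.inl (hc ▸ PointedCone.smul_mem _ h hvS)
  · right
    rw [hw.anti hu, ← hc, ← neg_smul]
    exact PointedCone.smul_mem _ (by linarith) hvS

/-- The signs of the points of a cone are determined. -/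
theorem PointConfig.eq_of_hull {n : ℕ} {w : ℕ → Fin 3 → ℝ} (hw : PointConfig n w) {u v : ℕ}
    (hu : u < 2 * n) (hv : v < 2 * n) {S : Set (Fin 3 → ℝ)} {a : Fin 3 → ℝ}
    (ha : ∀ x ∈ S, 0 < a ⬝ᵥ x) (huS : w u ∈ PointedCone.hull ℝ S)
    (hvS : w v ∈ PointedCone.hull ℝ S) (h : u % n = v % n) : u = v := by
  rcases eq_or_eq_anti hu hv h with h | rfl
  · exact h
  · have h1 := (dot_pos ha huS).resolve_left (hw.ne _)
    have h2 := (dot_pos ha hvS).resolve_left (hw.ne _)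
    rw [hw.anti hv, dotProduct_neg] at h1
    linarith

/-- A point on the inner side of all edges of a polygon is in one of the triangles. -/
theorem mem_fan_of_edges {n : ℕ} {w : ℕ → Fin 3 → ℝ} {r x : ℕ} (hx : x < 2 * n) {y : ℕ}
    {T : List ℕ} (hT : ∀ q p, [q, p].IsInfix (y :: T ++ [r]) → ori w p q x)
    (h0 : ∀ u ∈ T, det3 (w r) (w u) (w x) ≠ 0) (hy : ori w y r x) :
    x ∈ fan n (ori w) r (y :: T ++ [r]) := by
  induction T generalizing y with
  | nil =>
    have := hT y r (List.infix_refl _)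
    unfold ori at this hy
    rw [det3_swap] at hy
    linarith
  | cons a T ih =>
    obtain ⟨c, X, e⟩ : ∃ c X, T ++ [r] = c :: X := by
      rcases T with _ | ⟨c, T⟩
      · exact ⟨r, [], rfl⟩
      · exact ⟨c, T ++ [r], rfl⟩
    have h1 : ori w a y x := hT y a ⟨[], T ++ [r], by simp⟩
    simp only [List.cons_append, e, fan, Finset.mem_union, Finset.mem_filter,
        Finset.mem_range] at ih ⊢
    rcases (h0 a List.mem_cons_self).lt_or_gt with h | h
    · left
      refine ih (fun q p hs => hT q p ?_) (fun u hu => h0 u (List.mem_cons_of_mem _ hu)) ?_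
      · simp only [List.cons_append, e]
        exact List.infix_cons hs
      · unfold ori
        rw [det3_swap]
        linarith
    · exact Or.inr ⟨hx, h, h1, hy⟩

theorem IsPoly.lt' {n : ℕ} {w : ℕ → Fin 3 → ℝ} {r : ℕ} {T : List ℕ} (hP : IsPoly n w r T) :
    ∀ u ∈ T ++ [r], u < 2 * n := by
  intro u hu
  have := hP.root
  rcases List.mem_append.1 hu with hu | hu
  · exact (hP.lt u hu).1
  · rw [List.mem_singleton.1 hu]
    omega

theorem IsPoly.ori_root {n : ℕ} {w : ℕ → Fin 3 → ℝ} {r : ℕ} {T : List ℕ} (hP : IsPoly n w r T)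
    {q p : ℕ} (h : [q, p].Sublist T) : ori w r p q :=
  hP.convex q p r (h.append (List.Sublist.refl [r]))

theorem IsPoly.pairwise {n : ℕ} {w : ℕ → Fin 3 → ℝ} (hw : Config n w) {r : ℕ} {T : List ℕ}
    (hP : IsPoly n w r T) : (T ++ [r]).Pairwise fun q p => q % n ≠ p % n := by
  rw [List.pairwise_append]
  refine ⟨List.pairwise_iff_forall_sublist.2 fun {q p} h => ?_, List.pairwise_singleton _ _,
    fun q hq p hp => ?_⟩
  · have hr := hP.root
    exact (hw.ne_of_ori (by omega) (hP.lt p (h.subset (by simp))).1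
      (hP.lt q (h.subset (by simp))).1 (hP.ori_root h)).2.2.symm
  · rw [List.mem_singleton.1 hp, Nat.mod_eq_of_lt hP.root]
    exact (hP.lt q hq).2.ne'

theorem IsPoly.nodup {n : ℕ} {w : ℕ → Fin 3 → ℝ} (hw : Config n w) {r : ℕ} {T : List ℕ}
    (hP : IsPoly n w r T) : (T ++ [r]).Nodup :=
  (hP.pairwise hw).imp fun h e => h (by rw [e])

theorem Convex.edge_nonneg {w : ℕ → Fin 3 → ℝ} {L : List ℕ} (h : Convex w L) {q p : ℕ}
    (hs : [q, p].IsInfix L) {x : ℕ} (hx : x ∈ L) : 0 ≤ det3 (w p) (w q) (w x) := by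
  obtain ⟨A, B, rfl⟩ := hs
  rcases List.mem_append.1 hx with hx | hx
  · rcases List.mem_append.1 hx with hx | hx
    · exact (h x q p (((List.singleton_sublist.2 hx).append (List.Sublist.refl [q, p])).trans
        (List.sublist_append_left _ _))).le
    · simp only [List.mem_cons, List.not_mem_nil, or_false] at hx
      rcases hx with rfl | rfl
      · rw [det3_self_right]
      · rw [det3_self_outer]
  · rw [← det3_cyc]
    refine (h q p x ?_).le
    rw [List.append_assoc]
    exact ((List.Sublist.refl [q, p]).append (List.singleton_sublist.2 hx)).trans
      (List.sublist_append_right _ _)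

theorem Convex.last_nonneg {w : ℕ → Fin 3 → ℝ} {y r : ℕ} {T : List ℕ}
    (h : Convex w (y :: T ++ [r])) {x : ℕ} (hx : x ∈ y :: T ++ [r]) :
    0 ≤ det3 (w y) (w r) (w x) := by
  rw [List.cons_append, List.mem_cons] at hx
  rcases hx with rfl | hx
  · rw [det3_self_outer]
  rcases List.mem_append.1 hx with hx | hx
  · rw [det3_cyc]
    refine (h y x r ?_).le
    exact ((List.singleton_sublist.2 hx).append (List.Sublist.refl [r])).cons_cons y
  · rw [List.mem_singleton.1 hx, det3_self_right]

/-- A polygon has at least three vertices. -/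
theorem IsPoly.exists_eq {n : ℕ} {w : ℕ → Fin 3 → ℝ} {r : ℕ} {T : List ℕ} (hP : IsPoly n w r T) :
    ∃ y a S, T = y :: a :: S := by
  have := hP.length
  match T, this with
  | y :: a :: S, _ => exact ⟨y, a, S, rfl⟩

theorem IsPoly.exists_eq' {n : ℕ} {w : ℕ → Fin 3 → ℝ} {r : ℕ} {T : List ℕ} (hP : IsPoly n w r T) :
    ∃ S c b, T = S ++ [c, b] := by
  have := hP.length
  rcases List.eq_nil_or_concat T with rfl | ⟨S, b, rfl⟩
  · simp at this
  rcases List.eq_nil_or_concat S with rfl | ⟨S, c, rfl⟩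
  · simp at this
  · exact ⟨S, c, b, by simp⟩

/-- Every edge form is nonnegative on all vertices and vanishes at its endpoints. Three consecutive
edges around `r` and `b` have no common zero among the vertices, so their sum is positive
everywhere. -/
theorem IsPoly.exists_pos {n : ℕ} {w : ℕ → Fin 3 → ℝ} {r : ℕ} {T : List ℕ}
    (hP : IsPoly n w r T) :
    ∃ a : Fin 3 → ℝ, a ≠ 0 ∧ ∀ v ∈ w '' {u | u ∈ T ++ [r]}, 0 < a ⬝ᵥ v := by
  obtain ⟨S, c, b, e⟩ := hP.exists_eq'
  obtain ⟨y, a, S', e'⟩ := hP.exists_eq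
  have hc := hP.convex
  have h1 : ∀ u ∈ T ++ [r], 0 ≤ det3 (w r) (w b) (w u) := fun u hu =>
    hc.edge_nonneg ⟨S ++ [c], [], by simp [e]⟩ hu
  have h2 : ∀ u ∈ T ++ [r], 0 ≤ det3 (w b) (w c) (w u) := fun u hu =>
    hc.edge_nonneg ⟨S, [r], by simp [e]⟩ hu
  have h3 : ∀ u ∈ T ++ [r], 0 ≤ det3 (w y) (w r) (w u) := fun u hu => by
    rw [e'] at hu hc
    exact hc.last_nonneg hu
  have key : ∀ u ∈ T ++ [r], 0 < ((w r) ⨯₃ (w b) + (w b) ⨯₃ (w c) + (w y) ⨯₃ (w r)) ⬝ᵥ w u := by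
    intro u hu
    rw [add_dotProduct, add_dotProduct, cross_dot_eq_det3, cross_dot_eq_det3, cross_dot_eq_det3]
    have k1 := h1 u hu
    have k2 := h2 u hu
    have k3 := h3 u hu
    have hu' := hu
    rw [e] at hu'
    simp only [List.append_assoc, List.mem_append, List.mem_cons, List.not_mem_nil, or_false] at hu'
    have hbr : [b, r].Sublist (T ++ [r]) := by
      rw [e]; simp
    rcases hu' with hu' | (rfl | rfl) | rfl
    · have : 0 < det3 (w r) (w b) (w u) := hc u b r (by
        rw [e, List.append_assoc]
        exact (List.singleton_sublist.2 hu').append (by simp : [b, r].Sublist ([c, b] ++ [r])))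
      linarith
    · have : 0 < det3 (w r) (w b) (w u) := hc u b r (by rw [e]; simp)
      linarith
    · have : 0 < det3 (w r) (w u) (w y) := hc y u r (by
        have h : ∃ Z, T = y :: (Z ++ [u]) := by
          rcases S with _ | ⟨s, S⟩
          · exact ⟨[], by rw [e'] at e ⊢; simp at e; simp [e]⟩
          · exact ⟨S ++ [c], by rw [e'] at e ⊢; simp at e; simp [e]⟩
        obtain ⟨Z, rfl⟩ := h
        simp)
      rw [det3_cyc (w r), det3_cyc (w u)] at this
      linarith
    · have : 0 < det3 (w u) (w b) (w c) := hc c b u (by rw [e]; simp)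
      rw [det3_cyc] at this
      linarith
  refine ⟨_, fun h => ?_, by rintro _ ⟨u, hu, rfl⟩; exact key u hu⟩
  have := key r (by simp)
  rw [h, zero_dotProduct] at this
  exact this.false

/-- An edge of the polygon at `u` supplies the supporting form; a third vertex shows that it is not
identically zero. -/
theorem IsPoly.notMem_interior {n : ℕ} {w : ℕ → Fin 3 → ℝ} (hw : PointConfig n w) {r : ℕ}
    {T : List ℕ} (hP : IsPoly n w r T) {u : ℕ} (hu : u ∈ T ++ [r]) :
    hw.pt u ∉ interior (projCone (w '' {u | u ∈ T ++ [r]})) := by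
  obtain ⟨a, -, ha⟩ := hP.exists_pos
  obtain ⟨e, he, x, hx⟩ : ∃ e, (∀ x ∈ T ++ [r], 0 ≤ det3 (w e) (w u) (w x)) ∧
      ∃ x, det3 (w e) (w u) (w x) ≠ 0 := by
    rcases List.mem_append.1 hu with hu | hu
    · obtain ⟨A, B, rfl⟩ := List.append_of_mem hu
      obtain ⟨e, X, eX⟩ : ∃ e X, B ++ [r] = e :: X := by
        rcases B with _ | ⟨e, B⟩
        · exact ⟨r, [], rfl⟩
        · exact ⟨e, B ++ [r], rfl⟩
      refine ⟨e, fun x hx => hP.convex.edge_nonneg ⟨A, X, by simp [eX]⟩ hx, ?_⟩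
      rcases A with _ | ⟨x, A⟩
      · rcases B with _ | ⟨e', B⟩
        · exact absurd hP.length (by simp)
        · obtain ⟨rfl, -⟩ := List.cons.inj eX
          refine ⟨r, ?_⟩
          have := hP.convex u e' r (by simp)
          unfold ori at this
          rw [← det3_cyc]
          exact this.ne'
      · have : ori w e u x := hP.convex x u e (by
          rw [List.append_assoc, List.cons_append (a := u), eX]
          simp)
        exact ⟨x, this.ne'⟩
    · rw [List.mem_singleton.1 hu]
      obtain ⟨y, b, S, rfl⟩ := hP.exists_eq
      refine ⟨y, fun x hx => hP.convex.last_nonneg hx, b, ?_⟩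
      have := hP.convex y b r (by simp)
      unfold ori at this
      rw [det3_cyc]
      exact this.ne'
  refine mk_notMem_interior ha (b := (w e) ⨯₃ (w u)) ?_ ?_ (ha _ ⟨u, hu, rfl⟩) ?_ (hw.ne u)
  · rintro _ ⟨x, hx, rfl⟩
    rw [cross_dot_eq_det3]
    exact he x hx
  · intro h
    rw [← cross_dot_eq_det3, h, zero_dotProduct] at hx
    exact hx rfl
  · rw [cross_dot_eq_det3, det3_self_right]

/-- Edge forms are nonnegative on the whole cone, and general position excludes zero at points that
are not vertices. So the point is strictly inside all edges and on none of the fan's diagonals. -/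
theorem IsPoly.mem_fan {n : ℕ} {w : ℕ → Fin 3 → ℝ} (hw : PointConfig n w) {r : ℕ}
    {T : List ℕ} (hP : IsPoly n w r T) {x : ℕ} (hx : x < 2 * n)
    (hxL : w x ∈ PointedCone.hull ℝ (w '' {u | u ∈ T ++ [r]}))
    (hne : ∀ u ∈ T ++ [r], u % n ≠ x % n) : x ∈ fan n (ori w) r (T ++ [r]) := by
  have key : ∀ p q, p % n ≠ q % n → p ∈ T ++ [r] → q ∈ T ++ [r] →
      (∀ u ∈ T ++ [r], 0 ≤ det3 (w p) (w q) (w u)) → ori w p q x := by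
    intro p q hpq hp hq h
    refine lt_of_le_of_ne ?_ (hw.gen p q x hpq (hne p hp) (hne q hq)).symm
    rw [← cross_dot_eq_det3]
    refine dot_nonneg ?_ hxL
    rintro _ ⟨u, hu, rfl⟩
    rw [cross_dot_eq_det3]
    exact h u hu
  have hpw := hP.pairwise hw.toConfig
  have hrm := Nat.mod_eq_of_lt hP.root
  have hmem : ∀ {u}, u ∈ T → u ∈ T ++ [r] := fun h => List.mem_append_left _ h
  have hroot : ∀ u ∈ T, r % n ≠ u % n := fun u hu => by
    rw [hrm]; exact (hP.lt u hu).2.ne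
  obtain ⟨y, a, S, rfl⟩ := hP.exists_eq
  refine mem_fan_of_edges hx (fun q p hs => ?_) (fun u hu => ?_) ?_
  · have hs' : [q, p].Sublist _ := hs.sublist
    exact key p q (List.pairwise_iff_forall_sublist.1 hpw hs').symm (hs'.subset (by simp))
      (hs'.subset (by simp)) fun u hu => hP.convex.edge_nonneg hs hu
  · have hu' : u ∈ y :: a :: S := List.mem_cons_of_mem _ hu
    exact hw.gen r u x (hroot u hu') (hne r (by simp)) (hne u (hmem hu'))
  · exact key y r (hroot y List.mem_cons_self).symm (hmem List.mem_cons_self) (by simp)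
      fun u hu => hP.convex.last_nonneg hu

theorem IsPoly.mem_interior {n : ℕ} {w : ℕ → Fin 3 → ℝ} (hw : PointConfig n w) {r : ℕ}
    {T : List ℕ} (hP : IsPoly n w r T) {x : ℕ} (hx : x ∈ fan n (ori w) r (T ++ [r])) :
    hw.pt x ∈ interior (projCone (w '' {u | u ∈ T ++ [r]})) ∧
      w x ∈ PointedCone.hull ℝ (w '' {u | u ∈ T ++ [r]}) := by
  obtain ⟨-, q, p, hs, h1, h2, h3⟩ := RAM.mem_fan hx
  have hv : ∀ u ∈ T ++ [r], w u ∈ PointedCone.hull ℝ (w '' {u | u ∈ T ++ [r]}) :=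
    fun u hu => Submodule.subset_span ⟨u, hu, rfl⟩
  have hq : q ∈ T ++ [r] := List.mem_append_left _ (hs.subset (by simp))
  have hp : p ∈ T ++ [r] := List.mem_append_left _ (hs.subset (by simp))
  have h := hP.ori_root hs
  exact ⟨mk_mem_interior h1 h2 h3 h (hv r (by simp)) (hv p hp) (hv q hq) _,
    mem_hull_of_det3 h1.le h2.le h3.le h (hv r (by simp)) (hv p hp) (hv q hq)⟩

/-- The cone over a polygon, as a projective set. -/
def region (w : ℕ → Fin 3 → ℝ) (L : List ℕ) : Set RP2 := projCone (w '' {u | u ∈ L})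

theorem IsPoly.pt_mem_region {n : ℕ} {w : ℕ → Fin 3 → ℝ} (hw : PointConfig n w) {L : List ℕ}
    {u : ℕ} (hu : u ∈ L) : hw.pt u ∈ region w L := mem_projCone _ ⟨u, hu, rfl⟩

/-- All these vectors lie in one pointed cone, which cannot contain a vector and its negative. -/
theorem IsPoly.injOn {n : ℕ} {w : ℕ → Fin 3 → ℝ} (hw : PointConfig n w) {r : ℕ} {T : List ℕ}
    (hP : IsPoly n w r T) :
    Set.InjOn hw.pt ((T ++ [r]).toFinset ∪ fan n (ori w) r (T ++ [r]) : Finset ℕ) := by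
  obtain ⟨a, -, ha⟩ := hP.exists_pos
  have key : ∀ u ∈ (T ++ [r]).toFinset ∪ fan n (ori w) r (T ++ [r]),
      u < 2 * n ∧ w u ∈ PointedCone.hull ℝ (w '' {u | u ∈ T ++ [r]}) := by
    intro u hu
    rcases Finset.mem_union.1 hu with hu | hu
    · exact ⟨hP.lt' u (List.mem_toFinset.1 hu),
        Submodule.subset_span ⟨u, List.mem_toFinset.1 hu, rfl⟩⟩
    · exact ⟨(RAM.mem_fan hu).1, (hP.mem_interior hw hu).2⟩
  intro u hu v hv e
  have hu := key u hu
  have hv := key v hv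
  exact hw.eq_of_hull hu.1 hv.1 ha hu.2 hv.2 ((hw.pt_eq_iff hu.1 hv.1).1 e)

/-- The points of the configuration in a polygon. -/
theorem IsPoly.points_inter {n : ℕ} {w : ℕ → Fin 3 → ℝ} (hw : PointConfig n w) {r : ℕ}
    {T : List ℕ} (hP : IsPoly n w r T) : hw.points ∩ region w (T ++ [r]) =
      hw.pt '' ((T ++ [r]).toFinset ∪ fan n (ori w) r (T ++ [r]) : Finset ℕ) := by
  ext z
  constructor
  · rintro ⟨⟨x, hx, rfl⟩, hz⟩
    obtain ⟨x', hx', e, hxm⟩ : ∃ x' < 2 * n, hw.pt x' = hw.pt x ∧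
        w x' ∈ PointedCone.hull ℝ (w '' {u | u ∈ T ++ [r]}) := by
      rcases hw.mem_hull_of_pt hx hz with h | h
      · exact ⟨x, hx, rfl, h⟩
      · exact ⟨_, anti_lt hw.pos x, hw.pt_anti hx, h⟩
    rw [← e]
    by_cases h : ∃ u ∈ T ++ [r], u % n = x' % n
    · obtain ⟨u, hu, h⟩ := h
      exact ⟨u, Finset.mem_union_left _ (List.mem_toFinset.2 hu),
        (hw.pt_eq_iff (hP.lt' u hu) hx').2 h⟩
    · push Not at h
      exact ⟨x', Finset.mem_union_right _ (hP.mem_fan hw hx' hxm h), rfl⟩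
  · rintro ⟨u, hu, rfl⟩
    rcases Finset.mem_union.1 hu with hu | hu
    · rw [List.mem_toFinset] at hu
      exact ⟨⟨u, hP.lt' u hu, rfl⟩, IsPoly.pt_mem_region hw hu⟩
    · exact ⟨⟨u, (RAM.mem_fan hu).1, rfl⟩, interior_subset (hP.mem_interior hw hu).1⟩

theorem IsPoly.disjoint_fan {n : ℕ} {w : ℕ → Fin 3 → ℝ} (hw : PointConfig n w) {r : ℕ}
    {T : List ℕ} (hP : IsPoly n w r T) :
    Disjoint (T ++ [r]).toFinset (fan n (ori w) r (T ++ [r])) := by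
  rw [Finset.disjoint_left]
  intro u hu hu'
  exact hP.notMem_interior hw (List.mem_toFinset.1 hu) (hP.mem_interior hw hu').1

theorem IsPoly.ncard_inter {n : ℕ} {w : ℕ → Fin 3 → ℝ} (hw : PointConfig n w) {r : ℕ}
    {T : List ℕ} (hP : IsPoly n w r T) : (hw.points ∩ region w (T ++ [r])).ncard =
      (T ++ [r]).length + (fan n (ori w) r (T ++ [r])).card := by
  rw [hP.points_inter hw, (hP.injOn hw).ncard_image, Set.ncard_coe_finset,
    Finset.card_union_of_disjoint (hP.disjoint_fan hw),
    List.toFinset_card_of_nodup (hP.nodup hw.toConfig)]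

theorem IsPoly.isProjHull {n : ℕ} {w : ℕ → Fin 3 → ℝ} (hw : PointConfig n w) {r : ℕ}
    {T : List ℕ} (hP : IsPoly n w r T) {I : Set RP2} (h1 : ∀ u ∈ T ++ [r], hw.pt u ∈ I)
    (h2 : I ⊆ region w (T ++ [r])) : IsProjHull I (region w (T ++ [r])) := by
  obtain ⟨a, ha0, ha⟩ := hP.exists_pos
  refine isProjHull_projCone ha0 ha ?_ h2
  rintro _ ⟨u, hu, rfl⟩ hv
  exact h1 u hu

theorem IsPoly.isProjGon {n : ℕ} {w : ℕ → Fin 3 → ℝ} (hw : PointConfig n w) {r : ℕ}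
    {T : List ℕ} (hP : IsPoly n w r T) :
    IsProjGon hw.points (T ++ [r]).length (region w (T ++ [r])) := by
  have hsub : hw.pt '' {u | u ∈ T ++ [r]} ⊆ region w (T ++ [r]) := by
    rintro _ ⟨u, hu, rfl⟩
    exact IsPoly.pt_mem_region hw hu
  refine ⟨hw.pt '' {u | u ∈ T ++ [r]}, ?_, ?_, hP.isProjHull hw (fun u hu => ⟨u, hu, rfl⟩) hsub,
    ?_⟩
  · rintro _ ⟨u, hu, rfl⟩
    exact ⟨u, hP.lt' u hu, rfl⟩
  · rw [show {u | u ∈ T ++ [r]} = ((T ++ [r]).toFinset : Set ℕ) by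
      ext; exact List.mem_toFinset.symm,
      Set.InjOn.ncard_image, Set.ncard_coe_finset,
      List.toFinset_card_of_nodup (hP.nodup hw.toConfig)]
    exact (hP.injOn hw).mono fun u hu => Finset.mem_union_left _ hu
  · rintro z hz
    refine ⟨subset_closure (hsub hz), ?_⟩
    obtain ⟨u, hu, rfl⟩ := hz
    exact hP.notMem_interior hw hu

theorem IsPoly.disjoint_interior_iff {n : ℕ} {w : ℕ → Fin 3 → ℝ} (hw : PointConfig n w) {r : ℕ}
    {T : List ℕ} (hP : IsPoly n w r T) :
    Disjoint (interior (region w (T ++ [r]))) hw.points ↔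
      (fan n (ori w) r (T ++ [r])).card = 0 := by
  rw [Finset.card_eq_zero, Finset.eq_empty_iff_forall_notMem, Set.disjoint_left]
  constructor
  · intro h x hx
    exact h (hP.mem_interior hw hx).1 ⟨x, (RAM.mem_fan hx).1, rfl⟩
  · intro h z hz hzP
    have hz' : z ∈ hw.points ∩ region w (T ++ [r]) := ⟨hzP, interior_subset hz⟩
    rw [hP.points_inter hw] at hz'
    obtain ⟨u, hu, rfl⟩ := hz'
    rcases Finset.mem_union.1 hu with hu | hu
    · exact hP.notMem_interior hw (List.mem_toFinset.1 hu) hz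
    · exact h u hu

/-- An island must contain every input point of its region, so `I` is forced to be this
intersection, whose size is the number of vertices plus the fan count. -/
theorem IsPoly.isProjIsland_iff {n : ℕ} {w : ℕ → Fin 3 → ℝ} (hw : PointConfig n w) {r : ℕ}
    {T : List ℕ} (hP : IsPoly n w r T) {k : ℕ} :
    IsProjIsland hw.points k (region w (T ++ [r])) ↔
      (T ++ [r]).length + (fan n (ori w) r (T ++ [r])).card = k := by
  rw [← hP.ncard_inter hw]
  constructor
  · rintro ⟨I, hI, rfl, hH, hd⟩
    congr 1
    refine Set.Subset.antisymm (fun z hz => ?_) fun z hz => ⟨hI hz, hH.1.2 hz⟩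
    by_contra hzI
    exact Set.disjoint_left.1 hd hz.2 ⟨hz.1, hzI⟩
  · rintro h
    refine ⟨hw.points ∩ region w (T ++ [r]), Set.inter_subset_left, h, hP.isProjHull hw
      (fun u hu => ⟨⟨u, hP.lt' u hu, rfl⟩, IsPoly.pt_mem_region hw hu⟩) Set.inter_subset_right, ?_⟩
    rw [Set.disjoint_left]
    exact fun z hz hz' => hz'.2 ⟨hz'.1, hz⟩

/-- The region alone determines the vertices as projective points: they are the input points in it
that are not interior, whereas fan points are interior. -/
theorem IsPoly.exists_mod_eq {n : ℕ} {w : ℕ → Fin 3 → ℝ} (hw : PointConfig n w) {r r' : ℕ}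
    {T T' : List ℕ} (hP : IsPoly n w r T) (hP' : IsPoly n w r' T')
    (h : region w (T ++ [r]) = region w (T' ++ [r'])) {u : ℕ} (hu : u ∈ T ++ [r]) :
    ∃ v ∈ T' ++ [r'], u % n = v % n := by
  have hu' : hw.pt u ∈ hw.points ∩ region w (T' ++ [r']) :=
    ⟨⟨u, hP.lt' u hu, rfl⟩, h ▸ IsPoly.pt_mem_region hw hu⟩
  rw [hP'.points_inter hw] at hu'
  obtain ⟨v, hv, e⟩ := hu'
  rcases Finset.mem_union.1 hv with hv | hv
  · rw [List.mem_toFinset] at hv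
    exact ⟨v, hv, ((hw.pt_eq_iff (hP'.lt' v hv) (hP.lt' u hu)).1 e).symm⟩
  · refine absurd (hP'.mem_interior hw hv).1 ?_
    rw [e]
    have := hP.notMem_interior hw hu
    rwa [← region, h] at this

theorem IsPoly.root_le {n : ℕ} {w : ℕ → Fin 3 → ℝ} (hw : PointConfig n w) {r r' : ℕ}
    {T T' : List ℕ} (hP : IsPoly n w r T) (hP' : IsPoly n w r' T')
    (h : region w (T ++ [r]) = region w (T' ++ [r'])) : r' ≤ r := by
  obtain ⟨v, hv, e⟩ := hP.exists_mod_eq hw hP' h (u := r) (by simp)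
  rw [Nat.mod_eq_of_lt hP.root] at e
  rcases List.mem_append.1 hv with hv | hv
  · rw [e]
    exact (hP'.lt v hv).2.le
  · rw [e, List.mem_singleton.1 hv, Nat.mod_eq_of_lt hP'.root]

/-- Signs agree because both lists contain `r` with positive sign: a vertex with the opposite sign
would make the common region meet the line `a = 0`. -/
theorem IsPoly.subset_of_region {n : ℕ} {w : ℕ → Fin 3 → ℝ} (hw : PointConfig n w) {r : ℕ}
    {T T' : List ℕ} (hP : IsPoly n w r T) (hP' : IsPoly n w r T')
    (h : region w (T ++ [r]) = region w (T' ++ [r])) {u : ℕ} (hu : u ∈ T ++ [r]) :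
    u ∈ T' ++ [r] := by
  obtain ⟨a, ha0, ha⟩ := hP.exists_pos
  have hnz : ∀ v hv, Projectivization.mk ℝ v hv ∈ region w (T' ++ [r]) → a ⬝ᵥ v ≠ 0 := by
    rw [← h]
    rintro v hv ⟨x, hx, hxS, e⟩
    obtain ⟨c, rfl⟩ := (Projectivization.mk_eq_mk_iff' ℝ _ _ hv hx).1 e
    rw [dotProduct_smul]
    exact smul_ne_zero (left_ne_zero_of_smul hv) ((dot_pos ha hxS).resolve_left hx).ne'
  have har : 0 < a ⬝ᵥ w r := ha _ ⟨r, by simp, rfl⟩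
  have hsign : ∀ v ∈ T' ++ [r], 0 ≤ a ⬝ᵥ w v := by
    intro v hv
    by_contra hneg
    push Not at hneg
    -- This is the combination with nonnegative coefficients on which `a` vanishes; it is nonzero
    -- since `v` and `r` are different projective points.
    have h0 : (-(a ⬝ᵥ w v)) • w r + (a ⬝ᵥ w r) • w v ≠ 0 := by
      intro h0
      have h1 : w v = ((a ⬝ᵥ w r)⁻¹ * (a ⬝ᵥ w v)) • w r := by
        rw [← smul_smul, ← sub_eq_zero]
        have : w v - (a ⬝ᵥ w r)⁻¹ • (a ⬝ᵥ w v) • w r =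
            (a ⬝ᵥ w r)⁻¹ • ((-(a ⬝ᵥ w v)) • w r + (a ⬝ᵥ w r) • w v) := by
          rw [smul_add, smul_smul _ (a ⬝ᵥ w r), inv_mul_cancel₀ har.ne', one_smul]
          module
        rw [this, h0, smul_zero]
      have h2 : hw.pt v = hw.pt r := (Projectivization.mk_eq_mk_iff' ℝ _ _ _ _).2 ⟨_, h1.symm⟩
      rw [hw.pt_eq_iff (hP'.lt' v hv) (hP'.lt' r (by simp)), Nat.mod_eq_of_lt hP.root] at h2
      rcases List.mem_append.1 hv with hv | hv
      · exact (hP'.lt v hv).2.ne' h2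
      · rw [List.mem_singleton.1 hv] at hneg
        linarith
    refine hnz _ h0 ⟨_, h0, add_mem (PointedCone.smul_mem _ (by linarith)
      (Submodule.subset_span ⟨r, by simp, rfl⟩)) (PointedCone.smul_mem _ har.le
      (Submodule.subset_span ⟨v, hv, rfl⟩)), rfl⟩ ?_
    rw [dotProduct_add, dotProduct_smul, dotProduct_smul, smul_eq_mul, smul_eq_mul]
    ring
  obtain ⟨v, hv, e⟩ := hP.exists_mod_eq hw hP' h hu
  rcases eq_or_eq_anti (hP'.lt' v hv) (hP.lt' u hu) e.symm with rfl | rfl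
  · exact hv
  · exfalso
    have h1 := hsign _ hv
    rw [hw.anti (hP.lt' u hu), dotProduct_neg] at h1
    have := ha _ ⟨u, hu, rfl⟩
    linarith

/-- A polygon is determined by its region. -/
theorem IsPoly.eq_of_region {n : ℕ} {w : ℕ → Fin 3 → ℝ} (hw : PointConfig n w) {r r' : ℕ}
    {T T' : List ℕ} (hP : IsPoly n w r T) (hP' : IsPoly n w r' T')
    (h : region w (T ++ [r]) = region w (T' ++ [r'])) : T ++ [r] = T' ++ [r'] := by
  obtain rfl : r = r' := (hP'.root_le hw hP h.symm).antisymm (hP.root_le hw hP' h)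
  have hperm : (T ++ [r]).Perm (T' ++ [r]) :=
    (List.perm_ext_iff_of_nodup (hP.nodup hw.toConfig) (hP'.nodup hw.toConfig)).2 fun u =>
      ⟨hP.subset_of_region hw hP' h, hP'.subset_of_region hw hP h.symm⟩
  -- Both lists are sorted by angle around `r`, so as permutations of each other they coincide.
  rw [((List.perm_append_right_iff [r]).1 hperm).eq_of_pairwise
    (le := fun q p => ori w r p q) (fun q p _ _ h1 h2 => ?_)
    (List.pairwise_iff_forall_sublist.2 fun hs => hP.ori_root hs)
    (List.pairwise_iff_forall_sublist.2 fun hs => hP'.ori_root hs)]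
  unfold ori at h1 h2
  rw [det3_swap_right] at h1
  linarith

/-! ### Every gon and every island is the region of a polygon list -/

/-- A finite set with a transitive total relation can be sorted. -/
theorem exists_pairwise_list {α : Type*} (R : α → α → Prop) (s : Finset α)
    (htot : ∀ x ∈ s, ∀ y ∈ s, x ≠ y → R x y ∨ R y x)
    (htr : ∀ x ∈ s, ∀ y ∈ s, ∀ z ∈ s, R x y → R y z → R x z) :
    ∃ L : List α, (∀ x, x ∈ L ↔ x ∈ s) ∧ L.Pairwise R := by
  induction s using Finset.induction_on with
  | empty => exact ⟨[], by simp, .nil⟩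
  | insert a s ha ih =>
    obtain ⟨L, hL, hR⟩ := ih
      (fun x hx y hy => htot x (Finset.mem_insert_of_mem hx) y (Finset.mem_insert_of_mem hy))
      (fun x hx y hy z hz => htr x (Finset.mem_insert_of_mem hx) y (Finset.mem_insert_of_mem hy) z
        (Finset.mem_insert_of_mem hz))
    have h1 : ∀ x ∈ L.filter (fun x => ¬ R x a), R a x := by
      intro x hx
      simp only [List.mem_filter, decide_eq_true_eq] at hx
      have hxs := (hL x).1 hx.1
      refine (htot x (Finset.mem_insert_of_mem hxs) a (Finset.mem_insert_self a s) ?_).resolve_left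
        hx.2
      rintro rfl
      exact ha hxs
    refine ⟨L.filter (fun x => R x a) ++ a :: L.filter (fun x => ¬ R x a), fun x => ?_, ?_⟩
    · simp only [List.mem_append, List.mem_filter, List.mem_cons, decide_eq_true_eq, hL,
        Finset.mem_insert]
      tauto
    · rw [List.pairwise_append, List.pairwise_cons]
      refine ⟨hR.filter _, ⟨h1, hR.filter _⟩, fun x hx y hy => ?_⟩
      simp only [List.mem_filter, decide_eq_true_eq] at hx
      rcases List.mem_cons.1 hy with rfl | hy
      · exact hx.2
      · have hy' := (List.mem_filter.1 hy).1
        exact htr x (Finset.mem_insert_of_mem ((hL x).1 hx.1)) a (Finset.mem_insert_self a s) y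
          (Finset.mem_insert_of_mem ((hL y).1 hy')) hx.2 (h1 y hy)

/-- No point is in the interior of a triangle formed by the others. -/
def Independent (w : ℕ → Fin 3 → ℝ) (W : Finset ℕ) : Prop :=
  ∀ x ∈ W, ∀ y ∈ W, ∀ z ∈ W, ∀ p ∈ W, ori w x y p → ori w y z p → ¬ ori w z x p

theorem PointConfig.eq_of_mod {n : ℕ} {w : ℕ → Fin 3 → ℝ} (hw : PointConfig n w) {W : Finset ℕ}
    (hW : ∀ u ∈ W, u < 2 * n) {a : Fin 3 → ℝ} (ha : ∀ u ∈ W, 0 < a ⬝ᵥ w u) {u v : ℕ}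
    (hu : u ∈ W) (hv : v ∈ W) (h : u % n = v % n) : u = v :=
  hw.eq_of_hull (hW u hu) (hW v hv) (S := w '' W) (a := a)
    (by rintro _ ⟨u, hu, rfl⟩; exact ha u hu) (Submodule.subset_span ⟨u, hu, rfl⟩)
    (Submodule.subset_span ⟨v, hv, rfl⟩) h

/-- Sort the remaining points by angle around `r`. Independence is used twice: with `r` as the inner
point it makes the angular relation transitive, and with `q` as the inner point it excludes right
turns. -/
theorem exists_isPoly_of_root {n : ℕ} {w : ℕ → Fin 3 → ℝ} (hw : PointConfig n w) {W : Finset ℕ}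
    (hW : ∀ u ∈ W, u < 2 * n) {a : Fin 3 → ℝ} (ha : ∀ u ∈ W, 0 < a ⬝ᵥ w u) (h3 : 3 ≤ W.card)
    (hi : Independent w W) {r : ℕ} (hr : r ∈ W) (hrn : r < n)
    (hmin : ∀ u ∈ W, r ≤ u % n) :
    ∃ T, IsPoly n w r T ∧ (T ++ [r]).length = W.card ∧ ∀ u, u ∈ T ++ [r] ↔ u ∈ W := by
  have hne : ∀ {u v}, u ∈ W → v ∈ W → u ≠ v → u % n ≠ v % n := fun hu hv h e =>
    h (hw.eq_of_mod hW ha hu hv e)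
  have hmem : ∀ {u}, u ∈ W.erase r ↔ u ≠ r ∧ u ∈ W := Finset.mem_erase
  obtain ⟨T, hT, hR⟩ := exists_pairwise_list (fun q p => ori w r p q) (W.erase r)
    (fun x hx y hy hxy => by
      rw [hmem] at hx hy
      exact (hw.ori_total (hne hr hx.2 hx.1.symm) (hne hr hy.2 hy.1.symm)
        (hne hx.2 hy.2 hxy)).symm)
    (fun x hx y hy z hz h1 h2 => by
      rw [hmem] at hx hy hz
      by_contra h
      have hxz : x ≠ z := by
        rintro rfl
        unfold ori at h1 h2
        rw [det3_swap_right] at h1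
        linarith
      have h := (hw.ori_total (hne hr hz.2 hz.1.symm) (hne hr hx.2 hx.1.symm)
        (hne hz.2 hx.2 hxz.symm)).resolve_left h
      -- A cyclic triple in the angular relation would put `r` inside the triangle `x z y`.
      refine hi x hx.2 z hz.2 y hy.2 r hr ?_ ?_ ?_
      · unfold ori; rw [← det3_cyc]; exact h
      · unfold ori; rw [← det3_cyc]; exact h2
      · unfold ori; rw [← det3_cyc]; exact h1)
  have hall : ∀ u, u ∈ T ++ [r] ↔ u ∈ W := by
    intro u
    rw [List.mem_append, hT, hmem, List.mem_singleton]
    by_cases h : u = r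
    · simp [h, hr]
    · simp [h]
  have hlen : T.length = W.card - 1 := by
    rw [← Finset.card_erase_of_mem hr, ← List.toFinset_card_of_nodup]
    · congr 1
      ext u
      rw [List.mem_toFinset, hT]
    · refine hR.imp fun h e => ?_
      unfold ori at h
      rw [e, det3_self_right] at h
      exact h.false
  refine ⟨T, ⟨hrn, fun u hu => ?_, by omega, fun s q p hs => ?_⟩, ?_, hall⟩
  · have := hmem.1 ((hT u).1 hu)
    refine ⟨hW u this.2, lt_of_le_of_ne (hmin u this.2) ?_⟩
    have := hne hr this.2 this.1.symm
    rwa [Nat.mod_eq_of_lt hrn] at this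
  · by_cases hpr : p = r
    · subst hpr
      obtain ⟨l₁, l₂, e, hs₁, hs₂⟩ := List.sublist_append_iff.1 hs
      rcases List.sublist_singleton.1 hs₂ with rfl | rfl
      · rw [List.append_nil] at e
        subst e
        exact absurd ((hT p).1 (hs₁.subset (by simp))) (by simp)
      · have : l₁ = [s, q] :=
          (List.append_inj_left' (show [s, q] ++ [p] = l₁ ++ [p] from e) rfl).symm
        subst this
        exact List.pairwise_iff_forall_sublist.1 hR hs₁
    · have hs : [s, q, p].Sublist T := sublist_of_concat (l := [s, q]) hs hpr
      have hR' : ∀ {u v}, [u, v].Sublist T → ori w r v u := fun h =>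
        List.pairwise_iff_forall_sublist.1 hR h
      have h1 := hR' ((by simp : [s, q].Sublist [s, q, p]).trans hs)
      have h2 := hR' ((by simp : [q, p].Sublist [s, q, p]).trans hs)
      have h3 := hR' ((by simp : [s, p].Sublist [s, q, p]).trans hs)
      have hsW := (hmem.1 ((hT s).1 (hs.subset (by simp)))).2
      have hqW := (hmem.1 ((hT q).1 (hs.subset (by simp)))).2
      have hpW := (hmem.1 ((hT p).1 (hs.subset (by simp)))).2
      have hrn2 : r < 2 * n := by omega
      have e1 := (hw.ne_of_ori hrn2 (hW _ hqW) (hW _ hsW) h1).2.2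
      have e2 := (hw.ne_of_ori hrn2 (hW _ hpW) (hW _ hqW) h2).2.2
      have e3 := (hw.ne_of_ori hrn2 (hW _ hpW) (hW _ hsW) h3).2.2
      rcases (hw.gen p q s e2 e3 e1).lt_or_gt with h | h
      · exfalso
        -- A right turn at `q` would put it inside the triangle `p s r`.
        refine hi p hpW s hsW r hr q hqW ?_ ?_ h2
        · unfold ori
          rw [det3_swap_right]
          linarith
        · unfold ori
          rw [det3_cyc]
          exact h1
      · exact h
  · rw [List.length_append, hlen, List.length_singleton]
    omega

theorem exists_isPoly {n : ℕ} {w : ℕ → Fin 3 → ℝ} (hw : PointConfig n w) {W : Finset ℕ}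
    (hW : ∀ u ∈ W, u < 2 * n) {a : Fin 3 → ℝ} (ha : ∀ u ∈ W, 0 < a ⬝ᵥ w u) (h3 : 3 ≤ W.card)
    (hi : Independent w W) :
    ∃ r T, IsPoly n w r T ∧ (T ++ [r]).length = W.card ∧
      projCone (w '' W) = region w (T ++ [r]) := by
  obtain ⟨r, hr, hmin⟩ := Finset.exists_min_image W (· % n) (Finset.card_pos.1 (by omega))
  by_cases hrn : r < n
  · obtain ⟨T, hP, hl, hT⟩ := exists_isPoly_of_root hw hW ha h3 hi hr hrn fun u hu => by
      rw [← Nat.mod_eq_of_lt hrn]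
      exact hmin u hu
    refine ⟨r, T, hP, hl, ?_⟩
    rw [region]
    congr 2
    ext u
    exact (hT u).symm
  -- The vertex of least index carries the negative sign, so all points are replaced by their
  -- antipodes. This reverses orientations, which is why triangle vertices are exchanged when
  -- independence is transferred.
  · have hrW := hW r hr
    have hanti : ∀ u ∈ W, w (anti n u) = -w u := fun u hu => hw.anti (hW u hu)
    have hinj : Set.InjOn (anti n) (W : Set ℕ) := fun u hu v hv h => by
      rw [← anti_anti (hW u hu), h, anti_anti (hW v hv)]
    have hr' : anti n r = r - n := by
      rw [anti_eq hrW, if_neg hrn]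
    have hi' : Independent w (W.image (anti n)) := by
      intro x hx y hy z hz p hp h1 h2 h3
      obtain ⟨x, kx, rfl⟩ := Finset.mem_image.1 hx
      obtain ⟨y, ky, rfl⟩ := Finset.mem_image.1 hy
      obtain ⟨z, kz, rfl⟩ := Finset.mem_image.1 hz
      obtain ⟨p, kp, rfl⟩ := Finset.mem_image.1 hp
      unfold ori at h1 h2 h3
      rw [hanti _ kx, hanti _ ky, hanti _ kp, det3_neg_left, det3_neg_mid, det3_neg_right, neg_neg,
        ← det3_swap] at h1
      rw [hanti _ ky, hanti _ kz, hanti _ kp, det3_neg_left, det3_neg_mid, det3_neg_right, neg_neg,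
        ← det3_swap] at h2
      rw [hanti _ kx, hanti _ kz, hanti _ kp, det3_neg_left, det3_neg_mid, det3_neg_right, neg_neg,
        ← det3_swap] at h3
      exact hi y ky x kx z kz p kp h1 h3 h2
    obtain ⟨T, hP, hl, hT⟩ := exists_isPoly_of_root hw (W := W.image (anti n)) (a := -a)
      (Finset.forall_mem_image.2 fun v _ => anti_lt hw.pos v)
      (Finset.forall_mem_image.2 fun v hv => by
        rw [hanti v hv, neg_dotProduct_neg]
        exact ha v hv)
      (by rw [Finset.card_image_of_injOn hinj]; exact h3) hi'
      (Finset.mem_image_of_mem _ hr) (by omega)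
      (Finset.forall_mem_image.2 fun v hv => by
        rw [anti_mod (hW v hv), hr']
        have := hmin v hv
        rw [mod_eq hrW, if_neg hrn] at this
        exact this)
    refine ⟨_, T, hP, by rw [hl, Finset.card_image_of_injOn hinj], ?_⟩
    rw [region, ← projCone_neg]
    congr 1
    ext v
    constructor
    · rintro ⟨_, ⟨u, hu, rfl⟩, rfl⟩
      exact ⟨anti n u, (hT _).2 (Finset.mem_image_of_mem _ hu), hanti u hu⟩
    · rintro ⟨u, hu, rfl⟩
      obtain ⟨v, hv, rfl⟩ := Finset.mem_image.1 ((hT u).1 hu)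
      exact ⟨_, ⟨v, hv, rfl⟩, (hanti v hv).symm⟩

/-- A line missed by the hull selects one sign for each point of `I`, namely the one on which its
form is positive. -/
theorem exists_signs {n : ℕ} {w : ℕ → Fin 3 → ℝ} (hw : PointConfig n w) {I G : Set RP2}
    (hI : I ⊆ hw.points) (hG : IsProjHull I G) :
    ∃ (W : Finset ℕ) (a : Fin 3 → ℝ), (∀ u ∈ W, u < 2 * n) ∧ (∀ u ∈ W, 0 < a ⬝ᵥ w u) ∧
      W.card = I.ncard ∧ (∀ u ∈ W, hw.pt u ∈ I) ∧ G = projCone (w '' W) := by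
  obtain ⟨a, ha0, ha, hS⟩ := hG.eq_projCone
  have hW : ∀ u, u ∈ (Finset.range (2 * n)).filter (fun u => hw.pt u ∈ I ∧ 0 < a ⬝ᵥ w u) ↔
      u < 2 * n ∧ hw.pt u ∈ I ∧ 0 < a ⬝ᵥ w u := by
    intro u
    rw [Finset.mem_filter, Finset.mem_range]
  set W := (Finset.range (2 * n)).filter (fun u => hw.pt u ∈ I ∧ 0 < a ⬝ᵥ w u)
  have hIW : ∀ z ∈ I, ∃ u ∈ W, hw.pt u = z := by
    intro z hz
    obtain ⟨u, hu, rfl⟩ := hI hz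
    rcases (ha _ _ (hG.1.2 hz)).lt_or_gt with h | h
    · refine ⟨anti n u, (hW _).2 ⟨anti_lt hw.pos u, ?_, ?_⟩, hw.pt_anti hu⟩
      · rw [hw.pt_anti hu]; exact hz
      · rw [hw.anti hu, dotProduct_neg]; linarith
    · exact ⟨u, (hW u).2 ⟨hu, hz, h⟩, rfl⟩
  have hWlt : ∀ u ∈ W, u < 2 * n := fun u hu => ((hW u).1 hu).1
  have hWa : ∀ u ∈ W, 0 < a ⬝ᵥ w u := fun u hu => ((hW u).1 hu).2.2
  refine ⟨W, a, hWlt, hWa, ?_, fun u hu => ((hW u).1 hu).2.1, hS _ ?_ ?_ ?_⟩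
  · have : I = hw.pt '' (W : Set ℕ) := by
      ext z
      exact ⟨hIW z, by rintro ⟨u, hu, rfl⟩; exact ((hW u).1 hu).2.1⟩
    rw [this, Set.InjOn.ncard_image, Set.ncard_coe_finset]
    intro u hu v hv h
    exact hw.eq_of_mod hWlt hWa hu hv ((hw.pt_eq_iff (hWlt u hu) (hWlt v hv)).1 h)
  · rintro _ ⟨u, hu, rfl⟩
    exact hWa u hu
  · rintro _ ⟨u, hu, rfl⟩ hv
    exact ((hW u).1 hu).2.1
  · intro z hz
    obtain ⟨u, hu, rfl⟩ := hIW z hz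
    exact ⟨w u, ⟨u, hu, rfl⟩, hw.ne u, rfl⟩

/-- Apply `a` to Cramer's relation: the right side is positive, and so is `a ⬝ᵥ p`. -/
theorem det3_pos_of_dot {a x y z p : Fin 3 → ℝ} (hx : 0 < a ⬝ᵥ x) (hy : 0 < a ⬝ᵥ y)
    (hz : 0 < a ⬝ᵥ z) (hp : 0 < a ⬝ᵥ p) (h1 : 0 < det3 x y p) (h2 : 0 < det3 y z p)
    (h3 : 0 < det3 z x p) : 0 < det3 x y z := by
  have h := congrArg (a ⬝ᵥ ·) (det3_cramer x y z p)
  simp only [dotProduct_add, dotProduct_smul, smul_eq_mul] at h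
  exact pos_of_mul_pos_left (h ▸ by positivity) hp.le

/-- The boundary condition gives independence, since a point in an open triangle is interior to the
hull. So all `k` points become vertices. -/
theorem IsProjGon.exists_isPoly {n : ℕ} {w : ℕ → Fin 3 → ℝ} (hw : PointConfig n w) {k : ℕ}
    (hk : 3 ≤ k) {G : Set RP2} (hG : IsProjGon hw.points k G) :
    ∃ r T, IsPoly n w r T ∧ (T ++ [r]).length = k ∧ G = region w (T ++ [r]) := by
  obtain ⟨I, hI, rfl, hH, hf⟩ := hG
  obtain ⟨W, a, hW, ha, hc, hWI, rfl⟩ := exists_signs hw hI hH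
  rw [← hc] at hk ⊢
  refine RAM.exists_isPoly hw hW ha hk fun x hx y hy z hz p hp h1 h2 h3 => ?_
  have hS : ∀ u ∈ W, w u ∈ PointedCone.hull ℝ (w '' W) := fun u hu =>
    Submodule.subset_span ⟨u, hu, rfl⟩
  exact (hf (hWI p hp)).2 (mk_mem_interior h1 h2 h3
    (det3_pos_of_dot (ha x hx) (ha y hy) (ha z hz) (ha p hp) h1 h2 h3) (hS x hx) (hS y hy)
    (hS z hz) (hw.ne p))

/-- Every cone over at least three points is spanned by an independent subset. -/
theorem exists_independent {n : ℕ} {w : ℕ → Fin 3 → ℝ} (hw : PointConfig n w) {W : Finset ℕ}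
    (hW : ∀ u ∈ W, u < 2 * n) {a : Fin 3 → ℝ} (ha : ∀ u ∈ W, 0 < a ⬝ᵥ w u) (h3 : 3 ≤ W.card) :
    ∃ J ⊆ W, 3 ≤ J.card ∧ Independent w J ∧ projCone (w '' J) = projCone (w '' W) := by
  -- A generating subset of least cardinality plays the role of the extreme rays.
  obtain ⟨J, hJ, hmin⟩ := Finset.exists_min_image
    (W.powerset.filter fun J : Finset ℕ =>
      PointedCone.hull ℝ (w '' W) ≤ PointedCone.hull ℝ (w '' (J : Set ℕ)))
    Finset.card ⟨W, by simp⟩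
  rw [Finset.mem_filter, Finset.mem_powerset] at hJ
  obtain ⟨hJW, hJh⟩ := hJ
  have hS : ∀ u ∈ W, w u ∈ PointedCone.hull ℝ (w '' W) := fun u hu =>
    Submodule.subset_span ⟨u, hu, rfl⟩
  refine ⟨J, hJW, ?_, fun x hx y hy z hz p hp h1 h2 h3 => ?_, ?_⟩
  -- Two vectors span only a plane, and by general position a third point of `W` lies off it.
  · by_contra hJ3
    obtain ⟨J', hJJ', hJ'W, hJ'⟩ := Finset.exists_subsuperset_card_eq hJW (show J.card ≤ 2 by omega)
      (show 2 ≤ W.card by omega)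
    obtain ⟨x, y, hxy, rfl⟩ := Finset.card_eq_two.1 hJ'
    obtain ⟨u, hu, huJ⟩ := Finset.exists_mem_notMem_of_card_lt_card
      (show ({x, y} : Finset ℕ).card < W.card by omega)
    simp only [Finset.mem_insert, Finset.mem_singleton, not_or] at huJ
    have hxW : x ∈ W := hJ'W (by simp)
    have hyW : y ∈ W := hJ'W (by simp)
    have key : ∀ b : Fin 3 → ℝ, (∀ v ∈ J, 0 ≤ b ⬝ᵥ w v) → 0 ≤ b ⬝ᵥ w u := fun b hb =>
      dot_nonneg (by rintro _ ⟨v, hv, rfl⟩; exact hb v hv) (hJh (hS u hu))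
    have hz : ∀ v ∈ J, det3 (w x) (w y) (w v) = 0 := by
      intro v hv
      have := hJJ' hv
      simp only [Finset.mem_insert, Finset.mem_singleton] at this
      rcases this with rfl | rfl
      · exact det3_self_outer _ _
      · exact det3_self_right _ _
    have k1 := key (w x ⨯₃ w y) fun v hv => by rw [cross_dot_eq_det3, hz v hv]
    have k2 := key (-(w x ⨯₃ w y)) fun v hv => by
      rw [neg_dotProduct, cross_dot_eq_det3, hz v hv, neg_zero]
    rw [neg_dotProduct] at k2
    rw [cross_dot_eq_det3] at k1 k2
    exact hw.gen x y u (fun e => hxy (hw.eq_of_mod hW ha hxW hyW e))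
      (fun e => huJ.1 (hw.eq_of_mod hW ha hu hxW e.symm))
      (fun e => huJ.2 (hw.eq_of_mod hW ha hu hyW e.symm)) (by linarith)
  -- A point inside a triangle of others is in their cone and could be dropped, against minimality.
  · have hlt : (J.erase p).card < J.card := Finset.card_erase_lt_of_mem hp
    refine absurd (hmin (J.erase p) ?_) (by omega)
    rw [Finset.mem_filter, Finset.mem_powerset]
    refine ⟨(Finset.erase_subset _ _).trans hJW, hJh.trans ?_⟩
    rw [Submodule.span_le]
    have hE : ∀ u ∈ J, u ≠ p → w u ∈ PointedCone.hull ℝ (w '' (J.erase p : Finset ℕ)) :=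
      fun u hu h => Submodule.subset_span ⟨u, by simpa using ⟨hu, h⟩, rfl⟩
    have hpos := det3_pos_of_dot (ha x (hJW hx)) (ha y (hJW hy)) (ha z (hJW hz)) (ha p (hJW hp))
      h1 h2 h3
    unfold ori at h1 h2 h3
    rintro _ ⟨u, hu, rfl⟩
    by_cases hup : u = p
    · subst hup
      refine mem_hull_of_det3 h1.le h2.le h3.le hpos (hE x hx ?_) (hE y hy ?_) (hE z hz ?_)
      · rintro rfl
        rw [det3_self_outer] at h1
        exact h1.false
      · rintro rfl
        rw [det3_self_right] at h1
        exact h1.false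
      · rintro rfl
        rw [det3_self_right] at h2
        exact h2.false
    · exact hE u hu hup
  · have : PointedCone.hull ℝ (w '' J) = PointedCone.hull ℝ (w '' W) :=
      le_antisymm (Submodule.span_mono (Set.image_mono (by exact_mod_cast hJW))) hJh
    rw [projCone, projCone, this]

/-- Points of an island may be interior, so one first passes to an independent generating subset;
the length of the resulting list is not `k` in general. -/
theorem IsProjIsland.exists_isPoly {n : ℕ} {w : ℕ → Fin 3 → ℝ} (hw : PointConfig n w) {k : ℕ}
    (hk : 3 ≤ k) {G : Set RP2} (hG : IsProjIsland hw.points k G) :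
    ∃ r T, IsPoly n w r T ∧ G = region w (T ++ [r]) := by
  obtain ⟨I, hI, rfl, hH, hd⟩ := hG
  obtain ⟨W, a, hW, ha, hc, hWI, rfl⟩ := exists_signs hw hI hH
  obtain ⟨J, hJ, hJ3, hJi, e⟩ := exists_independent hw hW ha (by omega)
  obtain ⟨r, T, hP, -, e'⟩ := RAM.exists_isPoly hw (fun u hu => hW u (hJ hu))
    (fun u hu => ha u (hJ hu)) hJ3 hJi
  exact ⟨r, T, hP, by rw [← e, e']⟩

/-! ### The counts of the program are the numbers of regions -/

/-- The family of sets that is counted in the given mode. -/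
def Mode.family (P : Set RP2) : Mode → ℕ → Set (Set RP2)
  | .gon, k => {G | IsProjGon P k G}
  | .hole, k => {G | IsProjHole P k G}
  | .island, k => {G | IsProjIsland P k G}

theorem family_eq {n m : ℕ} {w : ℕ → Fin 3 → ℝ} (hw : PointConfig n w) (md : Mode) {k : ℕ}
    (hk : 3 ≤ k) (hkm : k ≤ m) :
    md.family hw.points k = region w '' (polys md n m w k : Set (List ℕ)) := by
  ext G
  rw [Set.mem_image]
  simp only [Finset.mem_coe, mem_polys hkm]
  constructor
  · intro h
    cases md with
    | gon =>
      obtain ⟨r, T, hP, hl, rfl⟩ := IsProjGon.exists_isPoly hw hk h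
      exact ⟨_, ⟨r, T, rfl, hP, hl⟩, rfl⟩
    | hole =>
      obtain ⟨r, T, hP, hl, rfl⟩ := IsProjGon.exists_isPoly hw hk h.1
      exact ⟨_, ⟨r, T, rfl, hP, hl, (hP.disjoint_interior_iff hw).1 h.2⟩, rfl⟩
    | island =>
      obtain ⟨r, T, hP, rfl⟩ := IsProjIsland.exists_isPoly hw hk h
      exact ⟨_, ⟨r, T, rfl, hP, (hP.isProjIsland_iff hw).1 h⟩, rfl⟩
  · rintro ⟨_, ⟨r, T, rfl, hP, hs⟩, rfl⟩
    cases md with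
    | gon => exact hs ▸ hP.isProjGon hw
    | hole => exact ⟨hs.1 ▸ hP.isProjGon hw, (hP.disjoint_interior_iff hw).2 hs.2⟩
    | island => exact (hP.isProjIsland_iff hw).2 hs

theorem isCount_family {n m : ℕ} {w : ℕ → Fin 3 → ℝ} (hw : PointConfig n w) (md : Mode) {k : ℕ}
    (hk : 3 ≤ k) (hkm : k ≤ m) :
    IsCount (total n (chainCount md n m (ori w)) k : ℕ) (md.family hw.points k) := by
  rw [family_eq hw md hk hkm, total_eq_card md hkm]
  refine ⟨(Finset.finite_toSet _).image _, ?_⟩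
  rw [Set.InjOn.ncard_image, Set.ncard_coe_finset]
  intro L hL L' hL' h
  obtain ⟨r, T, rfl, hP, -⟩ := (mem_polys hkm).1 (Finset.mem_coe.1 hL)
  obtain ⟨r', T', rfl, hP', -⟩ := (mem_polys hkm).1 (Finset.mem_coe.1 hL')
  exact hP.eq_of_region hw hP' h

end RAM

/-! ### The input points as a configuration of signed vectors -/

namespace RAM

theorem initC_point {n : ℕ} (p : Fin n → ℝ × ℝ) (i : Fin n) :
    initC p (2 * i) = (p i).1 ∧ initC p (2 * i + 1) = (p i).2 := by
  have := i.2
  constructor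
  · rw [initC, if_neg (by omega), if_neg (by omega)]
    simp [start]
  · rw [initC, if_neg (by omega), if_neg (by omega)]
    have h : (2 * (i : ℕ) + 1) / 2 = i := by omega
    simp [start, h]

theorem sgnPt_lt {n : ℕ} (p : Fin n → ℝ × ℝ) (i : Fin n) :
    sgnPt n (initC p) i = ![(p i).1, (p i).2, 1] := by
  have hi := i.2
  have h1 : (i : ℕ) % (2 * n) = i := Nat.mod_eq_of_lt (by omega)
  have h2 : initC p (2 * n) = 1 := by simp [initC]
  rw [sgnPt, h1, Nat.mod_eq_of_lt hi, Nat.div_eq_of_lt hi, Nat.add_zero, h2,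
    (initC_point p i).1, (initC_point p i).2, mul_one, mul_one]

/-- Adding `n` modulo `2 * n` keeps the index of the point and exchanges the sign cells `2 * n` and
`2 * n + 1`. -/
theorem sgnPt_add {n : ℕ} (hn : 0 < n) (p : Fin n → ℝ × ℝ) (u : ℕ) :
    sgnPt n (initC p) (u + n) = -sgnPt n (initC p) u := by
  have h1 : initC p (2 * n) = 1 := by simp [initC]
  have h2 : initC p (2 * n + 1) = -1 := by simp [initC]
  have h3 : (u + n) % (2 * n) % n = u % (2 * n) % n := by
    rw [Nat.mod_mul_left_mod, Nat.mod_mul_left_mod, Nat.add_mod_right]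
  have h4 : u % (2 * n) < 2 * n := Nat.mod_lt _ (by omega)
  have h5 : (u + n) % (2 * n) = if u % (2 * n) < n then u % (2 * n) + n else u % (2 * n) - n := by
    rw [Nat.add_mod, Nat.mod_eq_of_lt (show n < 2 * n by omega)]
    exact anti_eq h4
  unfold sgnPt
  rw [h3]
  have h6 : initC p (2 * n + (u + n) % (2 * n) / n) = -initC p (2 * n + u % (2 * n) / n) := by
    by_cases h : u % (2 * n) < n
    · rw [h5, if_pos h, Nat.div_eq_of_lt h, Nat.add_div_right _ hn, Nat.div_eq_of_lt h]
      simp [h1, h2]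
    · have e : u % (2 * n) / n = 1 := Nat.div_eq_of_lt_le (by omega) (by omega)
      rw [h5, if_neg h, Nat.div_eq_of_lt (by omega), e]
      simp [h1, h2]
  rw [h6]
  ext i
  fin_cases i <;> simp

theorem pointConfig {n : ℕ} (hn : 0 < n) {p : Fin n → ℝ × ℝ} (hp : Function.Injective p)
    (hg : GeneralPosition (Set.range fun i => affinePoint (p i))) :
    ∃ hw : PointConfig n (sgnPt n (initC p)),
      hw.points = Set.range fun i => affinePoint (p i) := by
  set w := sgnPt n (initC p) with hw
  have hadd : ∀ u, w (u + n) = -w u := sgnPt_add hn p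
  have hmul : ∀ k u, w (u + n * k) = w u ∨ w (u + n * k) = -w u := by
    intro k u
    induction k with
    | zero => simp
    | succ k ih =>
      rw [Nat.mul_succ, ← Nat.add_assoc, hadd, neg_inj]
      rcases ih with h | h
      · exact Or.inr h
      · left; rw [h, neg_neg]
  have hfin : ∀ u, w u = w (u % n) ∨ w u = -w (u % n) := fun u => by
    have := hmul (u / n) (u % n)
    rwa [Nat.mod_add_div] at this
  have hval : ∀ i : Fin n, w i = ![(p i).1, (p i).2, 1] := sgnPt_lt p
  have hmod : ∀ u, w (u % n) =
      ![(p ⟨u % n, Nat.mod_lt _ hn⟩).1, (p ⟨u % n, Nat.mod_lt _ hn⟩).2, 1] :=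
    fun u => hval ⟨u % n, Nat.mod_lt _ hn⟩
  have hne' : ∀ u, w (u % n) ≠ 0 := fun u h => by
    have := congrFun ((hmod u).symm.trans h) 2
    simp at this
  have hne : ∀ u, w u ≠ 0 := fun u => by
    rcases hfin u with h | h <;> rw [h]
    · exact hne' u
    · exact neg_ne_zero.2 (hne' u)
  have hpt : ∀ u, Projectivization.mk ℝ (w u) (hne u) =
      affinePoint (p ⟨u % n, Nat.mod_lt _ hn⟩) := by
    intro u
    rw [affinePoint, Projectivization.mk_eq_mk_iff']
    rcases hfin u with h | h
    · exact ⟨1, by rw [h, hmod, one_smul]⟩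
    · exact ⟨-1, by rw [h, hmod, neg_one_smul]⟩
  have haff : ∀ q q' : ℝ × ℝ, affinePoint q = affinePoint q' → q = q' := by
    intro q q' h
    obtain ⟨c, hc⟩ := (Projectivization.mk_eq_mk_iff' ℝ _ _ _ _).1 h
    have h0 := congrFun hc 0
    have h1 := congrFun hc 1
    have h2 := congrFun hc 2
    simp at h0 h1 h2
    subst h2
    ext <;> linarith
  have hinj : ∀ u v, Projectivization.mk ℝ (w u) (hne u) = Projectivization.mk ℝ (w v) (hne v) →
      u % n = v % n := by
    intro u v h
    rw [hpt, hpt] at h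
    simpa using hp (haff _ _ h)
  have hgen : ∀ u v x, u % n ≠ v % n → u % n ≠ x % n → v % n ≠ x % n →
      det3 (w u) (w v) (w x) ≠ 0 := by
    intro u v x h1 h2 h3 h
    refine hg _ ⟨⟨u % n, Nat.mod_lt _ hn⟩, rfl⟩ _ ⟨⟨v % n, Nat.mod_lt _ hn⟩, rfl⟩ _
      ⟨⟨x % n, Nat.mod_lt _ hn⟩, rfl⟩ ?_ ?_ ?_ ?_
    · simp only [← hpt]; exact fun e => h1 (hinj _ _ e)
    · simp only [← hpt]; exact fun e => h2 (hinj _ _ e)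
    · simp only [← hpt]; exact fun e => h3 (hinj _ _ e)
    · simp only [← hpt]
      -- The cross product is the form of the line through the two distinct points; a vanishing
      -- determinant would put the third point on that line, against general position.
      have h0 : w u ⨯₃ w v ≠ 0 := fun h0 => h1 (hinj u v
        ((Projectivization.mk_eq_mk_iff_crossProduct_eq_zero _ _).2 h0))
      refine ⟨_, isProjLine_dot h0, ⟨_, hne u, rfl, ?_⟩, ⟨_, hne v, rfl, ?_⟩, ⟨_, hne x, rfl, ?_⟩⟩
      · rw [cross_dot_eq_det3, det3_self_outer]
      · rw [cross_dot_eq_det3, det3_self_right]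
      · rw [cross_dot_eq_det3, h]
  refine ⟨⟨⟨hn, hadd, hgen⟩, hne, fun u v _ _ => hinj u v⟩, ?_⟩
  ext z
  constructor
  · rintro ⟨u, hu, rfl⟩
    exact ⟨_, (hpt u).symm⟩
  · rintro ⟨i, rfl⟩
    have hi := i.2
    refine ⟨i, show (i : ℕ) < 2 * n by omega, ?_⟩
    refine (hpt i).trans ?_
    simp [Nat.mod_eq_of_lt hi]

end RAM

theorem mainTheorem9 :
    -- k-gons are written to the cells `k`, k-holes to the cells `m + k`
    (∃ (prog : RAM.Program) (C : ℕ), ∀ (n m : ℕ), 1 ≤ n → 3 ≤ m →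
      ∀ p : Fin n → ℝ × ℝ, Function.Injective p →
        GeneralPosition (Set.range fun i => affinePoint (p i)) →
          RAM.Solves prog m p (C * (m * n ^ 4)) (C * (m * n ^ 2)) (fun out =>
            ∀ k : ℕ, 3 ≤ k → k ≤ m →
              IsCount (out k) {G | IsProjGon (Set.range fun i => affinePoint (p i)) k G} ∧
              IsCount (out (m + k))
                {G | IsProjHole (Set.range fun i => affinePoint (p i)) k G})) ∧
    -- k-islands are written to the cells `k`
    (∃ (prog : RAM.Program) (C : ℕ), ∀ (n m : ℕ), 1 ≤ n → 3 ≤ m →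
      ∀ p : Fin n → ℝ × ℝ, Function.Injective p →
        GeneralPosition (Set.range fun i => affinePoint (p i)) →
          RAM.Solves prog m p (C * (m ^ 2 * n ^ 5)) (C * (m ^ 2 * n ^ 3)) (fun out =>
            ∀ k : ℕ, 3 ≤ k → k ≤ m →
              IsCount (out k)
                {G | IsProjIsland (Set.range fun i => affinePoint (p i)) k G})) := by
  refine ⟨⟨RAM.prologue ++ RAM.gonCmd.code 12, 20014, fun n m hn hm p hp hg => ?_⟩,
    ⟨RAM.prologue ++ RAM.islandCmd.code 12, 20014, fun n m hn hm p hp hg => ?_⟩⟩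
  · obtain ⟨hw, hP⟩ := RAM.pointConfig hn hp hg
    refine RAM.solves_of_cmd hn p RAM.gonCmd RAM.gonCmd_wf
      (fun b _ => RAM.initV_le_bounds hm b) (RAM.gonCmd_cost hn hm)
      ((RAM.space_le hn hm).trans (Nat.mul_le_mul_right _ (by norm_num))) fun f hf k h3 hk => ?_
    have hs := RAM.gonCmd_spec hm (RAM.runOK hw.toConfig .gon hm) (RAM.runOK hw.toConfig .hole hm)
      RAM.total_hole_zero (k := k) (by omega) hk
    rw [hf k (by omega), hf (m + k) (by omega), ← hP]
    erw [hs.1, hs.2]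
    exact ⟨RAM.isCount_family hw .gon h3 hk, RAM.isCount_family hw .hole h3 hk⟩
  · obtain ⟨hw, hP⟩ := RAM.pointConfig hn hp hg
    refine RAM.solves_of_cmd hn p RAM.islandCmd RAM.islandCmd_wf
      (fun b _ => RAM.initV_le_bounds hm b) (RAM.islandCmd_cost hn hm)
      ((RAM.space_le_mul hn hm).trans (Nat.mul_le_mul_right _ (by norm_num))) fun f hf k h3 hk => ?_
    have hs := RAM.islandCmd_spec hm (RAM.runOK hw.toConfig .island hm) hk
    rw [hf k (by omega), ← hP]
    erw [hs]
    exact RAM.isCount_family hw .island h3 hk
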